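/- Let $\mu_{\max},\epsilon_{\max},\delta_{\min},\delta_{\max}>0$ and let $\mathcal P$ be the set of $\mathfrak p=(\mu,\epsilon,\delta,\gamma)$ with $0\le\mu\le\mu_{\max}$, $0\le\epsilon\le\epsilon_{\max}$, $\delta_{\min}<\delta<\delta_{\max}$, $0\le\gamma<1$. Let $0<T\le\infty$, and let $\|u\|_{L^\infty([0,T);H^\sigma)}=\sup_{0\le t<T}|u(t,\cdot)|_{H^\sigma(\mathbb R)}$ and $\|u\|_{W^1([0,T);H^{\sigma})}=\|u\|_{L^\infty([0,T);H^{\sigma})}+\|\partial_tu\|_{L^\infty([0,T);H^{\sigma-1})}$. **Weakly coupled system.** Consider $$\partial_t u_l+\partial_x u_l+f_l(u_l,u_r)=0,\qquad \partial_t u_r-\partial_x u_r+f_r(u_l,u_r)=0,\tag{1}$$ where, with $\alpha_1=\frac32\frac{\delta^2-\gamma}{\gamma+\delta}$, $\alpha_2=-3\frac{\gamma\delta(\delta+1)^2}{(\gamma+\delta)^2}$, $\alpha_3=-5\frac{\delta^2(\delta+1)^2\gamma(1-\gamma)}{(\gamma+\delta)^3}$, $\nu=\frac16\frac{1+\gamma\delta}{\delta(\delta+\gamma)}$,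 $\kappa_1=\frac{(1+\gamma\delta)(\delta^2-\gamma)}{3\delta(\gamma+\delta)^2}$, $\kappa_2=\frac{1-\gamma}{3(\gamma+\delta)}$, $\kappa_3=\frac{\gamma-1}{2(\gamma+\delta)}$ and $B(a,b)=\kappa_1(a\partial_x^2a-b\partial_x^2b)+\kappa_2(b\partial_x^2a-a\partial_x^2b)+(\kappa_1+\frac{\kappa_2}2)\big((\partial_xa)^2-(\partial_xb)^2\big)$, $$\begin{aligned}f_l=\ &\tfrac{\epsilon\alpha_1}{2}\partial_x\big((u_l+\tfrac13u_r)(u_l-u_r)\big)+\tfrac{\epsilon^2\alpha_2}3\partial_x\big((u_l-u_r)u_l(u_l+u_r)\big)+\tfrac{\epsilon^3\alpha_3}4\partial_x\big((u_l-\tfrac15u_r)(u_l-u_r)(u_l+u_r)^2\big)\\&-\mu\nu\partial_x^2\partial_t(u_l-u_r)+\mu\epsilon\kappa_3\partial_x\big(\tfrac13(u_l-u_r)\partial_x^2(u_l-u_r)+\tfrac12(\partial_xu_l-\partial_xu_r)^2\big)-\mu\epsilon\,\partial_tB(u_l,u_r),\\ f_r=\ &-\tfrac{\epsilon\alpha_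1}{2}\partial_x\big((\tfrac13u_l+u_r)(u_r-u_l)\big)-\tfrac{\epsilon^2\alpha_2}3\partial_x\big((u_r-u_l)u_r(u_l+u_r)\big)-\tfrac{\epsilon^3\alpha_3}4\partial_x\big((u_r-\tfrac15u_l)(u_r-u_l)(u_l+u_r)^2\big)\\&-\mu\nu\partial_x^2\partial_t(u_r-u_l)-\mu\epsilon\kappa_3\partial_x\big(\tfrac13(u_r-u_l)\partial_x^2(u_r-u_l)+\tfrac12(\partial_xu_r-\partial_xu_l)^2\big)-\mu\epsilon\,\partial_tB(u_r,u_l).\end{aligned}$$ **Green–Naghdi system.** With $h_1=1-\epsilon\zeta$, $h_2=\frac1\delta+\epsilon\zeta$, $L=\partial_x\big(h_2^3\partial_x\frac{h_1v}{h_1+\gamma h_2}\big)$, $U=\partial_x\big(h_1^3\partial_x\frac{h_2v}{h_1+\gamma h_2}\big)$, $\mathcal Q v=-\frac1{3h_1h_2}(h_1L+\gamma h_2U)$ and $\mathcal R v=\frac12\big((h_2\partial_x\frac{h_1v}{h_1+\gamma h_2})^2-\gamma(h_1\partial_x\frac{h_2v}{h_1+\gamma h_2})^2\big)+\frac13\frac{v}{h_1+\gamma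 h_2}\big(\frac{h_1}{h_2}L-\gamma\frac{h_2}{h_1}U\big)$, put $$\begin{aligned}GN_1(\zeta,v)&=\partial_t\zeta+\partial_x\Big(\tfrac{h_1h_2}{h_1+\gamma h_2}v\Big),\\ GN_2(\zeta,v)&=\partial_t(v+\mu\mathcal Qv)+(\gamma+\delta)\partial_x\zeta+\tfrac\epsilon2\partial_x\Big(\tfrac{h_1^2-\gamma h_2^2}{(h_1+\gamma h_2)^2}v^2\Big)-\mu\epsilon\,\partial_x(\mathcal Rv).\end{aligned}$$ **Statement.** Let $s>1/2$, $h,M>0$, and for each $\mathfrak p=(\mu,\epsilon,\delta,\gamma)$ in a subset $S\subseteq\mathcal P$ let $(u_l^{\mathfrak p},u_r^{\mathfrak p})$ be a strong (pointwise) solution of (1) on $[0,T)\times\mathbb R$ such that, for all $\mathfrak p\in S$, $$\|u_l^{\mathfrak p}\|_{W^1([0,T);H^{s+3})}+\|u_r^{\mathfrak p}\|_{W^1([0,T);H^{s+3})}\le M,\qquad 1-\epsilon(u_l^{\mathfrak p}+u_r^{\mathfrak p})\ge h,\qquad \tfrac1\delta+\epsilon(u_l^{\mathfrak p}+u_r^{\mathfrak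 p})\ge h .$$ Put $\zeta^{\mathfrak p}=u_l^{\mathfrak p}+u_r^{\mathfrak p}$ and $v^{\mathfrak p}=(\gamma+\delta)(u_l^{\mathfrak p}-u_r^{\mathfrak p})$. Then $(\zeta^{\mathfrak p},v^{\mathfrak p})$ is consistent with the Green–Naghdi system, of order $s$ on $[0,T)$, at precision $O(\mu\epsilon^2+\epsilon^4)$. That is, the family is uniformly bounded in $L^\infty([0,T);H^{s+3})$, and: 1. for every $\mathfrak p\in S$ there are $r_1,r_2$ with $GN_i(\zeta^{\mathfrak p},v^{\mathfrak p})=(\mu\epsilon^2+\epsilon^4)\,r_i$ $(i=1,2)$ on $[0,T)\times\mathbb R$ and $\|r_1\|_{L^\infty([0,T);H^s)}+\|r_2\|_{L^\infty([0,T);H^s)}\le C$, where $C$ depends only on $s,\mu_{\max},\epsilon_{\max},\delta_{\min},\delta_{\max},h,M$; 2. when $\mu\epsilon^2+\epsilon^4\le\rho$, where $\rho>0$ depends only on $s,\mu_{\max},\epsilon_{\max},\delta_{\min},\delta_{\max},h,M$, the bound of 1 holds with $C$ replaced by $C'\big(\|\zeta^{\mathfrak p}\|_{L^\infty([0,T);H^{s+3})},\|v^{\mathfrak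 p}\|_{L^\infty([0,T);H^{s+3})}\big)$, where the function $C'$, nondecreasing in both arguments, depends only on $s,\mu_{\max},\epsilon_{\max},\delta_{\min},\delta_{\max}$. -/

import Mathlib

open MeasureTheory
open scoped ENNReal

noncomputable section

/-! ### Parameters -/

/-- The dimensionless parameters: shallowness `μ`, nonlinearity `ε`, depth ratio `δ`,
density ratio `γ`. -/
structure Param where
  μ : ℝ
  ε : ℝ
  δ : ℝ
  γ : ℝ

/-- The admissible parameters. -/
def paramSet (μmax εmax δmin δmax : ℝ) : Set Param :=
  {p | 0 ≤ p.μ ∧ p.μ ≤ μmax ∧ 0 ≤ p.ε ∧ p.ε ≤ εmax ∧ δmin < p.δ ∧ p.δ < δmax ∧ 0 ≤ p.γ ∧ p.γ < 1}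

/-- The precision `μ ε² + ε⁴`. -/
def serrePrecision (p : Param) : ℝ := p.μ * p.ε ^ 2 + p.ε ^ 4

/-! ### Sobolev spaces

Functions of time and space are maps `u : ℝ → ℝ → ℝ`, `u t x`. Only spaces `H^σ(ℝ)` with
`σ > 1/2` occur, and their elements are identified with their continuous representatives. -/

/-- The norm `|f|_{H^σ} = ‖(1 - ∂ₓ²)^{σ/2} f‖_{L²} = ‖(1 + (2πξ)²)^{σ/2} 𝓕f(ξ)‖_{L²}`, for `σ ≥ 0`,
where `𝓕` is the Fourier transform on `L²` with kernel `exp(-2πixξ)`; it is `∞` when `f` does not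
belong to `H^σ` (an infimum over the empty set is `∞`). -/
def sobolevENorm (σ : ℝ) (f : ℝ → ℝ) : ℝ≥0∞ :=
  ⨅ hf : MemLp (fun x => (f x : ℂ)) 2 (volume : Measure ℝ),
    eLpNorm (fun ξ : ℝ => (((1 + (2 * Real.pi * ξ) ^ 2) ^ (σ / 2) : ℝ) : ℂ) *
      (Lp.fourierTransformₗᵢ ℝ ℂ (hf.toLp fun x => (f x : ℂ)) : ℝ → ℂ) ξ) 2 (volume : Measure ℝ)

/-- The time interval `[0, T)`, where `T = ⊤` is allowed. -/
def timeInterval (T : EReal) : Set ℝ := {t | 0 ≤ t ∧ (t : EReal) < T}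

/-- The norm of `L^∞([0,T); H^σ)`: the supremum over all times of the `H^σ` norm. -/
def linftyENorm (T : EReal) (σ : ℝ) (u : ℝ → ℝ → ℝ) : ℝ≥0∞ :=
  ⨆ t ∈ timeInterval T, sobolevENorm σ (u t)

/-- `u ∈ L^∞([0,T); H^σ)`. -/
def MemLinfty (T : EReal) (σ : ℝ) (u : ℝ → ℝ → ℝ) : Prop :=
  (∀ t ∈ timeInterval T, Continuous (u t)) ∧ linftyENorm T σ u < ⊤

/-- The time derivative `∂ₜ u` on `[0,T)`, one-sided at `t = 0`. -/
def dt (T : EReal) (u : ℝ → ℝ → ℝ) : ℝ → ℝ → ℝ :=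
  fun t x => derivWithin (fun τ => u τ x) (timeInterval T) t

/-- `u ∈ W¹([0,T); H^σ)`: `u ∈ L^∞([0,T); H^σ)` and `∂ₜ u ∈ L^∞([0,T); H^{σ-1})`. -/
def MemW1 (T : EReal) (σ : ℝ) (u : ℝ → ℝ → ℝ) : Prop :=
  MemLinfty T σ u ∧
  (∀ t ∈ timeInterval T, ∀ x, DifferentiableWithinAt ℝ (fun τ => u τ x) (timeInterval T) t) ∧
  MemLinfty T (σ - 1) (dt T u)

/-- The norm of `W¹([0,T); H^σ)`. -/
def w1ENorm (T : EReal) (σ : ℝ) (u : ℝ → ℝ → ℝ) : ℝ≥0∞ :=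
  linftyENorm T σ u + linftyENorm T (σ - 1) (dt T u)

/-! ### The Green–Naghdi system -/

/-- Depth of the upper layer, `h₁ = 1 - ε ζ`. -/
def depth₁ (p : Param) (ζ : ℝ → ℝ) : ℝ → ℝ := fun x => 1 - p.ε * ζ x

/-- Depth of the lower layer, `h₂ = 1/δ + ε ζ`. -/
def depth₂ (p : Param) (ζ : ℝ → ℝ) : ℝ → ℝ := fun x => 1 / p.δ + p.ε * ζ x

/-- `∂ₓ (h₂³ ∂ₓ (h₁ V / (h₁ + γ h₂)))`. -/
def lowerTerm (γ : ℝ) (h₁ h₂ V : ℝ → ℝ) : ℝ → ℝ :=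
  deriv fun y => h₂ y ^ 3 * deriv (fun z => h₁ z * V z / (h₁ z + γ * h₂ z)) y

/-- `∂ₓ (h₁³ ∂ₓ (h₂ V / (h₁ + γ h₂)))`. -/
def upperTerm (γ : ℝ) (h₁ h₂ V : ℝ → ℝ) : ℝ → ℝ :=
  deriv fun y => h₁ y ^ 3 * deriv (fun z => h₂ z * V z / (h₁ z + γ * h₂ z)) y

/-- The operator `𝒬̄[h₁,h₂] V`. -/
def opQ (γ : ℝ) (h₁ h₂ V : ℝ → ℝ) : ℝ → ℝ := fun x =>
  -1 / (3 * h₁ x * h₂ x) *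
    (h₁ x * lowerTerm γ h₁ h₂ V x + γ * h₂ x * upperTerm γ h₁ h₂ V x)

/-- The operator `ℛ̄[h₁,h₂] V`. -/
def opR (γ : ℝ) (h₁ h₂ V : ℝ → ℝ) : ℝ → ℝ := fun x =>
  1 / 2 * ((h₂ x * deriv (fun z => h₁ z * V z / (h₁ z + γ * h₂ z)) x) ^ 2
      - γ * (h₁ x * deriv (fun z => h₂ z * V z / (h₁ z + γ * h₂ z)) x) ^ 2)
    + 1 / 3 * (V x / (h₁ x + γ * h₂ x)) *
      (h₁ x / h₂ x * lowerTerm γ h₁ h₂ V x - γ * (h₂ x / h₁ x) * upperTerm γ h₁ h₂ V x)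

/-- The flux `h₁ h₂ / (h₁ + γ h₂) v` of the mass equation. -/
def massFlux (p : Param) (ζ v : ℝ → ℝ) : ℝ → ℝ := fun x =>
  depth₁ p ζ x * depth₂ p ζ x / (depth₁ p ζ x + p.γ * depth₂ p ζ x) * v x

/-- `(h₁² - γ h₂²) / (h₁ + γ h₂)² |v|²`. -/
def velocityFlux (p : Param) (ζ v : ℝ → ℝ) : ℝ → ℝ := fun x =>
  (depth₁ p ζ x ^ 2 - p.γ * depth₂ p ζ x ^ 2) / (depth₁ p ζ x + p.γ * depth₂ p ζ x) ^ 2 * v x ^ 2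

/-- `v + μ 𝒬̄[h₁,h₂] v` as a function of time and space. -/
def momentum (p : Param) (ζ v : ℝ → ℝ → ℝ) : ℝ → ℝ → ℝ := fun t x =>
  v t x + p.μ * opQ p.γ (depth₁ p (ζ t)) (depth₂ p (ζ t)) (v t) x

/-- `ℛ̄[h₁,h₂] v`. -/
def quadraticTerm (p : Param) (ζ v : ℝ → ℝ) : ℝ → ℝ :=
  opR p.γ (depth₁ p ζ) (depth₂ p ζ) v

/-- `(ζ, v)` satisfies the Green–Naghdi system on `[0,T)` with right-hand sides `R₁, R₂`; all the
derivatives exist in the classical sense. -/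
def SolvesGN (p : Param) (T : EReal) (ζ v R₁ R₂ : ℝ → ℝ → ℝ) : Prop :=
  ∀ t ∈ timeInterval T, ∀ x : ℝ,
    DifferentiableWithinAt ℝ (fun τ => ζ τ x) (timeInterval T) t ∧
    DifferentiableWithinAt ℝ (fun τ => momentum p ζ v τ x) (timeInterval T) t ∧
    DifferentiableAt ℝ (ζ t) x ∧
    DifferentiableAt ℝ (massFlux p (ζ t) (v t)) x ∧
    DifferentiableAt ℝ (velocityFlux p (ζ t) (v t)) x ∧
    DifferentiableAt ℝ (quadraticTerm p (ζ t) (v t)) x ∧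
    dt T ζ t x + deriv (massFlux p (ζ t) (v t)) x = R₁ t x ∧
    dt T (momentum p ζ v) t x + (p.γ + p.δ) * deriv (ζ t) x
        + p.ε / 2 * deriv (velocityFlux p (ζ t) (v t)) x
        - p.μ * p.ε * deriv (quadraticTerm p (ζ t) (v t)) x = R₂ t x

/-- Consistency of a family `(ζ^p, v^p)`, `p ∈ S`, with the Green–Naghdi system, of order `s` on
`[0,T)`, at precision `O(prec p)`: the family is uniformly bounded in `L^∞([0,T); H^{s+s'})` and
satisfies the system up to `prec p • (r₁, r₂)`, where
`‖(r₁,r₂)‖_{L^∞([0,T); H^s)} ≤ C(‖ζ^p‖_{L^∞([0,T); H^{s+s'})}, ‖v^p‖_{L^∞([0,T); H^{s+s'})})`. -/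
def ConsistentGN (S : Set Param) (T : EReal) (s s' : ℝ) (prec : Param → ℝ)
    (ζ v : Param → ℝ → ℝ → ℝ) (C : ℝ → ℝ → ℝ) : Prop :=
  (∃ K : ℝ, ∀ p ∈ S,
    MemLinfty T (s + s') (ζ p) ∧ MemLinfty T (s + s') (v p) ∧
    linftyENorm T (s + s') (ζ p) + linftyENorm T (s + s') (v p) ≤ ENNReal.ofReal K) ∧
  ∀ p ∈ S, ∃ r₁ r₂ : ℝ → ℝ → ℝ,
    SolvesGN p T (ζ p) (v p) (fun t x => prec p * r₁ t x) (fun t x => prec p * r₂ t x) ∧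
    MemLinfty T s r₁ ∧ MemLinfty T s r₂ ∧
    linftyENorm T s r₁ + linftyENorm T s r₂ ≤
      ENNReal.ofReal (C (linftyENorm T (s + s') (ζ p)).toReal (linftyENorm T (s + s') (v p)).toReal)

/-! ### The weakly coupled system -/

namespace Param

def α₁ (p : Param) : ℝ := 3 / 2 * ((p.δ ^ 2 - p.γ) / (p.γ + p.δ))

def α₂ (p : Param) : ℝ := -3 * (p.γ * p.δ * (p.δ + 1) ^ 2 / (p.γ + p.δ) ^ 2)

def α₃ (p : Param) : ℝ :=
  -5 * (p.δ ^ 2 * (p.δ + 1) ^ 2 * p.γ * (1 - p.γ) / (p.γ + p.δ) ^ 3)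

def ν (p : Param) : ℝ := 1 / 6 * ((1 + p.γ * p.δ) / (p.δ * (p.δ + p.γ)))

def κ₁ (p : Param) : ℝ :=
  (1 + p.γ * p.δ) * (p.δ ^ 2 - p.γ) / (3 * p.δ * (p.γ + p.δ) ^ 2)

def κ₂ (p : Param) : ℝ := (1 - p.γ) / (3 * (p.γ + p.δ))

def κ₃ (p : Param) : ℝ := (p.γ - 1) / (2 * (p.γ + p.δ))

end Param

/-- `κ₁ (a ∂ₓ²a - b ∂ₓ²b) + κ₂ (b ∂ₓ²a - a ∂ₓ²b) + (κ₁ + κ₂/2) ((∂ₓa)² - (∂ₓb)²)`. -/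
def serreBracket (p : Param) (a b : ℝ → ℝ → ℝ) : ℝ → ℝ → ℝ := fun t x =>
  p.κ₁ * (a t x * iteratedDeriv 2 (a t) x - b t x * iteratedDeriv 2 (b t) x)
    + p.κ₂ * (b t x * iteratedDeriv 2 (a t) x - a t x * iteratedDeriv 2 (b t) x)
    + (p.κ₁ + p.κ₂ / 2) * (deriv (a t) x ^ 2 - deriv (b t) x ^ 2)

/-- The nonlinear term `f_l^{ε,μ}(u_l,u_r)`. -/
def serreL (p : Param) (T : EReal) (ul ur : ℝ → ℝ → ℝ) : ℝ → ℝ → ℝ := fun t x =>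
  p.ε * (p.α₁ / 2) * deriv (fun y => (ul t y + 1 / 3 * ur t y) * (ul t y - ur t y)) x
  + p.ε ^ 2 * (p.α₂ / 3) *
      deriv (fun y => (ul t y - ur t y) * ul t y * (ul t y + ur t y)) x
  + p.ε ^ 3 * (p.α₃ / 4) *
      deriv (fun y => (ul t y - 1 / 5 * ur t y) * (ul t y - ur t y) * (ul t y + ur t y) ^ 2) x
  - p.μ * p.ν * iteratedDeriv 2 (dt T (fun τ y => ul τ y - ur τ y) t) x
  + p.μ * p.ε * p.κ₃ *
      deriv (fun y => 1 / 3 * (ul t y - ur t y) *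
          (iteratedDeriv 2 (ul t) y - iteratedDeriv 2 (ur t) y)
        + 1 / 2 * (deriv (ul t) y - deriv (ur t) y) ^ 2) x
  - p.μ * p.ε * dt T (serreBracket p ul ur) t x

/-- The nonlinear term `f_r^{ε,μ}(u_l,u_r)`. -/
def serreR (p : Param) (T : EReal) (ul ur : ℝ → ℝ → ℝ) : ℝ → ℝ → ℝ := fun t x =>
  - (p.ε * (p.α₁ / 2) * deriv (fun y => (1 / 3 * ul t y + ur t y) * (ur t y - ul t y)) x)
  - p.ε ^ 2 * (p.α₂ / 3) *
      deriv (fun y => (ur t y - ul t y) * ur t y * (ul t y + ur t y)) x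
  - p.ε ^ 3 * (p.α₃ / 4) *
      deriv (fun y => (ur t y - 1 / 5 * ul t y) * (ur t y - ul t y) * (ul t y + ur t y) ^ 2) x
  - p.μ * p.ν * iteratedDeriv 2 (dt T (fun τ y => ur τ y - ul τ y) t) x
  - p.μ * p.ε * p.κ₃ *
      deriv (fun y => 1 / 3 * (ur t y - ul t y) *
          (iteratedDeriv 2 (ur t) y - iteratedDeriv 2 (ul t) y)
        + 1 / 2 * (deriv (ur t) y - deriv (ul t) y) ^ 2) x
  - p.μ * p.ε * dt T (serreBracket p ur ul) t x

/-- `(u_l, u_r)` satisfies pointwise on `[0,T) × ℝ` the system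
`∂ₜu_l + ∂ₓu_l + f_l(u_l,u_r) = 0`, `∂ₜu_r - ∂ₓu_r + f_r(u_l,u_r) = 0`. -/
def SolvesSerre (p : Param) (T : EReal) (ul ur : ℝ → ℝ → ℝ) : Prop :=
  ∀ t ∈ timeInterval T, ∀ x : ℝ,
    dt T ul t x + deriv (ul t) x + serreL p T ul ur t x = 0 ∧
    dt T ur t x - deriv (ur t) x + serreR p T ul ur t x = 0

/-- A family of strong solutions `(u_l^p, u_r^p)`, `p ∈ S`, of the weakly coupled system on
`[0,T)`, bounded by `M` in `W¹([0,T); H^{s+3})` uniformly in `p`, both depths being at least `h`. -/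
def SerreFamily (S : Set Param) (T : EReal) (s h M : ℝ) (ul ur : Param → ℝ → ℝ → ℝ) : Prop :=
  ∀ p ∈ S,
    MemW1 T (s + 3) (ul p) ∧ MemW1 T (s + 3) (ur p) ∧
    w1ENorm T (s + 3) (ul p) + w1ENorm T (s + 3) (ur p) ≤ ENNReal.ofReal M ∧
    SolvesSerre p T (ul p) (ur p) ∧
    ∀ t ∈ timeInterval T, ∀ x : ℝ,
      h ≤ depth₁ p (fun y => ul p t y + ur p t y) x ∧
      h ≤ depth₂ p (fun y => ul p t y + ur p t y) x

/-- The deformation `ζ^p = u_l^p + u_r^p`. -/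
def serreZeta (ul ur : Param → ℝ → ℝ → ℝ) : Param → ℝ → ℝ → ℝ :=
  fun p t x => ul p t x + ur p t x

/-- The velocity `v^p = (γ + δ) (u_l^p - u_r^p)`. -/
def serreVelocity (ul ur : Param → ℝ → ℝ → ℝ) : Param → ℝ → ℝ → ℝ :=
  fun p t x => (p.γ + p.δ) * (ul p t x - ur p t x)

end

noncomputable section

open Filter Topology FourierTransform SchwartzMap

/-! ### The Fourier transform on `L²` -/

/-! Put ζ = u_l + u_r and w = u_l - u_r = v / (γ + δ). The dispersive parts of f_l and f_r are
opposite to each other, so they cancel in the sum of the two equations and double in the difference.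
The sum is a conservation law for ζ whose flux is the Taylor polynomial of the Green–Naghdi mass
flux up to ε³. The difference, multiplied by γ + δ, is the Green–Naghdi velocity equation with the
nonlinear flux term truncated after ε³, 𝒬̄ truncated after order ε and ℛ̄ at order zero. The
residual therefore consists of Taylor remainders only: ε⁴ from the fluxes, με² from the dispersive
operators.

These remainders are exact. Since h₁ + γh₂ = (γ + δ)/δ · (1 - qεζ) with q = (1 - γ)δ/(γ + δ), the
only quotient that occurs is P = ζw/(1 - qεζ), and every remainder is a polynomial in ζ, w, P and
their derivatives up to order two, with bounded coefficients (`massFlux_eq`, `velocityFlux_eq`,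
`opQ_eq`, `opR_eq`). Such polynomials are bounded by the algebra property of H^σ for σ > 1/2
(`sobolevENorm_mul_le`), by the stability of H^σ under F ↦ F/(1 - cF) (`UnifH.div_one_sub`), and by
the commutation of ∂ₜ with ∂ₓ (`hasDerivWithinAt_deriv`), which rests on equicontinuity in x.
Uniformity is obtained by indexing all families by the type `SerreData` of all solutions subject to
given bounds: a bound for such a family can depend on nothing else.

For the second statement, h and the time derivatives have to leave the constant. The precision
dominates ε⁴, so a small ρ makes ε small, below a threshold that may depend on h and M. Then εζ is
uniformly small by Sobolev embedding, and the depths exceed a fixed h'. Moreover the equations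
control ∂ₜζ and ∂ₜw in H^{s+2} by w and ζ in H^{s+3}, up to O(ε). For ∂ₜw this requires inverting 1
- 2μν∂ₓ², which regains the two derivatives lost in ∂ₜB, uniformly in μ because that term carries a
factor μ (`sobolevENorm_le_of_elliptic`, `SerreData.exists_dt_bounds`). The same solution thus meets
the hypotheses of the first statement with bounds that involve only the norms of ζ and v
(`SerreData.restrict`). -/

theorem integral_schwartz_smul_fourierInv_toLp {g : ℝ → ℂ} (hg : Integrable g) (hg2 : MemLp g 2)
    (φ : 𝓢(ℝ, ℂ)) :
    ∫ x, φ x • (𝓕⁻ (hg2.toLp g : Lp ℂ 2 (volume : Measure ℝ)) : Lp ℂ 2 (volume : Measure ℝ)) x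
      = ∫ x, φ x • 𝓕⁻ g x := by
  have h1 := congrArg (fun D : 𝓢'(ℝ, ℂ) => D φ)
    (Lp.fourierInv_toTemperedDistribution_eq (hg2.toLp g : Lp ℂ 2 (volume : Measure ℝ)))
  simp only [TemperedDistribution.fourierInv_apply, Lp.toTemperedDistribution_apply] at h1
  rw [← h1]
  have h2 : ∫ x, (𝓕⁻ φ) x • (hg2.toLp g) x = ∫ x, (𝓕⁻ φ) x • g x := by
    apply integral_congr_ae
    filter_upwards [hg2.coeFn_toLp] with x hx
    rw [hx]
  rw [h2, SchwartzMap.fourierInv_coe]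
  have hc : Continuous fun p : ℝ × ℝ => (-innerₗ ℝ) p.1 p.2 := by
    simp only [LinearMap.neg_apply, innerₗ_apply_apply]
    fun_prop
  -- Fubini gives for the integral transform the same duality that defines the transform of tempered
  -- distributions.
  have h3 := VectorFourier.integral_fourierIntegral_smul_eq_flip (μ := volume) (ν := volume)
    (L := -innerₗ ℝ) (f := φ) (g := g) Real.continuous_fourierChar hc φ.integrable hg
  have hflip : (-innerₗ ℝ).flip = (-innerₗ ℝ : ℝ →ₗ[ℝ] ℝ →ₗ[ℝ] ℝ) := by
    ext; simp
  rw [hflip] at h3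
  exact h3

theorem continuous_fourierInv {g : ℝ → ℂ} (hg : Integrable g) : Continuous (𝓕⁻ g) := by
  have hc : Continuous fun p : ℝ × ℝ => (-innerₗ ℝ) p.1 p.2 := by
    simp only [LinearMap.neg_apply, innerₗ_apply_apply]
    fun_prop
  exact VectorFourier.fourierIntegral_continuous Real.continuous_fourierChar hc hg

theorem ae_eq_of_integral_schwartz_eq {f g : ℝ → ℂ} (hf : LocallyIntegrable f)
    (hg : LocallyIntegrable g)
    (h : ∀ φ : 𝓢(ℝ, ℂ), ∫ x, φ x • f x = ∫ x, φ x • g x) : f =ᵐ[volume] g := by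
  refine ae_eq_of_integral_contDiff_smul_eq hf hg fun φ φ_smooth φ_cpt => ?_
  have h₁ : HasCompactSupport (Complex.ofRealCLM ∘ φ) := φ_cpt.comp_left rfl
  have h₂ : ContDiff ℝ (⊤ : ℕ∞) (Complex.ofRealCLM ∘ φ) := by fun_prop
  simpa using h (h₁.toSchwartzMap h₂)

theorem fourierInv_toLp_ae_eq {g : ℝ → ℂ} (hg : Integrable g) (hg2 : MemLp g 2) :
    (𝓕⁻ (hg2.toLp g : Lp ℂ 2 (volume : Measure ℝ)) : Lp ℂ 2 (volume : Measure ℝ))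
      =ᵐ[volume] 𝓕⁻ g :=
  ae_eq_of_integral_schwartz_eq ((Lp.memLp _).locallyIntegrable (by norm_num))
    (continuous_fourierInv hg).locallyIntegrable
    (integral_schwartz_smul_fourierInv_toLp hg hg2)

theorem memLp_fourierInv {g : ℝ → ℂ} (hg : Integrable g) (hg2 : MemLp g 2) :
    MemLp (𝓕⁻ g) 2 :=
  (memLp_congr_ae (fourierInv_toLp_ae_eq hg hg2)).1 (Lp.memLp _)

theorem fourier_toLp_fourierInv {g : ℝ → ℂ} (hg : Integrable g) (hg2 : MemLp g 2)
    (h : MemLp (𝓕⁻ g) 2) :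
    Lp.fourierTransformₗᵢ ℝ ℂ (h.toLp (𝓕⁻ g)) = hg2.toLp g := by
  have : h.toLp (𝓕⁻ g) = 𝓕⁻ (hg2.toLp g : Lp ℂ 2 (volume : Measure ℝ)) := by
    apply Lp.ext
    exact h.coeFn_toLp.trans (fourierInv_toLp_ae_eq hg hg2).symm
  rw [this]
  exact (Lp.fourierTransformₗᵢ ℝ ℂ).apply_symm_apply (hg2.toLp g)

/-- The `L²` Fourier transform of a differentiable function with square integrable derivative. -/
theorem fourier_toLp_deriv {f f' : ℝ → ℂ} (hf : MemLp f 2) (hf' : MemLp f' 2)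
    (hd : ∀ x, HasDerivAt f (f' x) x) :
    (Lp.fourierTransformₗᵢ ℝ ℂ (hf'.toLp f') : ℝ → ℂ) =ᵐ[volume]
      fun ξ => (2 * Real.pi * Complex.I * ξ) * (Lp.fourierTransformₗᵢ ℝ ℂ (hf.toLp f) : ℝ → ℂ) ξ := by
  -- Duality moves the L² transform onto the test function, where the calculus is classical.
  have key : ∀ {k : ℝ → ℂ} (hk : MemLp k 2) (φ : 𝓢(ℝ, ℂ)),
      ∫ x, φ x • (Lp.fourierTransformₗᵢ ℝ ℂ (hk.toLp k) : ℝ → ℂ) x = ∫ x, 𝓕 (φ : ℝ → ℂ) x • k x := by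
    intro k hk φ
    have h1 := congrArg (fun D : 𝓢'(ℝ, ℂ) => D φ)
      (Lp.fourier_toTemperedDistribution_eq (hk.toLp k : Lp ℂ 2 (volume : Measure ℝ)))
    simp only [TemperedDistribution.fourier_apply, Lp.toTemperedDistribution_apply] at h1
    refine h1.symm.trans ?_
    rw [SchwartzMap.fourier_coe]
    apply integral_congr_ae
    filter_upwards [hk.coeFn_toLp] with x hx
    rw [hx]
  have htg : (fun x : ℝ => (2 * Real.pi * Complex.I * x : ℂ)).HasTemperateGrowth := by fun_prop
  refine ae_eq_of_integral_schwartz_eq ((Lp.memLp _).locallyIntegrable (by norm_num)) ?_ ?_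
  · rw [← locallyIntegrableOn_univ]
    exact (((Lp.memLp _).locallyIntegrable (by norm_num)).locallyIntegrableOn _).continuousOn_mul
      (by fun_prop : Continuous fun x : ℝ => (2 * Real.pi * Complex.I * x : ℂ)).continuousOn
      isOpen_univ.isLocallyClosed
  intro φ
  set ψ : 𝓢(ℝ, ℂ) := SchwartzMap.smulLeftCLM ℂ (fun x : ℝ => (2 * Real.pi * Complex.I * x : ℂ)) φ
    with hψ
  have hψx : ∀ x : ℝ, ψ x = (2 * Real.pi * Complex.I * x) * φ x := fun x => by
    rw [hψ, SchwartzMap.smulLeftCLM_apply_apply htg]; rfl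
  have hder : ∀ x, HasDerivAt (𝓕 (φ : ℝ → ℂ)) (-𝓕 (ψ : ℝ → ℂ) x) x := by
    intro x
    have hi : Integrable fun x : ℝ => x • φ x := by
      have h := (ψ.integrable (μ := volume)).const_mul (2 * Real.pi * Complex.I)⁻¹
      refine h.congr (Eventually.of_forall fun x => ?_)
      have h0 : (2 * Real.pi * Complex.I : ℂ) ≠ 0 := Complex.two_pi_I_ne_zero
      simp only [hψx, Complex.real_smul]
      field_simp
    have h := Real.hasDerivAt_fourier (φ.integrable (μ := volume)) hi x
    convert! h using 1
    rw [Real.fourier_eq, Real.fourier_eq, ← integral_neg]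
    congr 1 with y
    simp only [hψx, smul_eq_mul, Circle.smul_def]
    ring
  have hm : ∀ (χ : 𝓢(ℝ, ℂ)), MemLp (𝓕 (χ : ℝ → ℂ)) 2 volume := fun χ => by
    rw [← SchwartzMap.fourier_coe]; exact (𝓕 χ).memLp 2 volume
  -- No boundary terms appear, because all products of the L² functions involved are integrable.
  have hparts := integral_mul_deriv_eq_deriv_mul_of_integrable
    (u := 𝓕 (φ : ℝ → ℂ)) (v := f) (u' := fun x => -𝓕 (ψ : ℝ → ℂ) x) (v' := f')
    (fun x _ => hder x) (fun x _ => hd x) ((hm φ).integrable_mul hf')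
    ((hm ψ).neg.integrable_mul hf) ((hm φ).integrable_mul hf)
  rw [key hf' φ]
  simp only [smul_eq_mul, neg_mul, integral_neg, neg_neg] at hparts ⊢
  rw [hparts]
  have := key hf ψ
  simp only [smul_eq_mul] at this
  rw [← this]
  congr 1 with x
  rw [hψx]
  ring

end

noncomputable section

open Filter Topology FourierTransform SchwartzMap

/-! ### Fourier weights -/

/-- The weight `(1 + (2πξ)²)^{σ/2}`. -/
def bracket (σ ξ : ℝ) : ℝ := (1 + (2 * Real.pi * ξ) ^ 2) ^ (σ / 2)

theorem bracket_pos (σ ξ : ℝ) : 0 < bracket σ ξ := by unfold bracket; positivity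

theorem bracket_add (σ τ ξ : ℝ) : bracket (σ + τ) ξ = bracket σ ξ * bracket τ ξ := by
  unfold bracket
  rw [← Real.rpow_add (by positivity)]
  ring_nf

theorem bracket_zero (ξ : ℝ) : bracket 0 ξ = 1 := by simp [bracket]

theorem bracket_neg (σ ξ : ℝ) : bracket (-σ) ξ = (bracket σ ξ)⁻¹ := by
  have h := bracket_add σ (-σ) ξ
  rw [add_neg_cancel, bracket_zero] at h
  exact eq_inv_of_mul_eq_one_right h.symm

theorem bracket_mono {σ τ : ℝ} (h : σ ≤ τ) (ξ : ℝ) : bracket σ ξ ≤ bracket τ ξ := by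
  unfold bracket
  exact Real.rpow_le_rpow_of_exponent_le (by nlinarith [sq_nonneg (2 * Real.pi * ξ)]) (by linarith)

theorem bracket_two (ξ : ℝ) : bracket 2 ξ = 1 + (2 * Real.pi * ξ) ^ 2 := by
  simp [bracket]

theorem bracket_one_sq (ξ : ℝ) : bracket 1 ξ ^ 2 = 1 + (2 * Real.pi * ξ) ^ 2 := by
  rw [← bracket_two, sq, ← bracket_add]; norm_num

theorem abs_le_bracket_one (ξ : ℝ) : |2 * Real.pi * ξ| ≤ bracket 1 ξ := by
  apply abs_le_of_sq_le_sq _ (bracket_pos _ _).le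
  rw [bracket_one_sq]; linarith

theorem continuous_bracket (σ : ℝ) : Continuous (bracket σ) := by
  unfold bracket
  exact Continuous.rpow_const (by fun_prop) fun x => Or.inl (by positivity)

theorem bracket_sq (σ ξ : ℝ) : bracket σ ξ ^ 2 = (1 + (2 * Real.pi * ξ) ^ 2) ^ σ := by
  unfold bracket
  rw [← Real.rpow_mul_natCast (by positivity)]
  norm_num

/-- Peetre-type inequality: ξ = η + (ξ - η), so the larger of the two brackets on the right controls
the left one. -/
theorem bracket_sq_le {σ : ℝ} (hσ : 0 ≤ σ) (ξ η : ℝ) :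
    bracket σ ξ ^ 2 ≤ 4 ^ σ * (bracket σ η ^ 2 + bracket σ (ξ - η) ^ 2) := by
  simp only [bracket_sq]
  set a := 1 + (2 * Real.pi * η) ^ 2
  set b := 1 + (2 * Real.pi * (ξ - η)) ^ 2
  have ha : 0 < a := by positivity
  have hb : 0 < b := by positivity
  have hab : 1 + (2 * Real.pi * ξ) ^ 2 ≤ 4 * max a b := by
    have h1 : 1 + (2 * Real.pi * ξ) ^ 2 ≤ 2 * a + 2 * b := by
      have := sq_nonneg (2 * Real.pi * η - 2 * Real.pi * (ξ - η))
      simp only [a, b]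
      nlinarith
    linarith [le_max_left a b, le_max_right a b]
  calc (1 + (2 * Real.pi * ξ) ^ 2) ^ σ ≤ (4 * max a b) ^ σ :=
        Real.rpow_le_rpow (by positivity) hab hσ
    _ = 4 ^ σ * (max a b) ^ σ := Real.mul_rpow (by norm_num) (by positivity)
    _ ≤ 4 ^ σ * (a ^ σ + b ^ σ) := by
        gcongr
        rcases max_choice a b with h | h <;> rw [h] <;>
          linarith [Real.rpow_nonneg ha.le σ, Real.rpow_nonneg hb.le σ]

/-- This integrability is the source of the condition σ > 1/2 in the embedding, in the algebra
property and in the equicontinuity of balls. -/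
theorem lintegral_bracket_neg_sq_lt_top {σ : ℝ} (hσ : 1 / 2 < σ) :
    ∫⁻ ξ, ENNReal.ofReal (bracket (-σ) ξ) ^ 2 < ⊤ := by
  have h1 : Integrable fun x : ℝ => (1 + ‖x‖ ^ 2) ^ (-(2 * σ) / 2) :=
    integrable_rpow_neg_one_add_norm_sq (by simp; linarith)
  refine lt_of_le_of_lt (lintegral_mono fun ξ => ?_) h1.lintegral_lt_top
  rw [← ENNReal.ofReal_pow (bracket_pos _ _).le, bracket_sq]
  apply ENNReal.ofReal_le_ofReal
  rw [show -(2 * σ) / 2 = -σ by ring]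
  apply Real.rpow_le_rpow_of_nonpos (by positivity) _ (by linarith)
  rw [Real.norm_eq_abs, sq_abs, mul_pow]
  have : 1 ≤ (2 * Real.pi) ^ 2 := by nlinarith [Real.pi_gt_three]
  nlinarith [sq_nonneg ξ]

/-- The weighted norm `‖(1 + (2πξ)²)^{σ/2} g‖_{L²}`. -/
def weightedNorm (σ : ℝ) (g : ℝ → ℂ) : ℝ≥0∞ :=
  eLpNorm (fun ξ => ((bracket σ ξ : ℝ) : ℂ) * g ξ) 2 volume

theorem eLpNorm_two_sq (g : ℝ → ℂ) : eLpNorm g 2 volume ^ 2 = ∫⁻ ξ, ‖g ξ‖ₑ ^ 2 := by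
  have := eLpNorm_nnreal_pow_eq_lintegral (f := g) (μ := volume) (p := 2) (by norm_num)
  simpa using this

theorem weightedNorm_sq (σ : ℝ) (g : ℝ → ℂ) :
    weightedNorm σ g ^ 2 = ∫⁻ ξ, (ENNReal.ofReal (bracket σ ξ) * ‖g ξ‖ₑ) ^ 2 := by
  rw [weightedNorm, eLpNorm_two_sq]
  congr 1 with ξ
  rw [enorm_mul, ← ofReal_norm (_ : ℂ), Complex.norm_real, Real.norm_of_nonneg (bracket_pos _ _).le]

theorem lintegral_mul_sq_le {f g : ℝ → ℝ≥0∞} (hf : AEMeasurable f) (hg : AEMeasurable g) :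
    (∫⁻ x, f x * g x) ^ 2 ≤ (∫⁻ x, f x ^ 2) * ∫⁻ x, g x ^ 2 := by
  have h := ENNReal.lintegral_mul_le_Lp_mul_Lq volume Real.HolderConjugate.two_two hf hg
  have h2 := pow_le_pow_left' h 2
  rw [mul_pow, ← ENNReal.rpow_mul_natCast, ← ENNReal.rpow_mul_natCast] at h2
  simpa using h2

theorem weightedNorm_mono {σ τ : ℝ} (h : σ ≤ τ) (g : ℝ → ℂ) :
    weightedNorm σ g ≤ weightedNorm τ g := by
  apply eLpNorm_mono
  intro ξ
  rw [norm_mul, norm_mul, Complex.norm_real, Complex.norm_real,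
    Real.norm_of_nonneg (bracket_pos _ _).le, Real.norm_of_nonneg (bracket_pos _ _).le]
  gcongr
  exact bracket_mono h ξ

theorem weightedNorm_zero (g : ℝ → ℂ) : weightedNorm 0 g = eLpNorm g 2 volume := by
  simp [weightedNorm, bracket_zero]

theorem memLp_of_weightedNorm {σ : ℝ} (hσ : 0 ≤ σ) {g : ℝ → ℂ} (hm : AEStronglyMeasurable g volume)
    (hg : weightedNorm σ g < ⊤) : MemLp g 2 :=
  ⟨hm, by rw [← weightedNorm_zero]; exact (weightedNorm_mono hσ g).trans_lt hg⟩

/-- The constant of the embedding of `H^σ` in the bounded functions. -/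
def embeddingConst (σ : ℝ) : ℝ≥0∞ := (∫⁻ ξ, ENNReal.ofReal (bracket (-σ) ξ) ^ 2) ^ (1 / 2 : ℝ)

theorem embeddingConst_lt_top {σ : ℝ} (hσ : 1 / 2 < σ) : embeddingConst σ < ⊤ :=
  ENNReal.rpow_lt_top_of_nonneg (by norm_num) (lintegral_bracket_neg_sq_lt_top hσ).ne

/-- Sobolev embedding on the Fourier side: Cauchy–Schwarz after inserting the product of the weights
of orders σ and -σ, which is 1. -/
theorem lintegral_enorm_le {σ : ℝ} {g : ℝ → ℂ} (hm : AEStronglyMeasurable g volume) :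
    ∫⁻ ξ, ‖g ξ‖ₑ ≤ embeddingConst σ * weightedNorm σ g := by
  have h : (∫⁻ ξ, ‖g ξ‖ₑ) ^ 2 ≤ (embeddingConst σ * weightedNorm σ g) ^ 2 := by
    rw [mul_pow, weightedNorm_sq, embeddingConst, ← ENNReal.rpow_mul_natCast]
    have h1 := lintegral_mul_sq_le (f := fun ξ => ENNReal.ofReal (bracket (-σ) ξ))
      (g := fun ξ => ENNReal.ofReal (bracket σ ξ) * ‖g ξ‖ₑ)
      (continuous_bracket (-σ)).measurable.ennreal_ofReal.aemeasurable
      ((continuous_bracket σ).measurable.ennreal_ofReal.aemeasurable.mul hm.enorm)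
    convert h1 using 2
    · congr 1 with ξ
      rw [← mul_assoc, ← ENNReal.ofReal_mul (bracket_pos _ _).le, ← bracket_add]
      simp [bracket_zero]
    · norm_num
  exact (ENNReal.pow_le_pow_left_iff (by norm_num)).1 h

theorem integrable_of_weightedNorm {σ : ℝ} (hσ : 1 / 2 < σ) {g : ℝ → ℂ}
    (hm : AEStronglyMeasurable g volume) (hg : weightedNorm σ g < ⊤) : Integrable g :=
  ⟨hm, (lintegral_enorm_le hm).trans_lt (ENNReal.mul_lt_top (embeddingConst_lt_top hσ) hg)⟩

/-! ### Functions represented by an integrable Fourier transform -/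

/-- `f` is the inverse Fourier transform of `g ∈ L¹ ∩ L²`. -/
structure FourierRep (f : ℝ → ℝ) (g : ℝ → ℂ) : Prop where
  integrable : Integrable g
  memLp : MemLp g 2
  eq_fourierInv : ∀ x, (f x : ℂ) = 𝓕⁻ g x

namespace FourierRep

variable {f f₁ f₂ : ℝ → ℝ} {g g₁ g₂ : ℝ → ℂ}

theorem coe_eq (h : FourierRep f g) : (fun x => (f x : ℂ)) = 𝓕⁻ g := funext h.eq_fourierInv

theorem continuous (h : FourierRep f g) : Continuous f := by
  have h1 := continuous_fourierInv h.integrable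
  rw [← h.coe_eq] at h1
  exact Complex.continuous_re.comp h1

/-- Allows every Sobolev estimate to be made on an explicit function `g` instead of an almost
everywhere class: the L² transform inverts the integral formula on L¹ ∩ L². -/
theorem sobolevENorm_eq (h : FourierRep f g) (σ : ℝ) : sobolevENorm σ f = weightedNorm σ g := by
  have hm : MemLp (fun x => (f x : ℂ)) 2 (volume : Measure ℝ) := by
    rw [h.coe_eq]; exact memLp_fourierInv h.integrable h.memLp
  unfold sobolevENorm
  rw [iInf_pos hm]
  have h1 : Lp.fourierTransformₗᵢ ℝ ℂ (hm.toLp fun x => (f x : ℂ)) = h.memLp.toLp g := by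
    rw [← fourier_toLp_fourierInv h.integrable h.memLp (memLp_fourierInv h.integrable h.memLp)]
    congr 1
    apply Lp.ext
    filter_upwards [hm.coeFn_toLp, (memLp_fourierInv h.integrable h.memLp).coeFn_toLp] with x h1 h2
    rw [h1, h2, h.eq_fourierInv]
  rw [h1]
  apply eLpNorm_congr_ae
  filter_upwards [h.memLp.coeFn_toLp] with ξ hξ
  rw [hξ]; rfl

/-- For σ > 1/2 the L² transform is integrable, so inversion holds almost everywhere; continuity of
both sides makes it hold at every point. -/
theorem exists_of_sobolevENorm {σ : ℝ} (hσ : 1 / 2 < σ) (hc : Continuous f)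
    (hf : sobolevENorm σ f < ⊤) : ∃ g, FourierRep f g := by
  unfold sobolevENorm at hf
  obtain ⟨hm, hlt⟩ := iInf_lt_top.1 hf
  set G := Lp.fourierTransformₗᵢ ℝ ℂ (hm.toLp fun x => (f x : ℂ)) with hG
  have hmeas : AEStronglyMeasurable (G : ℝ → ℂ) volume := (Lp.memLp G).1
  have hw : weightedNorm σ G < ⊤ := hlt
  have hg_int : Integrable (G : ℝ → ℂ) := integrable_of_weightedNorm hσ hmeas hw
  have hae : (fun x => (f x : ℂ)) =ᵐ[volume] 𝓕⁻ (G : ℝ → ℂ) := by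
    refine EventuallyEq.trans ?_ (fourierInv_toLp_ae_eq hg_int (Lp.memLp G))
    have : 𝓕⁻ ((Lp.memLp G).toLp G : Lp ℂ 2 (volume : Measure ℝ)) = hm.toLp fun x => (f x : ℂ) := by
      rw [Lp.toLp_coeFn, hG]
      exact (Lp.fourierTransformₗᵢ ℝ ℂ).symm_apply_apply _
    rw [this]
    exact hm.coeFn_toLp.symm
  have heq := (Continuous.ae_eq_iff_eq volume (by fun_prop) (continuous_fourierInv hg_int)).1 hae
  exact ⟨G, hg_int, Lp.memLp G, fun x => congrFun heq x⟩

theorem add (h₁ : FourierRep f₁ g₁) (h₂ : FourierRep f₂ g₂) :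
    FourierRep (fun x => f₁ x + f₂ x) (fun ξ => g₁ ξ + g₂ ξ) := by
  refine ⟨h₁.integrable.add h₂.integrable, h₁.memLp.add h₂.memLp, fun x => ?_⟩
  have i₁ := (Real.fourierIntegral_convergent_iff (-x)).2 h₁.integrable
  have i₂ := (Real.fourierIntegral_convergent_iff (-x)).2 h₂.integrable
  simp only [inner_neg_right, neg_neg] at i₁ i₂
  push_cast
  rw [h₁.eq_fourierInv, h₂.eq_fourierInv]
  simp only [Real.fourierInv_eq]
  rw [← integral_add i₁ i₂]
  simp only [smul_add]

theorem const_mul (c : ℝ) (h : FourierRep f g) :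
    FourierRep (fun x => c * f x) (fun ξ => (c : ℂ) * g ξ) := by
  refine ⟨h.integrable.const_mul _, h.memLp.const_mul _, fun x => ?_⟩
  push_cast
  rw [h.eq_fourierInv]
  simp only [Real.fourierInv_eq]
  rw [← integral_const_mul]
  congr 1 with ξ
  simp only [Circle.smul_def, smul_eq_mul]
  ring

theorem mul (h₁ : FourierRep f₁ g₁) (h₂ : FourierRep f₂ g₂)
    (hm : MemLp (convolution g₁ g₂ (ContinuousLinearMap.mul ℂ ℂ) volume) 2) :
    FourierRep (fun x => f₁ x * f₂ x)
      (convolution g₁ g₂ (ContinuousLinearMap.mul ℂ ℂ) volume) := by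
  refine ⟨h₁.integrable.integrable_convolution _ h₂.integrable, hm, fun x => ?_⟩
  push_cast
  rw [h₁.eq_fourierInv, h₂.eq_fourierInv]
  simp only [Real.fourierInv_eq_fourier_neg]
  exact (Real.fourier_mul_convolution_eq h₁.integrable h₂.integrable (-x)).symm

theorem hasDerivAt (h : FourierRep f g) (hg : Integrable fun ξ : ℝ => ξ • g ξ) (x : ℝ) :
    HasDerivAt (fun y => (f y : ℂ)) (𝓕⁻ (fun ξ : ℝ => (2 * Real.pi * Complex.I * ξ) * g ξ) x) x := by
  have h1 := (Real.hasDerivAt_fourier h.integrable hg (-x)).scomp x (hasDerivAt_neg x)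
  have h2 : (𝓕 g ∘ fun y : ℝ => -y) = fun y => (f y : ℂ) := by
    ext y
    rw [h.eq_fourierInv, Real.fourierInv_eq_fourier_neg]; rfl
  rw [h2] at h1
  have h3 : (-1 : ℝ) • 𝓕 (fun x : ℝ => (-2 * Real.pi * Complex.I * x) • g x) (-x)
      = 𝓕⁻ (fun ξ : ℝ => (2 * Real.pi * Complex.I * ξ) * g ξ) x := by
    rw [Real.fourierInv_eq_fourier_neg, Real.fourier_eq, Real.fourier_eq, ← integral_smul]
    congr 1 with ξ
    simp [Circle.smul_def]
  rw [h3] at h1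
  exact h1

end FourierRep
end

noncomputable section

open Filter Topology FourierTransform SchwartzMap

/-! ### The algebra property -/

/-- The square of the constant of the product estimate in `H^σ`. -/
def productConstSq (σ : ℝ) : ℝ≥0∞ :=
  ENNReal.ofReal (4 ^ σ) * (2 * ∫⁻ ξ, ENNReal.ofReal (bracket (-σ) ξ) ^ 2)

theorem productConstSq_lt_top {σ : ℝ} (hσ : 1 / 2 < σ) : productConstSq σ < ⊤ :=
  ENNReal.mul_lt_top ENNReal.ofReal_lt_top
    (ENNReal.mul_lt_top (by norm_num) (lintegral_bracket_neg_sq_lt_top hσ))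

/-- By `bracket_sq_le` the squared quotient of weights is at most 4^σ times the sum of the squared
weights of order -σ at η and at ξ - η. Each of them has an integral independent of ξ. -/
theorem lintegral_kernel_le {σ : ℝ} (hσ : 0 ≤ σ) (ξ : ℝ) :
    ENNReal.ofReal (bracket σ ξ) ^ 2 *
      ∫⁻ η, (ENNReal.ofReal (bracket (-σ) η) * ENNReal.ofReal (bracket (-σ) (ξ - η))) ^ 2
      ≤ productConstSq σ := by
  have hmeas : Measurable fun η => ENNReal.ofReal (bracket (-σ) η) ^ 2 :=
    (continuous_bracket (-σ)).measurable.ennreal_ofReal.pow_const 2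
  rw [← lintegral_const_mul' _ _ (by simp)]
  calc _ ≤ ∫⁻ η, ENNReal.ofReal (4 ^ σ) * (ENNReal.ofReal (bracket (-σ) η) ^ 2
          + ENNReal.ofReal (bracket (-σ) (ξ - η)) ^ 2) := by
        apply lintegral_mono
        intro η
        dsimp only
        have p1 := bracket_pos σ ξ
        have p2 := bracket_pos σ η
        have p3 := bracket_pos σ (ξ - η)
        have q2 := bracket_pos (-σ) η
        have q3 := bracket_pos (-σ) (ξ - η)
        rw [← ENNReal.ofReal_mul q2.le, ← ENNReal.ofReal_pow p1.le, ← ENNReal.ofReal_pow (by positivity),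
          ← ENNReal.ofReal_mul (by positivity), ← ENNReal.ofReal_pow q2.le, ← ENNReal.ofReal_pow q3.le,
          ← ENNReal.ofReal_add (by positivity) (by positivity), ← ENNReal.ofReal_mul (by positivity)]
        apply ENNReal.ofReal_le_ofReal
        rw [bracket_neg, bracket_neg]
        have h := bracket_sq_le hσ ξ η
        calc bracket σ ξ ^ 2 * ((bracket σ η)⁻¹ * (bracket σ (ξ - η))⁻¹) ^ 2
            ≤ (4 ^ σ * (bracket σ η ^ 2 + bracket σ (ξ - η) ^ 2)) *
              ((bracket σ η)⁻¹ * (bracket σ (ξ - η))⁻¹) ^ 2 := by gcongr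
          _ = _ := by field_simp; ring
    _ = productConstSq σ := by
        rw [lintegral_const_mul' _ _ (by simp), lintegral_add_left hmeas,
          lintegral_sub_left_eq_self (fun η => ENNReal.ofReal (bracket (-σ) η) ^ 2) ξ, productConstSq,
          two_mul]

/-- The weights are inserted into the convolution and Cauchy–Schwarz in η separates the kernel of
`lintegral_kernel_le`. What remains is a convolution of two integrable squares, evaluated by
Tonelli. -/
theorem weightedNorm_convolution_sq_le {σ : ℝ} (hσ : 1 / 2 < σ) {g₁ g₂ : ℝ → ℂ}
    (h₁ : AEStronglyMeasurable g₁ volume) (h₂ : AEStronglyMeasurable g₂ volume) :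
    weightedNorm σ (convolution g₁ g₂ (ContinuousLinearMap.mul ℂ ℂ) volume) ^ 2
      ≤ productConstSq σ * (weightedNorm σ g₁ ^ 2 * weightedNorm σ g₂ ^ 2) := by
  have hb : ∀ τ, Measurable fun η => ENNReal.ofReal (bracket τ η) := fun τ =>
    (continuous_bracket τ).measurable.ennreal_ofReal
  set A : ℝ → ℝ≥0∞ := fun η => ENNReal.ofReal (bracket σ η) * ‖g₁ η‖ₑ with hA
  set B : ℝ → ℝ≥0∞ := fun η => ENNReal.ofReal (bracket σ η) * ‖g₂ η‖ₑ with hB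
  have mA : AEMeasurable A := (hb σ).aemeasurable.mul h₁.enorm
  have mB : AEMeasurable B := (hb σ).aemeasurable.mul h₂.enorm
  have hqmp : ∀ ξ : ℝ, Measure.QuasiMeasurePreserving (fun η => ξ - η) volume volume := fun ξ =>
    quasiMeasurePreserving_sub_left volume ξ
  have hpt : ∀ ξ, (ENNReal.ofReal (bracket σ ξ) *
      ‖convolution g₁ g₂ (ContinuousLinearMap.mul ℂ ℂ) volume ξ‖ₑ) ^ 2
      ≤ productConstSq σ * ∫⁻ η, A η ^ 2 * B (ξ - η) ^ 2 := by
    intro ξ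
    have mB' : AEMeasurable fun η => B (ξ - η) := mB.comp_quasiMeasurePreserving (hqmp ξ)
    have hc : ‖convolution g₁ g₂ (ContinuousLinearMap.mul ℂ ℂ) volume ξ‖ₑ ≤
        ∫⁻ η, (A η * B (ξ - η)) *
          (ENNReal.ofReal (bracket (-σ) η) * ENNReal.ofReal (bracket (-σ) (ξ - η))) := by
      refine (enorm_integral_le_lintegral_enorm _).trans (lintegral_mono fun η => ?_)
      simp only [ContinuousLinearMap.mul_apply', enorm_mul, hA, hB]
      have e : ∀ y, ENNReal.ofReal (bracket σ y) * ENNReal.ofReal (bracket (-σ) y) = 1 := fun y => by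
        rw [← ENNReal.ofReal_mul (bracket_pos _ _).le, ← bracket_add]; simp [bracket_zero]
      calc ‖g₁ η‖ₑ * ‖g₂ (ξ - η)‖ₑ
          = (ENNReal.ofReal (bracket σ η) * ENNReal.ofReal (bracket (-σ) η)) *
            (ENNReal.ofReal (bracket σ (ξ - η)) * ENNReal.ofReal (bracket (-σ) (ξ - η))) *
            (‖g₁ η‖ₑ * ‖g₂ (ξ - η)‖ₑ) := by rw [e, e]; simp
        _ ≤ _ := le_of_eq (by ring)
    have hcs := lintegral_mul_sq_le (mA.mul mB')
      (((hb (-σ)).mul ((hb (-σ)).comp (measurable_const_sub ξ))).aemeasurable (μ := volume))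
    calc _ ≤ ENNReal.ofReal (bracket σ ξ) ^ 2 * ((∫⁻ η, (A η * B (ξ - η)) ^ 2) *
            ∫⁻ η, (ENNReal.ofReal (bracket (-σ) η) * ENNReal.ofReal (bracket (-σ) (ξ - η))) ^ 2) := by
          rw [mul_pow]
          gcongr
          exact (pow_le_pow_left' hc 2).trans hcs
      _ = (ENNReal.ofReal (bracket σ ξ) ^ 2 *
            ∫⁻ η, (ENNReal.ofReal (bracket (-σ) η) * ENNReal.ofReal (bracket (-σ) (ξ - η))) ^ 2) *
            ∫⁻ η, (A η * B (ξ - η)) ^ 2 := by ring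
      _ ≤ productConstSq σ * ∫⁻ η, A η ^ 2 * B (ξ - η) ^ 2 := by
          simp only [mul_pow]
          gcongr
          simpa only [mul_pow] using lintegral_kernel_le (by linarith) ξ
  rw [weightedNorm_sq, weightedNorm_sq, weightedNorm_sq]
  calc _ ≤ ∫⁻ ξ, productConstSq σ * ∫⁻ η, A η ^ 2 * B (ξ - η) ^ 2 := lintegral_mono hpt
    _ = productConstSq σ * ∫⁻ ξ, ∫⁻ η, A η ^ 2 * B (ξ - η) ^ 2 :=
        lintegral_const_mul' _ _ (productConstSq_lt_top hσ).ne
    _ = productConstSq σ * ((∫⁻ η, A η ^ 2) * ∫⁻ η, B η ^ 2) := by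
        congr 1
        rw [lintegral_lintegral_swap]
        · have : ∀ η, ∫⁻ ξ, A η ^ 2 * B (ξ - η) ^ 2 = A η ^ 2 * ∫⁻ ξ, B ξ ^ 2 := fun η => by
            have m : AEMeasurable fun ξ => B (ξ - η) := mB.comp_quasiMeasurePreserving
              (measurePreserving_sub_right volume η).quasiMeasurePreserving
            rw [lintegral_const_mul'' _ (m.pow_const 2)]
            congr 1
            exact lintegral_sub_right_eq_self (fun ξ => B ξ ^ 2) η
          simp_rw [this]
          rw [lintegral_mul_const'' _ (mA.pow_const 2)]
        · have m : AEMeasurable (fun z : ℝ × ℝ => B (z.1 - z.2)) (volume.prod volume) :=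
            mB.comp_quasiMeasurePreserving (quasiMeasurePreserving_sub volume volume)
          exact (mA.comp_snd.pow_const 2).mul (m.pow_const 2)

theorem eLpNorm_le_add {f f₁ f₂ : ℝ → ℂ} (h₁ : AEStronglyMeasurable f₁ volume)
    (h₂ : AEStronglyMeasurable f₂ volume) (h : ∀ ξ, ‖f ξ‖ ≤ ‖f₁ ξ‖ + ‖f₂ ξ‖) :
    eLpNorm f 2 volume ≤ eLpNorm f₁ 2 volume + eLpNorm f₂ 2 volume := by
  rw [← eLpNorm_norm f₁, ← eLpNorm_norm f₂]
  calc eLpNorm f 2 volume ≤ eLpNorm ((fun ξ => ‖f₁ ξ‖) + fun ξ => ‖f₂ ξ‖) 2 volume :=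
        eLpNorm_mono_real h
    _ ≤ _ := eLpNorm_add_le h₁.norm h₂.norm (by norm_num)

/-! ### Calculus in `H^σ`, `σ > 1/2` -/

theorem sobolevENorm_mono {σ τ : ℝ} (h : σ ≤ τ) (f : ℝ → ℝ) :
    sobolevENorm σ f ≤ sobolevENorm τ f :=
  iInf_mono fun _ => weightedNorm_mono h _

theorem sobolevENorm_add_le {σ : ℝ} (hσ : 1 / 2 < σ) {f₁ f₂ : ℝ → ℝ} (h₁ : Continuous f₁)
    (h₂ : Continuous f₂) :
    sobolevENorm σ (fun x => f₁ x + f₂ x) ≤ sobolevENorm σ f₁ + sobolevENorm σ f₂ := by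
  rcases eq_top_or_lt_top (sobolevENorm σ f₁) with e | l₁
  · simp [e]
  rcases eq_top_or_lt_top (sobolevENorm σ f₂) with e | l₂
  · simp [e]
  obtain ⟨g₁, r₁⟩ := FourierRep.exists_of_sobolevENorm hσ h₁ l₁
  obtain ⟨g₂, r₂⟩ := FourierRep.exists_of_sobolevENorm hσ h₂ l₂
  rw [(r₁.add r₂).sobolevENorm_eq, r₁.sobolevENorm_eq, r₂.sobolevENorm_eq, weightedNorm,
    weightedNorm, weightedNorm]
  have hb : Continuous fun ξ => ((bracket σ ξ : ℝ) : ℂ) :=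
    Complex.continuous_ofReal.comp (continuous_bracket σ)
  simp only [mul_add]
  exact eLpNorm_add_le (hb.aestronglyMeasurable.mul r₁.memLp.1)
    (hb.aestronglyMeasurable.mul r₂.memLp.1) (by norm_num)

theorem sobolevENorm_const_mul {σ : ℝ} (hσ : 1 / 2 < σ) {f : ℝ → ℝ} (c : ℝ) (hf : Continuous f)
    (hfin : sobolevENorm σ f < ⊤) :
    sobolevENorm σ (fun x => c * f x) = ENNReal.ofReal |c| * sobolevENorm σ f := by
  obtain ⟨g, r⟩ := FourierRep.exists_of_sobolevENorm hσ hf hfin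
  rw [(r.const_mul c).sobolevENorm_eq, r.sobolevENorm_eq, weightedNorm, weightedNorm]
  have : (fun ξ => ((bracket σ ξ : ℝ) : ℂ) * ((c : ℂ) * g ξ))
      = (c : ℂ) • fun ξ => ((bracket σ ξ : ℝ) : ℂ) * g ξ := by
    ext ξ; simp; ring
  rw [this, eLpNorm_const_smul, ← ofReal_norm, Complex.norm_real, Real.norm_eq_abs]

theorem sobolevENorm_mul_le {σ : ℝ} (hσ : 1 / 2 < σ) {f₁ f₂ : ℝ → ℝ} (h₁ : Continuous f₁)
    (h₂ : Continuous f₂) (l₁ : sobolevENorm σ f₁ < ⊤) (l₂ : sobolevENorm σ f₂ < ⊤) :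
    sobolevENorm σ (fun x => f₁ x * f₂ x) ^ 2
      ≤ productConstSq σ * (sobolevENorm σ f₁ ^ 2 * sobolevENorm σ f₂ ^ 2) := by
  obtain ⟨g₁, r₁⟩ := FourierRep.exists_of_sobolevENorm hσ h₁ l₁
  obtain ⟨g₂, r₂⟩ := FourierRep.exists_of_sobolevENorm hσ h₂ l₂
  have hle := weightedNorm_convolution_sq_le hσ r₁.memLp.1 r₂.memLp.1
  rw [r₁.sobolevENorm_eq] at l₁ ⊢
  rw [r₂.sobolevENorm_eq] at l₂ ⊢
  have hlt : weightedNorm σ (convolution g₁ g₂ (ContinuousLinearMap.mul ℂ ℂ) volume) < ⊤ := by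
    have := hle.trans_lt (ENNReal.mul_lt_top (productConstSq_lt_top hσ)
      (ENNReal.mul_lt_top (ENNReal.pow_lt_top l₁) (ENNReal.pow_lt_top l₂)))
    by_contra h
    rw [not_lt_top_iff.1 h] at this
    simp at this
  have hm := memLp_of_weightedNorm (by linarith)
    (r₁.integrable.integrable_convolution (ContinuousLinearMap.mul ℂ ℂ) r₂.integrable).1 hlt
  rw [(r₁.mul r₂ hm).sobolevENorm_eq]
  exact hle

/-- The factor 2πiξ costs one power of the weight. The remaining order σ > 1/2 keeps the product
integrable, which justifies differentiation under the integral. -/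
theorem FourierRep.deriv {σ : ℝ} (hσ : 1 / 2 < σ) {f : ℝ → ℝ} {g : ℝ → ℂ} (r : FourierRep f g)
    (hfin : weightedNorm (σ + 1) g < ⊤) :
    (Differentiable ℝ f ∧
      FourierRep (_root_.deriv f) fun ξ => (2 * Real.pi * Complex.I * ξ) * g ξ) ∧
      weightedNorm σ (fun ξ : ℝ => (2 * Real.pi * Complex.I * ξ) * g ξ) ≤ weightedNorm (σ + 1) g := by
  have hm : AEStronglyMeasurable (fun ξ : ℝ => (2 * Real.pi * Complex.I * ξ) * g ξ) volume :=
    (by fun_prop : Continuous fun ξ : ℝ => (2 * Real.pi * Complex.I * ξ : ℂ)).aestronglyMeasurable.mul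
      r.memLp.1
  have hle : weightedNorm σ (fun ξ : ℝ => (2 * Real.pi * Complex.I * ξ) * g ξ)
      ≤ weightedNorm (σ + 1) g := by
    apply eLpNorm_mono
    intro ξ
    have h1 := abs_le_bracket_one ξ
    have h2 := bracket_pos σ ξ
    have h3 := bracket_pos 1 ξ
    rw [bracket_add]
    simp only [norm_mul, Complex.norm_real, Complex.norm_I, Real.norm_of_nonneg h2.le,
      Real.norm_of_nonneg h3.le, Complex.norm_ofNat, Real.norm_eq_abs, mul_one]
    rw [abs_mul, abs_mul, abs_two] at h1
    rw [← mul_assoc]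
    gcongr
  have hg_int := integrable_of_weightedNorm hσ hm (hle.trans_lt hfin)
  have hxg : Integrable fun ξ : ℝ => ξ • g ξ := by
    have h := hg_int.const_mul (2 * Real.pi * Complex.I)⁻¹
    refine h.congr (Eventually.of_forall fun x => ?_)
    have h0 : (2 * Real.pi * Complex.I : ℂ) ≠ 0 := Complex.two_pi_I_ne_zero
    simp only [Complex.real_smul]
    field_simp
  have hd : ∀ x, HasDerivAt f (𝓕⁻ (fun ξ : ℝ => (2 * Real.pi * Complex.I * ξ) * g ξ) x).re x :=
    fun x => Complex.reCLM.hasFDerivAt.comp_hasDerivAt x (r.hasDerivAt hxg x)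
  refine ⟨⟨fun x => (hd x).differentiableAt, hg_int,
    memLp_of_weightedNorm (by linarith) hm (hle.trans_lt hfin), fun x => ?_⟩, hle⟩
  rw [(hd x).deriv]
  exact (hd x).ofReal_comp.unique (r.hasDerivAt hxg x)

theorem differentiable_of_sobolevENorm {σ : ℝ} (hσ : 1 / 2 < σ) {f : ℝ → ℝ} (hf : Continuous f)
    (hfin : sobolevENorm (σ + 1) f < ⊤) : Differentiable ℝ f := by
  obtain ⟨g, r⟩ := FourierRep.exists_of_sobolevENorm (by linarith : 1 / 2 < σ + 1) hf hfin
  rw [r.sobolevENorm_eq] at hfin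
  exact (r.deriv hσ hfin).1.1

theorem continuous_deriv_of_sobolevENorm {σ : ℝ} (hσ : 1 / 2 < σ) {f : ℝ → ℝ} (hf : Continuous f)
    (hfin : sobolevENorm (σ + 1) f < ⊤) : Continuous (deriv f) := by
  obtain ⟨g, r⟩ := FourierRep.exists_of_sobolevENorm (by linarith : 1 / 2 < σ + 1) hf hfin
  rw [r.sobolevENorm_eq] at hfin
  exact (r.deriv hσ hfin).1.2.continuous

theorem sobolevENorm_deriv_le {σ : ℝ} (hσ : 1 / 2 < σ) {f : ℝ → ℝ} (hf : Continuous f) :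
    sobolevENorm σ (deriv f) ≤ sobolevENorm (σ + 1) f := by
  rcases eq_top_or_lt_top (sobolevENorm (σ + 1) f) with e | hfin
  · simp [e]
  obtain ⟨g, r⟩ := FourierRep.exists_of_sobolevENorm (by linarith : 1 / 2 < σ + 1) hf hfin
  rw [r.sobolevENorm_eq] at hfin ⊢
  rw [(r.deriv hσ hfin).1.2.sobolevENorm_eq]
  exact (r.deriv hσ hfin).2

/-- Converse of the bound of a derivative, from ⟨ξ⟩ ≤ 1 + |2πξ|. There is no lower bound on σ, so it
also serves at σ = 0, where the algebra property is not available. -/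
theorem sobolevENorm_add_one_le (σ : ℝ) {f f' : ℝ → ℝ} (hf : MemLp (fun x => (f x : ℂ)) 2 volume)
    (hf' : MemLp (fun x => (f' x : ℂ)) 2 volume) (hd : ∀ x, HasDerivAt f (f' x) x) :
    sobolevENorm (σ + 1) f ≤ sobolevENorm σ f + sobolevENorm σ f' := by
  unfold sobolevENorm
  rw [iInf_pos hf, iInf_pos hf, iInf_pos hf']
  have hF := fourier_toLp_deriv hf hf' fun x => (hd x).ofReal_comp
  set F := (Lp.fourierTransformₗᵢ ℝ ℂ (hf.toLp fun x => (f x : ℂ)) : ℝ → ℂ) with hFdef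
  have hFm : AEStronglyMeasurable F volume := (Lp.memLp _).1
  have hb : Continuous fun ξ => ((bracket σ ξ : ℝ) : ℂ) :=
    Complex.continuous_ofReal.comp (continuous_bracket σ)
  have hG : eLpNorm (fun ξ : ℝ => (((1 + (2 * Real.pi * ξ) ^ 2) ^ (σ / 2) : ℝ) : ℂ) *
      (Lp.fourierTransformₗᵢ ℝ ℂ (hf'.toLp fun x => (f' x : ℂ)) : ℝ → ℂ) ξ) 2 volume
      = eLpNorm (fun ξ : ℝ => ((bracket σ ξ : ℝ) : ℂ) * ((2 * Real.pi * Complex.I * ξ) * F ξ))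
        2 volume := by
    apply eLpNorm_congr_ae
    filter_upwards [hF] with ξ hξ
    rw [hξ]; rfl
  rw [hG]
  have m1 : AEStronglyMeasurable (fun ξ : ℝ => ((bracket σ ξ : ℝ) : ℂ) * F ξ) volume :=
    hb.aestronglyMeasurable.mul hFm
  have m2 : AEStronglyMeasurable
      (fun ξ : ℝ => ((bracket σ ξ : ℝ) : ℂ) * ((2 * Real.pi * Complex.I * ξ) * F ξ)) volume :=
    hb.aestronglyMeasurable.mul ((by fun_prop :
      Continuous fun ξ : ℝ => (2 * Real.pi * Complex.I * ξ : ℂ)).aestronglyMeasurable.mul hFm)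
  refine eLpNorm_le_add m1 m2 fun ξ => ?_
  change ‖((bracket (σ + 1) ξ : ℝ) : ℂ) * F ξ‖ ≤ ‖((bracket σ ξ : ℝ) : ℂ) * F ξ‖ +
    ‖((bracket σ ξ : ℝ) : ℂ) * ((2 * Real.pi * Complex.I * ξ) * F ξ)‖
  have h2 := bracket_pos σ ξ
  have h3 := bracket_pos 1 ξ
  have h4 : bracket 1 ξ ≤ 1 + |2 * Real.pi * ξ| := by
    apply le_of_sq_le_sq _ (by positivity)
    rw [bracket_one_sq, ← sq_abs]
    nlinarith [abs_nonneg (2 * Real.pi * ξ)]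
  rw [bracket_add]
  simp only [norm_mul, Complex.norm_real, Complex.norm_I, Real.norm_of_nonneg h2.le,
    Real.norm_of_nonneg h3.le, Complex.norm_ofNat, Real.norm_eq_abs, mul_one, Complex.ofReal_mul]
  rw [abs_mul, abs_mul, abs_two] at h4
  calc bracket σ ξ * bracket 1 ξ * ‖F ξ‖
      ≤ bracket σ ξ * (1 + 2 * |Real.pi| * |ξ|) * ‖F ξ‖ := by gcongr
    _ = _ := by ring

theorem sobolevENorm_zero {f : ℝ → ℝ} (hf : MemLp (fun x => (f x : ℂ)) 2 volume) :
    sobolevENorm 0 f = eLpNorm (fun x => (f x : ℂ)) 2 volume := by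
  unfold sobolevENorm
  rw [iInf_pos hf]
  have h1 := (Lp.fourierTransformₗᵢ ℝ ℂ).norm_map (hf.toLp fun x => (f x : ℂ))
  rw [Lp.norm_def, Lp.norm_toLp, ENNReal.toReal_eq_toReal_iff' (Lp.eLpNorm_ne_top _) hf.2.ne] at h1
  simpa using h1

theorem memLp_of_sobolevENorm {σ : ℝ} {f : ℝ → ℝ} (h : sobolevENorm σ f < ⊤) :
    MemLp (fun x => (f x : ℂ)) 2 volume := (iInf_lt_top.1 h).1

theorem enorm_le_sobolevENorm {σ : ℝ} (hσ : 1 / 2 < σ) {f : ℝ → ℝ} (hf : Continuous f)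
    (hfin : sobolevENorm σ f < ⊤) (x : ℝ) : ‖f x‖ₑ ≤ embeddingConst σ * sobolevENorm σ f := by
  obtain ⟨g, r⟩ := FourierRep.exists_of_sobolevENorm hσ hf hfin
  have h1 : ‖f x‖ₑ = ‖(f x : ℂ)‖ₑ := by
    rw [← ofReal_norm, ← ofReal_norm, Complex.norm_real]
  rw [h1, r.eq_fourierInv, Real.fourierInv_eq, r.sobolevENorm_eq]
  refine (enorm_integral_le_lintegral_enorm _).trans ?_
  refine le_trans (le_of_eq ?_) (lintegral_enorm_le r.memLp.1)
  congr 1 with ξ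
  rw [← ofReal_norm, Circle.norm_smul, ofReal_norm]

/-- Balls of `H^σ`, `σ > 1/2`, are uniformly equicontinuous. -/
theorem equicontinuous_of_sobolevENorm {σ : ℝ} (hσ : 1 / 2 < σ) {M : ℝ≥0∞} (hM : M < ⊤) {e : ℝ}
    (he : 0 < e) : ∃ d > 0, ∀ f : ℝ → ℝ, Continuous f → sobolevENorm σ f ≤ M →
      ∀ x y, |x - y| < d → |f x - f y| ≤ e := by
  -- Cauchy–Schwarz bounds |f x - f y|² by `Ω (x - y)` times the squared H^σ norm. `Ω` does not
  -- depend on f and tends to 0 by dominated convergence.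
  set Ω : ℝ → ℝ≥0∞ := fun d =>
    ∫⁻ ξ, (‖(Real.fourierChar (ξ * d) : ℂ) - 1‖ₑ * ENNReal.ofReal (bracket (-σ) ξ)) ^ 2 with hΩ
  have hbm : Measurable fun ξ => ENNReal.ofReal (bracket (-σ) ξ) :=
    (continuous_bracket (-σ)).measurable.ennreal_ofReal
  have hcm : ∀ d : ℝ, Measurable fun ξ : ℝ => ‖(Real.fourierChar (ξ * d) : ℂ) - 1‖ₑ := fun d =>
    (((continuous_subtype_val.comp (Real.continuous_fourierChar.comp
      (continuous_mul_const d))).sub continuous_const).measurable.enorm)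
  have hlim : Tendsto Ω (𝓝 0) (𝓝 0) := by
    have h := tendsto_lintegral_filter_of_dominated_convergence (μ := volume) (l := 𝓝 (0 : ℝ))
      (F := fun d ξ => (‖(Real.fourierChar (ξ * d) : ℂ) - 1‖ₑ * ENNReal.ofReal (bracket (-σ) ξ)) ^ 2)
      (f := fun _ => 0) (fun ξ => (2 * ENNReal.ofReal (bracket (-σ) ξ)) ^ 2)
      (Eventually.of_forall fun d => (((hcm d).mul hbm).pow_const 2))
      (Eventually.of_forall fun d => Eventually.of_forall fun ξ => ?_) ?_
      (Eventually.of_forall fun ξ => ?_)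
    · simpa using h
    · gcongr
      refine (enorm_sub_le).trans ?_
      rw [← ofReal_norm, ← ofReal_norm, Circle.norm_coe, norm_one]
      norm_num
    · simp only [mul_pow]
      rw [lintegral_const_mul' _ _ (by simp)]
      exact (ENNReal.mul_lt_top (by norm_num) (lintegral_bracket_neg_sq_lt_top hσ)).ne
    · have hc : Continuous fun d : ℝ => ‖(Real.fourierChar (ξ * d) : ℂ) - 1‖ₑ :=
        (((continuous_subtype_val.comp (Real.continuous_fourierChar.comp
          (continuous_const_mul ξ))).sub continuous_const).enorm)
      have h0 := hc.tendsto 0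
      simp only [mul_zero, AddChar.map_zero_eq_one, Circle.coe_one, sub_self, enorm_zero] at h0
      have h1 := ENNReal.Tendsto.pow (n := 2)
        (ENNReal.Tendsto.mul_const (b := ENNReal.ofReal (bracket (-σ) ξ)) h0 (Or.inr (by simp)))
      simpa using h1
  have hlim2 : Tendsto (fun d => Ω d * M ^ 2) (𝓝 0) (𝓝 0) := by
    simpa using ENNReal.Tendsto.mul_const (b := M ^ 2) hlim (Or.inr (ENNReal.pow_lt_top hM).ne)
  have hev : ∀ᶠ d in 𝓝 (0 : ℝ), Ω d * M ^ 2 < ENNReal.ofReal e ^ 2 :=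
    hlim2.eventually (gt_mem_nhds (ENNReal.pow_pos (by simpa using he) 2))
  obtain ⟨d, hd, hd'⟩ := Metric.eventually_nhds_iff.1 hev
  refine ⟨d, hd, fun f hf hfM x y hxy => ?_⟩
  obtain ⟨g, r⟩ := FourierRep.exists_of_sobolevENorm hσ hf (hfM.trans_lt hM)
  rw [r.sobolevENorm_eq] at hfM
  have i₁ := (Real.fourierIntegral_convergent_iff (-x)).2 r.integrable
  have i₂ := (Real.fourierIntegral_convergent_iff (-y)).2 r.integrable
  simp only [inner_neg_right, neg_neg] at i₁ i₂
  have h1 : ((f x - f y : ℝ) : ℂ) = ∫ ξ, (Real.fourierChar (inner ℝ ξ x) • g ξ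
      - Real.fourierChar (inner ℝ ξ y) • g ξ) := by
    rw [integral_sub i₁ i₂]
    push_cast
    rw [r.eq_fourierInv, r.eq_fourierInv, Real.fourierInv_eq, Real.fourierInv_eq]
  have h2 : ENNReal.ofReal |f x - f y| ≤ ∫⁻ ξ, (‖(Real.fourierChar (ξ * (x - y)) : ℂ) - 1‖ₑ *
      ENNReal.ofReal (bracket (-σ) ξ)) * (ENNReal.ofReal (bracket σ ξ) * ‖g ξ‖ₑ) := by
    rw [← Real.norm_eq_abs, ← Complex.norm_real, ofReal_norm, h1]
    refine (enorm_integral_le_lintegral_enorm _).trans (le_of_eq ?_)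
    congr 1 with ξ
    have e1 : ENNReal.ofReal (bracket (-σ) ξ) * ENNReal.ofReal (bracket σ ξ) = 1 := by
      rw [← ENNReal.ofReal_mul (bracket_pos _ _).le, ← bracket_add]; simp [bracket_zero]
    have e2 : Real.fourierChar (inner ℝ ξ x) • g ξ - Real.fourierChar (inner ℝ ξ y) • g ξ
        = Real.fourierChar (inner ℝ ξ y) • (((Real.fourierChar (ξ * (x - y)) : ℂ) - 1) * g ξ) := by
      have : (inner ℝ ξ x : ℝ) = inner ℝ ξ y + ξ * (x - y) := by
        simp only [RCLike.inner_apply, conj_trivial]; ring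
      rw [this, AddChar.map_add_eq_mul]
      simp only [Circle.smul_def, smul_eq_mul, Circle.coe_mul]
      ring
    rw [e2, ← ofReal_norm, Circle.norm_smul, ofReal_norm, enorm_mul]
    rw [show ∀ a b c d : ℝ≥0∞, a * b * (c * d) = (b * c) * (a * d) by intros; ring, e1, one_mul]
  have h3 := lintegral_mul_sq_le ((hcm (x - y)).mul hbm).aemeasurable
    (((continuous_bracket σ).measurable.ennreal_ofReal.aemeasurable).mul r.memLp.1.enorm)
  have h4 : ENNReal.ofReal |f x - f y| ^ 2 ≤ ENNReal.ofReal e ^ 2 := by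
    refine (pow_le_pow_left' h2 2).trans (h3.trans ?_)
    refine le_trans ?_ (hd' (y := x - y) (by simpa using hxy)).le
    have := weightedNorm_sq σ g
    simp only [Pi.mul_apply]
    rw [← this]
    gcongr
  have h5 := (ENNReal.pow_le_pow_left_iff (by norm_num)).1 h4
  exact (ENNReal.ofReal_le_ofReal_iff he.le).1 h5

/-- The operator `1 - c ∂ₓ²` gains two derivatives, uniformly for a small coefficient `c`. -/
theorem sobolevENorm_le_of_elliptic {σ c m k : ℝ} (hσ : 1 / 2 < σ) (hc : 0 ≤ c) (hm : 0 ≤ m)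
    (hk : 0 ≤ k) (hmk : ∀ y : ℝ, 0 ≤ y → m * (1 + y) ≤ k * (1 + c * y)) {W A B : ℝ → ℝ}
    (hW : Continuous W) (hW' : sobolevENorm (σ + 2) W < ⊤) (hB : Continuous B)
    (hB' : sobolevENorm σ B < ⊤)
    (heq : ∀ x, W x - c * deriv (deriv W) x = A x + m * B x) :
    sobolevENorm (σ + 2) W ≤ sobolevENorm (σ + 2) A + ENNReal.ofReal k * sobolevENorm σ B := by
  obtain ⟨gW, rW⟩ := FourierRep.exists_of_sobolevENorm (by linarith : 1 / 2 < σ + 2) hW hW'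
  obtain ⟨gB, rB⟩ := FourierRep.exists_of_sobolevENorm hσ hB hB'
  rw [rW.sobolevENorm_eq, show σ + 2 = (σ + 1) + 1 by ring] at hW'
  obtain ⟨⟨-, r1⟩, h1⟩ := rW.deriv (by linarith) hW'
  obtain ⟨⟨-, r2⟩, -⟩ := r1.deriv hσ (h1.trans_lt hW')
  -- No regularity of A is assumed: the equation expresses it through W, W″ and B, which gives its
  -- transform.
  have rA := (rW.add (r2.const_mul (-c))).add (rB.const_mul (-m))
  have hA : A = fun x => W x + -c * deriv (deriv W) x + -m * B x := by
    ext x; linarith [heq x]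
  rw [← hA] at rA
  rw [rW.sobolevENorm_eq, rB.sobolevENorm_eq, rA.sobolevENorm_eq]
  set gA : ℝ → ℂ := fun ξ => gW ξ + ((-c : ℝ) : ℂ) * (2 * Real.pi * Complex.I * ξ *
    (2 * Real.pi * Complex.I * ξ * gW ξ)) + ((-m : ℝ) : ℂ) * gB ξ with hgA
  have hb : ∀ τ, Continuous fun ξ => ((bracket τ ξ : ℝ) : ℂ) := fun τ =>
    Complex.continuous_ofReal.comp (continuous_bracket τ)
  have m1 : AEStronglyMeasurable (fun ξ : ℝ => ((bracket (σ + 2) ξ : ℝ) : ℂ) * gA ξ) volume :=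
    (hb _).aestronglyMeasurable.mul rA.memLp.1
  have m2 : AEStronglyMeasurable (fun ξ : ℝ => (k : ℂ) * (((bracket σ ξ : ℝ) : ℂ) * gB ξ)) volume :=
    ((hb _).aestronglyMeasurable.mul rB.memLp.1).const_mul _
  have hkB : ENNReal.ofReal k * weightedNorm σ gB =
      eLpNorm (fun ξ : ℝ => (k : ℂ) * (((bracket σ ξ : ℝ) : ℂ) * gB ξ)) 2 volume := by
    have := eLpNorm_const_smul (k : ℂ) (fun ξ : ℝ => ((bracket σ ξ : ℝ) : ℂ) * gB ξ) 2 volume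
    rw [← ofReal_norm, Complex.norm_real, Real.norm_of_nonneg hk] at this
    exact this.symm
  rw [hkB, weightedNorm, weightedNorm]
  refine eLpNorm_le_add m1 m2 fun ξ => ?_
  have h2 := bracket_pos σ ξ
  have h3 := bracket_pos 2 ξ
  have h4 := bracket_pos (σ + 2) ξ
  set y := (2 * Real.pi * ξ) ^ 2 with hy
  have hy0 : 0 ≤ y := sq_nonneg _
  have e1 : ((1 + c * y : ℝ) : ℂ) * gW ξ = gA ξ + (m : ℂ) * gB ξ := by
    simp only [hgA, hy]
    push_cast
    linear_combination ((c : ℂ) * (2 * Real.pi * ξ) ^ 2 * gW ξ) * Complex.I_sq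
  have hpos : 0 < 1 + c * y := by positivity
  have e2 : (1 + c * y) * ‖gW ξ‖ ≤ ‖gA ξ‖ + m * ‖gB ξ‖ := by
    have := congrArg norm e1
    rw [norm_mul, Complex.norm_real, Real.norm_of_nonneg hpos.le] at this
    rw [this]
    refine (norm_add_le _ _).trans ?_
    rw [norm_mul, Complex.norm_real, Real.norm_of_nonneg hm]
  simp only [norm_mul, Complex.norm_real, Real.norm_of_nonneg h2.le, Real.norm_of_nonneg h4.le,
    Real.norm_of_nonneg hk]
  -- The two missing derivatives on B are paid by the symbol 1 + cy, through `hmk` at y = (2πξ)².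
  have e3 : m * bracket (σ + 2) ξ ≤ k * (1 + c * y) * bracket σ ξ := by
    rw [bracket_add, bracket_two]
    nlinarith [hmk y hy0]
  refine le_of_mul_le_mul_left ?_ hpos
  calc (1 + c * y) * (bracket (σ + 2) ξ * ‖gW ξ‖)
      = bracket (σ + 2) ξ * ((1 + c * y) * ‖gW ξ‖) := by ring
    _ ≤ bracket (σ + 2) ξ * (‖gA ξ‖ + m * ‖gB ξ‖) := by gcongr
    _ = bracket (σ + 2) ξ * ‖gA ξ‖ + (m * bracket (σ + 2) ξ) * ‖gB ξ‖ := by ring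
    _ ≤ (1 + c * y) * (bracket (σ + 2) ξ * ‖gA ξ‖) + (k * (1 + c * y) * bracket σ ξ) * ‖gB ξ‖ :=
        add_le_add (le_mul_of_one_le_left (by positivity) (le_add_of_nonneg_right (by positivity)))
          (mul_le_mul_of_nonneg_right e3 (norm_nonneg _))
    _ = _ := by ring
end

noncomputable section

open Filter Topology

/-! ### Time derivative of a space derivative -/

theorem slope_sub_deriv_le {k : ℝ → ℝ} (hk : Differentiable ℝ k) {x d e η : ℝ}
    (h : ∀ y, |y - x| < d → |deriv k y - deriv k x| ≤ e) (hη : 0 < η) (hηd : η < d) :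
    |(k (x + η) - k x) / η - deriv k x| ≤ e := by
  obtain ⟨y, ⟨hy1, hy2⟩, hy⟩ := exists_deriv_eq_slope k (show x < x + η by linarith)
    hk.continuous.continuousOn hk.differentiableOn
  rw [add_sub_cancel_left] at hy
  rw [← hy]
  exact h y (by rw [abs_lt]; constructor <;> linarith)

/-- If `u` is differentiable in time and the space derivatives of `∂ₜu(t,·)` are equicontinuous, then
`∂ₓu` is differentiable in time and `∂ₜ∂ₓu = ∂ₓ∂ₜu`. -/
theorem hasDerivWithinAt_deriv {I : Set ℝ} (hI : Convex ℝ I) {u ut : ℝ → ℝ → ℝ}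
    (hu : ∀ t ∈ I, Differentiable ℝ (u t)) (hut : ∀ t ∈ I, Differentiable ℝ (ut t))
    (h : ∀ t ∈ I, ∀ x, HasDerivWithinAt (fun τ => u τ x) (ut t x) I t)
    (heq : ∀ x, ∀ e > 0, ∃ d > 0, ∀ t ∈ I, ∀ y, |y - x| < d →
      |deriv (ut t) y - deriv (ut t) x| ≤ e) {t₀ : ℝ} (ht₀ : t₀ ∈ I) (x : ℝ) :
    HasDerivWithinAt (fun τ => deriv (u τ) x) (deriv (ut t₀) x) I t₀ := by
  rw [hasDerivWithinAt_iff_isLittleO, Asymptotics.isLittleO_iff]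
  intro c hc
  -- The error c is split as c/4 for the time derivative of one difference quotient, c/4 for the
  -- distance of that quotient to its limit, and c/2 for the comparison of two quotients.
  obtain ⟨d, hd, hd'⟩ := heq x (c / 4) (by positivity)
  set S : ℝ → (ℝ → ℝ) → ℝ := fun η k => (k (x + η) - k x) / η with hS
  have hSut : ∀ t ∈ I, ∀ η, 0 < η → η < d → |S η (ut t) - deriv (ut t) x| ≤ c / 4 :=
    fun t ht η h0 h1 => slope_sub_deriv_le (hut t ht) (hd' t ht) h0 h1
  have hSder : ∀ t ∈ I, ∀ η, HasDerivWithinAt (fun τ => S η (u τ)) (S η (ut t)) I t :=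
    fun t ht η => ((h t ht (x + η)).sub (h t ht x)).div_const η
  set η₀ := d / 2 with hη₀
  have hη₀pos : 0 < η₀ := by positivity
  have hη₀d : η₀ < d := by rw [hη₀]; linarith
  -- Mean value inequality in time: two difference quotients of ∂ₜu differ by at most c/2, uniformly
  -- in time. The smaller step η is then sent to 0.
  have hdiff : ∀ t ∈ I, ∀ η, 0 < η → η < d →
      |(S η₀ (u t) - S η (u t)) - (S η₀ (u t₀) - S η (u t₀))| ≤ c / 2 * |t - t₀| := by
    intro t ht η h0 h1
    have := hI.norm_image_sub_le_of_norm_hasDerivWithin_le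
      (f := fun τ => S η₀ (u τ) - S η (u τ)) (f' := fun τ => S η₀ (ut τ) - S η (ut τ)) (C := c / 2)
      (fun τ hτ => (hSder τ hτ η₀).sub (hSder τ hτ η)) (fun τ hτ => ?_) ht₀ ht
    · simpa only [Real.norm_eq_abs] using this
    · have a1 := hSut τ hτ η₀ hη₀pos hη₀d
      have a2 := hSut τ hτ η h0 h1
      rw [Real.norm_eq_abs, abs_le]
      rw [abs_le] at a1 a2
      constructor <;> linarith [a1.1, a1.2, a2.1, a2.2]
  have hlim : ∀ t ∈ I, Tendsto (fun η => S η (u t)) (𝓝[>] 0) (𝓝 (deriv (u t) x)) := by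
    intro t ht
    have := (hu t ht x).hasDerivAt.tendsto_slope_zero_right
    refine this.congr fun η => ?_
    simp only [hS, smul_eq_mul]
    ring
  have hdiff' : ∀ t ∈ I,
      |(S η₀ (u t) - deriv (u t) x) - (S η₀ (u t₀) - deriv (u t₀) x)| ≤ c / 2 * |t - t₀| := by
    intro t ht
    have hl : Tendsto (fun η => |(S η₀ (u t) - S η (u t)) - (S η₀ (u t₀) - S η (u t₀))|) (𝓝[>] 0)
        (𝓝 |(S η₀ (u t) - deriv (u t) x) - (S η₀ (u t₀) - deriv (u t₀) x)|) :=
      (((tendsto_const_nhds.sub (hlim t ht)).sub (tendsto_const_nhds.sub (hlim t₀ ht₀)))).abs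
    refine le_of_tendsto hl ?_
    filter_upwards [Ioo_mem_nhdsGT hd] with η hη using hdiff t ht η hη.1 hη.2
  have hS0 := hSder t₀ ht₀ η₀
  rw [hasDerivWithinAt_iff_isLittleO, Asymptotics.isLittleO_iff] at hS0
  filter_upwards [hS0 (show 0 < c / 4 by positivity), self_mem_nhdsWithin] with t h1 ht
  have h2 := hdiff' t ht
  have h3 := hSut t₀ ht₀ η₀ hη₀pos hη₀d
  simp only [Real.norm_eq_abs, smul_eq_mul] at h1 ⊢
  have h4 : |(t - t₀) * (S η₀ (ut t₀) - deriv (ut t₀) x)| ≤ c / 4 * |t - t₀| := by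
    rw [abs_mul, mul_comm]
    gcongr
  calc |deriv (u t) x - deriv (u t₀) x - (t - t₀) * deriv (ut t₀) x|
      = |(S η₀ (u t) - S η₀ (u t₀) - (t - t₀) * S η₀ (ut t₀))
        + (t - t₀) * (S η₀ (ut t₀) - deriv (ut t₀) x)
        - ((S η₀ (u t) - deriv (u t) x) - (S η₀ (u t₀) - deriv (u t₀) x))| := by congr 1; ring
    _ ≤ c / 4 * |t - t₀| + c / 4 * |t - t₀| + c / 2 * |t - t₀| :=
        (abs_sub _ _).trans (add_le_add ((abs_add_le _ _).trans (add_le_add h1 h4)) h2)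
    _ = c * |t - t₀| := by ring

theorem convex_timeInterval (T : EReal) : Convex ℝ (timeInterval T) := by
  apply Set.OrdConnected.convex
  refine ⟨fun a ha b hb c hc => ⟨ha.1.trans hc.1, lt_of_le_of_lt ?_ hb.2⟩⟩
  exact_mod_cast hc.2

/-- For T > 0 the interval has interior points, so the derivative used in `dt` is determined, at t =
0 included. -/
theorem uniqueDiffOn_timeInterval {T : EReal} (hT : 0 < T) : UniqueDiffOn ℝ (timeInterval T) := by
  obtain ⟨r, hr0, hrT⟩ := EReal.lt_iff_exists_real_btwn.1 hT
  refine uniqueDiffOn_convex (convex_timeInterval T) ⟨r / 2, ?_⟩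
  have hr : (0 : ℝ) < r := by exact_mod_cast hr0
  have hsub : Set.Ioo 0 r ⊆ timeInterval T := fun t ht =>
    ⟨ht.1.le, lt_trans (by exact_mod_cast ht.2) hrT⟩
  refine interior_mono hsub ?_
  rw [interior_Ioo]
  constructor <;> linarith

/-! ### Uniformly bounded families -/

variable {Ω : Type*}

/-- A bounded family of numbers. -/
def UnifBdd (c : Ω → ℝ) : Prop := ∃ K : ℝ, ∀ ω, |c ω| ≤ K

namespace UnifBdd

variable {c d : Ω → ℝ}

theorem const (a : ℝ) : UnifBdd fun _ : Ω => a := ⟨|a|, fun _ => le_rfl⟩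

theorem add (hc : UnifBdd c) (hd : UnifBdd d) : UnifBdd fun ω => c ω + d ω := by
  obtain ⟨K, hK⟩ := hc
  obtain ⟨L, hL⟩ := hd
  exact ⟨K + L, fun ω => (abs_add_le _ _).trans (add_le_add (hK ω) (hL ω))⟩

theorem mul (hc : UnifBdd c) (hd : UnifBdd d) : UnifBdd fun ω => c ω * d ω := by
  obtain ⟨K, hK⟩ := hc
  obtain ⟨L, hL⟩ := hd
  refine ⟨K * L, fun ω => ?_⟩
  rw [abs_mul]
  exact mul_le_mul (hK ω) (hL ω) (abs_nonneg _) ((abs_nonneg _).trans (hK ω))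

theorem neg (hc : UnifBdd c) : UnifBdd fun ω => -c ω := by
  obtain ⟨K, hK⟩ := hc
  exact ⟨K, fun ω => by rw [abs_neg]; exact hK ω⟩

theorem sub (hc : UnifBdd c) (hd : UnifBdd d) : UnifBdd fun ω => c ω - d ω := by
  simpa only [sub_eq_add_neg] using hc.add hd.neg

theorem pow (hc : UnifBdd c) (n : ℕ) : UnifBdd fun ω => c ω ^ n := by
  obtain ⟨K, hK⟩ := hc
  refine ⟨K ^ n, fun ω => ?_⟩
  rw [abs_pow]
  exact pow_le_pow_left₀ (abs_nonneg _) (hK ω) n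

theorem div {a : ℝ} (ha : 0 < a) (hc : UnifBdd c) (hd : ∀ ω, a ≤ d ω) :
    UnifBdd fun ω => c ω / d ω := by
  obtain ⟨K, hK⟩ := hc
  refine ⟨K / a, fun ω => ?_⟩
  rw [abs_div, abs_of_pos (ha.trans_le (hd ω))]
  exact div_le_div₀ ((abs_nonneg _).trans (hK ω)) (hK ω) ha (hd ω)

end UnifBdd

/-- A family of functions of time and space, bounded in `L^∞([0,T); H^σ)`. -/
def UnifH (T : Ω → EReal) (σ : ℝ) (F : Ω → ℝ → ℝ → ℝ) : Prop :=
  ∃ K : ℝ≥0∞, K < ⊤ ∧ ∀ ω, ∀ t ∈ timeInterval (T ω), Continuous (F ω t) ∧ sobolevENorm σ (F ω t) ≤ K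

namespace UnifH

variable {T : Ω → EReal} {σ τ : ℝ} {F G : Ω → ℝ → ℝ → ℝ} {c : Ω → ℝ}

theorem continuous (hF : UnifH T σ F) {ω : Ω} {t : ℝ} (ht : t ∈ timeInterval (T ω)) :
    Continuous (F ω t) := by
  obtain ⟨K, -, h⟩ := hF
  exact (h ω t ht).1

theorem lt_top (hF : UnifH T σ F) {ω : Ω} {t : ℝ} (ht : t ∈ timeInterval (T ω)) :
    sobolevENorm σ (F ω t) < ⊤ := by
  obtain ⟨K, hK, h⟩ := hF
  exact (h ω t ht).2.trans_lt hK

theorem congr (hF : UnifH T σ F) (h : ∀ ω, ∀ t ∈ timeInterval (T ω), ∀ x, G ω t x = F ω t x) :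
    UnifH T σ G := by
  obtain ⟨K, hK, hF⟩ := hF
  refine ⟨K, hK, fun ω t ht => ?_⟩
  rw [show G ω t = F ω t from funext (h ω t ht)]
  exact hF ω t ht

theorem mono (h : σ ≤ τ) (hF : UnifH T τ F) : UnifH T σ F := by
  obtain ⟨K, hK, hF⟩ := hF
  exact ⟨K, hK, fun ω t ht => ⟨(hF ω t ht).1, (sobolevENorm_mono h _).trans (hF ω t ht).2⟩⟩

theorem add (hσ : 1 / 2 < σ) (hF : UnifH T σ F) (hG : UnifH T σ G) :
    UnifH T σ fun ω t x => F ω t x + G ω t x := by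
  obtain ⟨K, hK, hF⟩ := hF
  obtain ⟨L, hL, hG⟩ := hG
  refine ⟨K + L, ENNReal.add_lt_top.2 ⟨hK, hL⟩, fun ω t ht => ⟨(hF ω t ht).1.add (hG ω t ht).1, ?_⟩⟩
  exact (sobolevENorm_add_le hσ (hF ω t ht).1 (hG ω t ht).1).trans
    (add_le_add (hF ω t ht).2 (hG ω t ht).2)

theorem const_mul (hσ : 1 / 2 < σ) (hc : UnifBdd c) (hF : UnifH T σ F) :
    UnifH T σ fun ω t x => c ω * F ω t x := by
  obtain ⟨K, hK, hF⟩ := hF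
  obtain ⟨L, hL⟩ := hc
  refine ⟨ENNReal.ofReal L * K, ENNReal.mul_lt_top ENNReal.ofReal_lt_top hK,
    fun ω t ht => ⟨(hF ω t ht).1.const_mul _, ?_⟩⟩
  rw [sobolevENorm_const_mul hσ _ (hF ω t ht).1 ((hF ω t ht).2.trans_lt hK)]
  exact mul_le_mul' (ENNReal.ofReal_le_ofReal (hL ω)) (hF ω t ht).2

theorem neg (hσ : 1 / 2 < σ) (hF : UnifH T σ F) : UnifH T σ fun ω t x => -F ω t x := by
  simpa using hF.const_mul hσ (UnifBdd.const (-1))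

theorem sub (hσ : 1 / 2 < σ) (hF : UnifH T σ F) (hG : UnifH T σ G) :
    UnifH T σ fun ω t x => F ω t x - G ω t x := by
  simpa only [sub_eq_add_neg] using hF.add hσ (hG.neg hσ)

theorem mul (hσ : 1 / 2 < σ) (hF : UnifH T σ F) (hG : UnifH T σ G) :
    UnifH T σ fun ω t x => F ω t x * G ω t x := by
  obtain ⟨K, hK, hF⟩ := hF
  obtain ⟨L, hL, hG⟩ := hG
  refine ⟨(productConstSq σ * (K ^ 2 * L ^ 2)) ^ (1 / 2 : ℝ),
    ENNReal.rpow_lt_top_of_nonneg (by norm_num) (ENNReal.mul_lt_top (productConstSq_lt_top hσ)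
      (ENNReal.mul_lt_top (ENNReal.pow_lt_top hK) (ENNReal.pow_lt_top hL))).ne,
    fun ω t ht => ⟨(hF ω t ht).1.mul (hG ω t ht).1, ?_⟩⟩
  rw [← ENNReal.pow_le_pow_left_iff two_ne_zero, ← ENNReal.rpow_mul_natCast]
  norm_num
  refine (sobolevENorm_mul_le hσ (hF ω t ht).1 (hG ω t ht).1 ((hF ω t ht).2.trans_lt hK)
    ((hG ω t ht).2.trans_lt hL)).trans ?_
  gcongr
  · exact (hF ω t ht).2
  · exact (hG ω t ht).2

theorem differentiable (hσ : 1 / 2 < σ) (hF : UnifH T (σ + 1) F) {ω : Ω} {t : ℝ}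
    (ht : t ∈ timeInterval (T ω)) : Differentiable ℝ (F ω t) :=
  differentiable_of_sobolevENorm hσ (hF.continuous ht) (hF.lt_top ht)

theorem deriv (hσ : 1 / 2 < σ) (hF : UnifH T (σ + 1) F) :
    UnifH T σ fun ω t x => deriv (F ω t) x := by
  have hF' := hF
  obtain ⟨K, hK, hF⟩ := hF
  exact ⟨K, hK, fun ω t ht => ⟨continuous_deriv_of_sobolevENorm hσ (hF'.continuous ht)
    (hF'.lt_top ht), (sobolevENorm_deriv_le hσ (hF ω t ht).1).trans (hF ω t ht).2⟩⟩

theorem of_hasDerivAt (hF : UnifH T σ F) (hG : UnifH T σ G)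
    (hd : ∀ ω, ∀ t ∈ timeInterval (T ω), ∀ x, HasDerivAt (F ω t) (G ω t x) x) :
    UnifH T (σ + 1) F := by
  have hF' := hF
  have hG' := hG
  obtain ⟨K, hK, hF⟩ := hF
  obtain ⟨L, hL, hG⟩ := hG
  refine ⟨K + L, ENNReal.add_lt_top.2 ⟨hK, hL⟩, fun ω t ht => ⟨(hF ω t ht).1, ?_⟩⟩
  exact (sobolevENorm_add_one_le σ (memLp_of_sobolevENorm (hF'.lt_top ht))
    (memLp_of_sobolevENorm (hG'.lt_top ht)) (hd ω t ht)).trans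
    (add_le_add (hF ω t ht).2 (hG ω t ht).2)

/-- A continuous family dominated by a family bounded in `H^σ` is bounded in `L²`. -/
theorem of_abs_le {a : ℝ} (hσ : 0 ≤ σ) (hF : UnifH T σ F)
    (hG : ∀ ω, ∀ t ∈ timeInterval (T ω), Continuous (G ω t))
    (h : ∀ ω, ∀ t ∈ timeInterval (T ω), ∀ x, |G ω t x| ≤ a * |F ω t x|) : UnifH T 0 G := by
  have hF0 := hF.mono hσ
  have hF0' := hF0
  obtain ⟨K, hK, hF0⟩ := hF0
  refine ⟨ENNReal.ofReal a * K, ENNReal.mul_lt_top ENNReal.ofReal_lt_top hK,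
    fun ω t ht => ⟨hG ω t ht, ?_⟩⟩
  have m := memLp_of_sobolevENorm (hF0'.lt_top ht)
  have hle : ∀ x, ‖((G ω t x : ℝ) : ℂ)‖ ≤ a * ‖((F ω t x : ℝ) : ℂ)‖ := fun x => by
    rw [Complex.norm_real, Complex.norm_real]; exact h ω t ht x
  have mG : MemLp (fun x => (G ω t x : ℂ)) 2 volume :=
    m.of_le_mul (Complex.continuous_ofReal.comp (hG ω t ht)).aestronglyMeasurable
      (Eventually.of_forall hle)
  rw [sobolevENorm_zero mG]
  refine (eLpNorm_le_mul_eLpNorm_of_ae_le_mul (Eventually.of_forall hle) 2).trans ?_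
  rw [← sobolevENorm_zero m]
  gcongr
  exact (hF0 ω t ht).2

/-- `F / (1 - c F)` is bounded in `H^σ` when `1 - c F` is bounded from below. -/
theorem div_one_sub {a : ℝ} (ha : 0 < a) (hσ : 3 / 2 < σ) (hc : UnifBdd c) (hF : UnifH T σ F)
    (h : ∀ ω, ∀ t ∈ timeInterval (T ω), ∀ x, a ≤ 1 - c ω * F ω t x) :
    UnifH T σ fun ω t x => F ω t x / (1 - c ω * F ω t x) := by
  set Y : Ω → ℝ → ℝ → ℝ := fun ω t x => F ω t x / (1 - c ω * F ω t x) with hY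
  have hF1 : UnifH T (σ - 1 + 1) F := by rwa [sub_add_cancel]
  have hF' : UnifH T (σ - 1) fun ω t x => _root_.deriv (F ω t) x := hF1.deriv (by linarith)
  have hYd : ∀ ω, ∀ t ∈ timeInterval (T ω), ∀ x,
      HasDerivAt (Y ω t) (_root_.deriv (F ω t) x / (1 - c ω * F ω t x) ^ 2) x := by
    intro ω t ht x
    have hd := (hF1.differentiable (by linarith) ht x).hasDerivAt
    have hne : 1 - c ω * F ω t x ≠ 0 := (ha.trans_le (h ω t ht x)).ne'
    convert! hd.div ((hd.const_mul (c ω)).const_sub 1) hne using 1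
    field_simp
    ring
  have hYc : ∀ ω, ∀ t ∈ timeInterval (T ω), Continuous (Y ω t) := fun ω t ht =>
    continuous_iff_continuousAt.2 fun x => (hYd ω t ht x).continuousAt
  -- Since 1/(1 - cF) = 1 + cY, the derivative of Y is F′(1 + cY)², a polynomial in F′ and Y.
  have hYe : ∀ ω, ∀ t ∈ timeInterval (T ω), ∀ x,
      _root_.deriv (F ω t) x / (1 - c ω * F ω t x) ^ 2
        = _root_.deriv (F ω t) x + 2 * c ω * (_root_.deriv (F ω t) x * Y ω t x)
          + c ω ^ 2 * (_root_.deriv (F ω t) x * (Y ω t x * Y ω t x)) := by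
    intro ω t ht x
    have hne : 1 - c ω * F ω t x ≠ 0 := (ha.trans_le (h ω t ht x)).ne'
    simp only [hY]
    field_simp
    ring
  -- Bootstrap: the algebra property puts F′(1 + cY)² in H^r as soon as Y is there, so Y gains one
  -- derivative, up to the regularity of F.
  have hstep : ∀ r : ℝ, 1 / 2 < r → r ≤ σ - 1 → UnifH T r Y → UnifH T (r + 1) Y := by
    intro r hr hrσ hYr
    have hFr := hF'.mono hrσ
    have hG := ((hFr.add hr ((hFr.mul hr hYr).const_mul hr ((UnifBdd.const 2).mul hc))).add hr
      ((hFr.mul hr (hYr.mul hr hYr)).const_mul hr (hc.pow 2)))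
    refine hYr.of_hasDerivAt hG fun ω t ht x => ?_
    rw [← hYe ω t ht x]
    exact hYd ω t ht x
  -- The bootstrap cannot start at L². The first derivative comes from the pointwise bounds |Y| ≤
  -- |F|/a and |Y′| ≤ |F′|/a².
  have hbase : UnifH T 1 Y := by
    have h0 : UnifH T 0 Y := by
      refine hF.of_abs_le (a := 1 / a) (by linarith) hYc fun ω t ht x => ?_
      have hp := ha.trans_le (h ω t ht x)
      rw [abs_div, abs_of_pos hp, one_div, ← div_eq_inv_mul]
      exact div_le_div_of_nonneg_left (abs_nonneg _) ha (h ω t ht x)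
    have h1 : UnifH T 0 fun ω t x => _root_.deriv (F ω t) x / (1 - c ω * F ω t x) ^ 2 := by
      refine hF'.of_abs_le (a := 1 / a ^ 2) (by linarith) (fun ω t ht => ?_) fun ω t ht x => ?_
      · exact (hF'.continuous ht).div ((continuous_const.sub
          ((hF.continuous ht).const_mul _)).pow 2)
          fun x => pow_ne_zero 2 (ha.trans_le (h ω t ht x)).ne'
      · have hp := ha.trans_le (h ω t ht x)
        rw [abs_div, abs_of_pos (pow_pos hp 2), one_div, ← div_eq_inv_mul]
        exact div_le_div_of_nonneg_left (abs_nonneg _) (pow_pos ha 2)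
          (pow_le_pow_left₀ ha.le (h ω t ht x) 2)
    simpa using h0.of_hasDerivAt h1 hYd
  have hnat : ∀ n : ℕ, (n : ℝ) + 1 ≤ σ → UnifH T ((n : ℝ) + 1) Y := by
    intro n
    induction n with
    | zero => intro _; simpa using hbase
    | succ n ih =>
      intro hn
      push_cast at hn ⊢
      exact hstep _ (by linarith [n.cast_nonneg (α := ℝ)]) (by linarith) (ih (by linarith))
  -- Integer orders reach ⌊σ - 1⌋ + 1, which lies above σ - 1 and not above σ. A last step from
  -- exactly σ - 1 > 1/2 covers non-integer σ.
  have hfl := Nat.floor_le (show 0 ≤ σ - 1 by linarith)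
  have hlt := Nat.lt_floor_add_one (σ - 1)
  have := hstep (σ - 1) (by linarith) le_rfl
    ((hnat ⌊σ - 1⌋₊ (by linarith)).mono hlt.le)
  rwa [sub_add_cancel] at this

end UnifH
end

noncomputable section

open Filter Topology

variable {Ω : Type*}

/-! ### Families differentiable in time -/

/-- A family bounded in `L^∞([0,T); H^σ)` whose time derivative is bounded in `L^∞([0,T); H^τ)`. -/
structure UnifC1 (T : Ω → EReal) (σ τ : ℝ) (F : Ω → ℝ → ℝ → ℝ) : Prop where
  unifH : UnifH T σ F
  unifH_dt : UnifH T τ fun ω => dt (T ω) (F ω)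
  differentiableWithinAt : ∀ ω, ∀ t ∈ timeInterval (T ω), ∀ x,
    DifferentiableWithinAt ℝ (fun r => F ω r x) (timeInterval (T ω)) t

theorem dt_eq {T : EReal} (hT : 0 < T) {u : ℝ → ℝ → ℝ} {t x a : ℝ} (ht : t ∈ timeInterval T)
    (h : HasDerivWithinAt (fun r => u r x) a (timeInterval T) t) : dt T u t x = a :=
  h.derivWithin (uniqueDiffOn_timeInterval hT t ht)

namespace UnifC1

variable {T : Ω → EReal} {σ τ : ℝ} {F G : Ω → ℝ → ℝ → ℝ} {c : Ω → ℝ}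

theorem hasDerivWithinAt (hF : UnifC1 T σ τ F) {ω : Ω} {t : ℝ} (ht : t ∈ timeInterval (T ω)) (x : ℝ) :
    HasDerivWithinAt (fun r => F ω r x) (dt (T ω) (F ω) t x) (timeInterval (T ω)) t :=
  (hF.differentiableWithinAt ω t ht x).hasDerivWithinAt

theorem of_hasDerivWithinAt (hT : ∀ ω, 0 < T ω) (hF : UnifH T σ F) (hG : UnifH T τ G)
    (h : ∀ ω, ∀ t ∈ timeInterval (T ω), ∀ x,
      HasDerivWithinAt (fun r => F ω r x) (G ω t x) (timeInterval (T ω)) t) : UnifC1 T σ τ F :=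
  ⟨hF, hG.congr fun ω t ht x => dt_eq (hT ω) ht (h ω t ht x),
    fun ω t ht x => (h ω t ht x).differentiableWithinAt⟩

theorem mono {σ' τ' : ℝ} (hσ : σ' ≤ σ) (hτ : τ' ≤ τ) (hF : UnifC1 T σ τ F) : UnifC1 T σ' τ' F :=
  ⟨hF.1.mono hσ, hF.2.mono hτ, hF.3⟩

theorem add (hT : ∀ ω, 0 < T ω) (hσ : 1 / 2 < σ) (hτ : 1 / 2 < τ) (hF : UnifC1 T σ τ F)
    (hG : UnifC1 T σ τ G) : UnifC1 T σ τ fun ω t x => F ω t x + G ω t x :=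
  of_hasDerivWithinAt hT (hF.1.add hσ hG.1) (hF.2.add hτ hG.2) fun _ _ ht x =>
    (hF.hasDerivWithinAt ht x).add (hG.hasDerivWithinAt ht x)

theorem sub (hT : ∀ ω, 0 < T ω) (hσ : 1 / 2 < σ) (hτ : 1 / 2 < τ) (hF : UnifC1 T σ τ F)
    (hG : UnifC1 T σ τ G) : UnifC1 T σ τ fun ω t x => F ω t x - G ω t x :=
  of_hasDerivWithinAt hT (hF.1.sub hσ hG.1) (hF.2.sub hτ hG.2) fun _ _ ht x =>
    (hF.hasDerivWithinAt ht x).sub (hG.hasDerivWithinAt ht x)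

theorem const_mul (hT : ∀ ω, 0 < T ω) (hσ : 1 / 2 < σ) (hτ : 1 / 2 < τ) (hc : UnifBdd c)
    (hF : UnifC1 T σ τ F) : UnifC1 T σ τ fun ω t x => c ω * F ω t x :=
  of_hasDerivWithinAt hT (hF.1.const_mul hσ hc) (hF.2.const_mul hτ hc) fun ω _ ht x =>
    (hF.hasDerivWithinAt ht x).const_mul (c ω)

theorem mul (hT : ∀ ω, 0 < T ω) (hτ : 1 / 2 < τ) (hτσ : τ ≤ σ) (hF : UnifC1 T σ τ F)
    (hG : UnifC1 T σ τ G) : UnifC1 T σ τ fun ω t x => F ω t x * G ω t x :=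
  of_hasDerivWithinAt hT (hF.1.mul (hτ.trans_le hτσ) hG.1)
    ((hF.2.mul hτ (hG.1.mono hτσ)).add hτ ((hF.1.mono hτσ).mul hτ hG.2)) fun _ _ ht x =>
    (hF.hasDerivWithinAt ht x).mul (hG.hasDerivWithinAt ht x)

/-- The bound of ∂ₓ∂ₜF in H^τ, τ > 1/2, supplies the equicontinuity; no continuity of ∂ₜF in time is
required. -/
theorem hasDerivWithinAt_deriv (hσ : 1 / 2 < σ) (hτ : 1 / 2 < τ) (hF : UnifC1 T (σ + 1) (τ + 1) F)
    {ω : Ω} {t : ℝ} (ht : t ∈ timeInterval (T ω)) (x : ℝ) :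
    HasDerivWithinAt (fun r => _root_.deriv (F ω r) x) (_root_.deriv (dt (T ω) (F ω) t) x)
      (timeInterval (T ω)) t := by
  refine _root_.hasDerivWithinAt_deriv (convex_timeInterval _)
    (fun t ht => hF.1.differentiable hσ ht) (fun t ht => hF.2.differentiable hτ ht)
    (fun t ht x => hF.hasDerivWithinAt ht x) (fun x e he => ?_) ht x
  obtain ⟨K, hK, h⟩ := hF.2.deriv hτ
  obtain ⟨d, hd, hd'⟩ := equicontinuous_of_sobolevENorm hτ hK he
  exact ⟨d, hd, fun t ht y hy => hd' _ (h ω t ht).1 (h ω t ht).2 y x hy⟩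

theorem deriv (hT : ∀ ω, 0 < T ω) (hσ : 1 / 2 < σ) (hτ : 1 / 2 < τ)
    (hF : UnifC1 T (σ + 1) (τ + 1) F) : UnifC1 T σ τ fun ω t x => deriv (F ω t) x :=
  of_hasDerivWithinAt hT (hF.1.deriv hσ) (hF.2.deriv hτ) fun _ _ ht x =>
    hF.hasDerivWithinAt_deriv hσ hτ ht x

theorem div_one_sub {a : ℝ} (ha : 0 < a) (hT : ∀ ω, 0 < T ω) (hτ : 1 / 2 < τ)
    (hσ : 3 / 2 < σ) (hτσ : τ ≤ σ) (hc : UnifBdd c) (hF : UnifC1 T σ τ F)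
    (h : ∀ ω, ∀ t ∈ timeInterval (T ω), ∀ x, a ≤ 1 - c ω * F ω t x) :
    UnifC1 T σ τ fun ω t x => F ω t x / (1 - c ω * F ω t x) := by
  have hY := hF.1.div_one_sub ha hσ hc h
  have hYτ := hY.mono hτσ
  -- In time as in space, the derivative of F/(1 - cF) is that of F times (1 + cY)².
  refine of_hasDerivWithinAt hT hY
    ((hF.2.add hτ ((hF.2.mul hτ hYτ).const_mul hτ ((UnifBdd.const 2).mul hc))).add hτ
      ((hF.2.mul hτ (hYτ.mul hτ hYτ)).const_mul hτ (hc.pow 2))) fun ω t ht x => ?_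
  have hd := hF.hasDerivWithinAt ht x
  have hne : 1 - c ω * F ω t x ≠ 0 := (ha.trans_le (h ω t ht x)).ne'
  convert! hd.div ((hd.const_mul (c ω)).const_sub 1) hne using 1
  field_simp
  ring

end UnifC1
end

noncomputable section

open Filter Topology

/-! ### Algebra of the Green–Naghdi operators -/

namespace Param

/-- The coefficient of `h₁ + γ h₂ = (γ + δ) / δ (1 - q ε ζ)`. -/
def q (p : Param) : ℝ := (1 - p.γ) * p.δ / (p.γ + p.δ)

/-- First Taylor coefficient of the mass flux. -/
def c₁ (p : Param) : ℝ := p.δ - 1 + p.q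

/-- Second Taylor coefficient of the mass flux. -/
def c₂ (p : Param) : ℝ := (p.q + p.δ) * (p.q - 1)

variable {p : Param}

/-- Up to the factors 3/2, 3 and 5 produced by the passage from (ζ, w) to (u_l, u_r), the α's are
the Taylor coefficients c₁, c₂, q c₂ of the mass flux. This is what makes the system match
Green–Naghdi up to ε³. -/
theorem α₁_eq (h : p.γ + p.δ ≠ 0) : p.α₁ = 3 / 2 * p.c₁ := by
  unfold α₁ c₁ q
  field_simp
  ring

theorem α₂_eq (h : p.γ + p.δ ≠ 0) : p.α₂ = 3 * p.c₂ := by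
  unfold α₂ c₂ q
  field_simp
  ring

theorem α₃_eq (h : p.γ + p.δ ≠ 0) : p.α₃ = 5 * (p.q * p.c₂) := by
  unfold α₃ c₂ q
  field_simp
  ring

end Param

variable {p : Param}

/-- `ζ w / (1 - q ε ζ)`. -/
def profile (p : Param) (Z W : ℝ → ℝ) : ℝ → ℝ := fun x => Z x / (1 - p.q * p.ε * Z x) * W x

/-- Every denominator h₁ + γh₂ reduces to the single factor 1 - qεζ. -/
theorem depth_sum_eq (hd : p.δ ≠ 0) (h : p.γ + p.δ ≠ 0) (Z : ℝ → ℝ) (x : ℝ) :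
    depth₁ p Z x + p.γ * depth₂ p Z x = (p.γ + p.δ) / p.δ * (1 - p.q * p.ε * Z x) := by
  unfold depth₁ depth₂ Param.q
  field_simp
  ring

/-- With X = εζ the flux is w(1 - X)(1 + δX)/(1 - qX). From order two on its Taylor coefficients are
geometric of ratio q, so the remainder after order three is again a multiple of 1/(1 - qX), that is,
of P. -/
theorem massFlux_eq (hd : p.δ ≠ 0) (h : p.γ + p.δ ≠ 0) (Z W : ℝ → ℝ) {x : ℝ}
    (hne : 1 - p.q * p.ε * Z x ≠ 0) :
    massFlux p Z (fun y => (p.γ + p.δ) * W y) x =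
      (W x + p.ε * (p.c₁ * (Z x * W x)) + p.ε ^ 2 * (p.c₂ * (Z x * (Z x * W x)))
        + p.ε ^ 3 * (p.q * p.c₂ * (Z x * (Z x * (Z x * W x)))))
        + p.ε ^ 4 * (p.q ^ 2 * p.c₂ * (Z x * (Z x * (Z x * profile p Z W x)))) := by
  unfold massFlux
  rw [depth_sum_eq hd h]
  unfold depth₁ depth₂ profile Param.c₁ Param.c₂
  generalize hD : 1 - p.q * p.ε * Z x = D at *
  field_simp
  rw [← hD]
  ring

/-- The quotient in the velocity flux is the derivative of h₁h₂/(h₁ + γh₂) with respect to X = εζ.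
Its Taylor coefficients are therefore proportional to c₁, 2c₂, 3q c₂. -/
theorem velocityFlux_eq (hd : p.δ ≠ 0) (h : p.γ + p.δ ≠ 0) (Z W : ℝ → ℝ) {x : ℝ}
    (hne : 1 - p.q * p.ε * Z x ≠ 0) :
    p.ε / 2 * velocityFlux p Z (fun y => (p.γ + p.δ) * W y) x =
      (p.γ + p.δ) * ((p.ε * (p.c₁ / 2 * (W x * W x)) + p.ε ^ 2 * (p.c₂ * (Z x * (W x * W x)))
        + p.ε ^ 3 * (3 / 2 * (p.q * p.c₂) * (Z x * (Z x * (W x * W x)))))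
        + p.ε ^ 4 * (p.q ^ 2 * p.c₂ / 2 * (4 * (Z x * (Z x * (profile p Z W x * W x)))
          + p.q * p.ε * (Z x * (Z x * (profile p Z W x * profile p Z W x)))))) := by
  -- The numerator is (1 - qX)² times the truncated series plus a remainder divisible by X³.
  have hpoly : p.δ ^ 2 * (depth₁ p Z x ^ 2 - p.γ * depth₂ p Z x ^ 2) = (p.γ + p.δ) *
      ((1 - p.q * p.ε * Z x) ^ 2 * (p.c₁ + 2 * p.c₂ * (p.ε * Z x)
        + 3 * (p.q * p.c₂) * (p.ε * Z x) ^ 2)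
        + p.q ^ 2 * p.c₂ * (4 * (p.ε * Z x) ^ 3 * (1 - p.q * p.ε * Z x)
          + p.q * (p.ε * Z x) ^ 4)) := by
    unfold depth₁ depth₂ Param.c₁ Param.c₂ Param.q
    field_simp
    ring
  have hv : velocityFlux p Z (fun y => (p.γ + p.δ) * W y) x =
      p.δ ^ 2 * (depth₁ p Z x ^ 2 - p.γ * depth₂ p Z x ^ 2) * W x ^ 2 /
        (1 - p.q * p.ε * Z x) ^ 2 := by
    unfold velocityFlux
    rw [depth_sum_eq hd h]
    field_simp
  rw [hv, hpoly]
  unfold profile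
  generalize hD : 1 - p.q * p.ε * Z x = D at *
  field_simp

/-- In terms of w and P the quotients inside 𝒬̄ and ℛ̄ become linear, so their derivatives produce
no further denominators. -/
theorem lower_quotient_eq (hd : p.δ ≠ 0) (h : p.γ + p.δ ≠ 0) (Z W : ℝ → ℝ) {x : ℝ}
    (hne : 1 - p.q * p.ε * Z x ≠ 0) :
    depth₁ p Z x * ((p.γ + p.δ) * W x) / (depth₁ p Z x + p.γ * depth₂ p Z x)
      = p.δ * (W x + p.ε * (p.q - 1) * profile p Z W x) := by
  rw [depth_sum_eq hd h]
  unfold depth₁ profile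
  generalize hD : 1 - p.q * p.ε * Z x = D at *
  field_simp
  rw [← hD]
  ring

theorem upper_quotient_eq (hd : p.δ ≠ 0) (h : p.γ + p.δ ≠ 0) (Z W : ℝ → ℝ) {x : ℝ}
    (hne : 1 - p.q * p.ε * Z x ≠ 0) :
    depth₂ p Z x * ((p.γ + p.δ) * W x) / (depth₁ p Z x + p.γ * depth₂ p Z x)
      = W x + p.ε * (p.q + p.δ) * profile p Z W x := by
  rw [depth_sum_eq hd h]
  unfold depth₂ profile
  generalize hD : 1 - p.q * p.ε * Z x = D at *
  field_simp
  rw [← hD]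
  ring

theorem quotient_eq (hd : p.δ ≠ 0) (h : p.γ + p.δ ≠ 0) (Z W : ℝ → ℝ) {x : ℝ}
    (hne : 1 - p.q * p.ε * Z x ≠ 0) :
    (p.γ + p.δ) * W x / (depth₁ p Z x + p.γ * depth₂ p Z x)
      = p.δ * (W x + p.ε * p.q * profile p Z W x) := by
  rw [depth_sum_eq hd h]
  unfold profile
  generalize hD : 1 - p.q * p.ε * Z x = D at *
  field_simp
  rw [← hD]
  ring

/-- Isolates the leading part ζw of P; the correction carries a factor ε. -/
theorem profile_eq (Z W : ℝ → ℝ) {x : ℝ} (hne : 1 - p.q * p.ε * Z x ≠ 0) :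
    profile p Z W x = Z x * W x + p.ε * p.q * (Z x * profile p Z W x) := by
  unfold profile
  generalize hD : 1 - p.q * p.ε * Z x = D at *
  field_simp
  rw [← hD]
  ring

/-- The bracket `2 B(u_l,u_r)` in the variables `ζ = u_l + u_r`, `w = u_l - u_r`. -/
def jetBracket (p : Param) (z z₁ z₂ w w₁ w₂ : ℝ) : ℝ :=
  (p.κ₁ + p.κ₂) * (z * w₂) + (p.κ₁ - p.κ₂) * (w * z₂) + (2 * p.κ₁ + p.κ₂) * (z₁ * w₁)

/-- Second order remainder of the operator `𝒬̄`, as a function of the jets of `ζ`, `w` and of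
`P = ζ w / (1 - q ε ζ)`. -/
def jetQ (p : Param) (z z₁ z₂ w₁ w₂ P P₁ P₂ : ℝ) : ℝ :=
  -1 / 3 * (3 * (p.δ * (z * (z₁ * w₁)) + (p.q - 1) * (z₁ * P₁)
      + p.ε * p.δ * (p.q - 1) * (z * (z₁ * P₁)))
    + (p.δ * (z * (z * w₂)) + 2 * (p.q - 1) * (z * P₂) + p.ε * p.δ * (p.q - 1) * (z * (z * P₂)))
    - 3 * p.γ * ((p.q + p.δ) * (z₁ * P₁) - z * (z₁ * w₁) - p.ε * (p.q + p.δ) * (z * (z₁ * P₁)))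
    + p.γ * (z * (z * w₂) - 2 * (p.q + p.δ) * (z * P₂) + p.ε * (p.q + p.δ) * (z * (z * P₂)))
    + ((p.q - 1) / p.δ + p.γ * (p.q + p.δ)) * p.q * (z₂ * P + 2 * (z₁ * P₁) + z * P₂))

/-- First order remainder of `h₂ ∂ₓⁿ(w + ε (q - 1) P) δ`. -/
def jetLower (p : Param) (z w P : ℝ) : ℝ :=
  p.δ * (z * w) + (p.q - 1) * P + p.ε * p.δ * (p.q - 1) * (z * P)

/-- First order remainder of `h₁ ∂ₓⁿ(w + ε (q + δ) P)`. -/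
def jetUpper (p : Param) (z w P : ℝ) : ℝ :=
  (p.q + p.δ) * P - z * w - p.ε * (p.q + p.δ) * (z * P)

/-- First order remainder of the flux `(1 - ε z) (1 + δ ε z) (w₂ + ε E)`. -/
def jetProduct (p : Param) (z w₂ E : ℝ) : ℝ :=
  E + (p.δ - 1) * (z * w₂) - p.ε * p.δ * (z * (z * w₂))
    + p.ε * ((p.δ - 1) * (z * E)) - p.ε * (p.ε * p.δ) * (z * (z * E))

/-- First order remainder of the operator `ℛ̄`. -/
def jetR (p : Param) (z z₁ w w₁ w₂ P P₁ P₂ : ℝ) : ℝ :=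
  1 / 2 * (2 * (w₁ * jetLower p z w₁ P₁) + p.ε * (jetLower p z w₁ P₁ * jetLower p z w₁ P₁)
      - p.γ * (2 * (w₁ * jetUpper p z w₁ P₁) + p.ε * (jetUpper p z w₁ P₁ * jetUpper p z w₁ P₁)))
    + 1 / 3 * (p.q * (1 - p.γ) * (P * w₂) + (w + p.ε * p.q * P) *
      ((3 * p.δ * (z₁ * (w₁ + p.ε * jetLower p z w₁ P₁)
          - p.ε * (z * (z₁ * (w₁ + p.ε * jetLower p z w₁ P₁))))
          + jetProduct p z w₂ (jetLower p z w₂ P₂))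
        - p.γ * (-3 * (z₁ * (w₁ + p.ε * jetUpper p z w₁ P₁)
          + p.δ * p.ε * (z * (z₁ * (w₁ + p.ε * jetUpper p z w₁ P₁))))
          + jetProduct p z w₂ (jetUpper p z w₂ P₂))))

section Operators

variable {Z W : ℝ → ℝ}

theorem deriv_quotients (hd : p.δ ≠ 0) (h : p.γ + p.δ ≠ 0) (hne : ∀ x, 1 - p.q * p.ε * Z x ≠ 0)
    (hW : Differentiable ℝ W) (hP : Differentiable ℝ (profile p Z W)) :
    (deriv (fun z => depth₁ p Z z * ((p.γ + p.δ) * W z) / (depth₁ p Z z + p.γ * depth₂ p Z z))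
      = fun x => p.δ * (deriv W x + p.ε * (p.q - 1) * deriv (profile p Z W) x)) ∧
    (deriv (fun z => depth₂ p Z z * ((p.γ + p.δ) * W z) / (depth₁ p Z z + p.γ * depth₂ p Z z))
      = fun x => deriv W x + p.ε * (p.q + p.δ) * deriv (profile p Z W) x) := by
  constructor
  · ext x
    rw [show (fun z => depth₁ p Z z * ((p.γ + p.δ) * W z) / (depth₁ p Z z + p.γ * depth₂ p Z z))
      = fun z => p.δ * (W z + p.ε * (p.q - 1) * profile p Z W z) from
      funext fun z => lower_quotient_eq hd h Z W (hne z)]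
    exact (((hW x).hasDerivAt.add ((hP x).hasDerivAt.const_mul _)).const_mul _).deriv
  · ext x
    rw [show (fun z => depth₂ p Z z * ((p.γ + p.δ) * W z) / (depth₁ p Z z + p.γ * depth₂ p Z z))
      = fun z => W z + p.ε * (p.q + p.δ) * profile p Z W z from
      funext fun z => upper_quotient_eq hd h Z W (hne z)]
    exact ((hW x).hasDerivAt.add ((hP x).hasDerivAt.const_mul _)).deriv

theorem lowerTerm_eq (hd : p.δ ≠ 0) (h : p.γ + p.δ ≠ 0) (hne : ∀ x, 1 - p.q * p.ε * Z x ≠ 0)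
    (hZ : Differentiable ℝ Z) (hW : Differentiable ℝ W) (hP : Differentiable ℝ (profile p Z W))
    (hW₂ : Differentiable ℝ (deriv W)) (hP₂ : Differentiable ℝ (deriv (profile p Z W))) (x : ℝ) :
    lowerTerm p.γ (depth₁ p Z) (depth₂ p Z) (fun y => (p.γ + p.δ) * W y) x =
      3 * depth₂ p Z x ^ 2 * (p.ε * deriv Z x) *
        (p.δ * (deriv W x + p.ε * (p.q - 1) * deriv (profile p Z W) x))
      + depth₂ p Z x ^ 3 *
        (p.δ * (deriv (deriv W) x + p.ε * (p.q - 1) * deriv (deriv (profile p Z W)) x)) := by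
  unfold lowerTerm
  rw [(deriv_quotients hd h hne hW hP).1]
  have h1 : HasDerivAt (depth₂ p Z) (p.ε * deriv Z x) x :=
    ((hZ x).hasDerivAt.const_mul p.ε).const_add _
  have h2 := ((hW₂ x).hasDerivAt.add ((hP₂ x).hasDerivAt.const_mul (p.ε * (p.q - 1)))).const_mul p.δ
  refine ((h1.pow 3).mul h2).deriv.trans ?_
  simp

theorem upperTerm_eq (hd : p.δ ≠ 0) (h : p.γ + p.δ ≠ 0) (hne : ∀ x, 1 - p.q * p.ε * Z x ≠ 0)
    (hZ : Differentiable ℝ Z) (hW : Differentiable ℝ W) (hP : Differentiable ℝ (profile p Z W))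
    (hW₂ : Differentiable ℝ (deriv W)) (hP₂ : Differentiable ℝ (deriv (profile p Z W))) (x : ℝ) :
    upperTerm p.γ (depth₁ p Z) (depth₂ p Z) (fun y => (p.γ + p.δ) * W y) x =
      3 * depth₁ p Z x ^ 2 * (-(p.ε * deriv Z x)) *
        (deriv W x + p.ε * (p.q + p.δ) * deriv (profile p Z W) x)
      + depth₁ p Z x ^ 3 *
        (deriv (deriv W) x + p.ε * (p.q + p.δ) * deriv (deriv (profile p Z W)) x) := by
  unfold upperTerm
  rw [(deriv_quotients hd h hne hW hP).2]
  have h1 : HasDerivAt (depth₁ p Z) (-(p.ε * deriv Z x)) x :=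
    ((hZ x).hasDerivAt.const_mul p.ε).const_sub _
  have h2 := (hW₂ x).hasDerivAt.add ((hP₂ x).hasDerivAt.const_mul (p.ε * (p.q + p.δ)))
  refine ((h1.pow 3).mul h2).deriv.trans ?_
  simp

/-- The relation P = ζw + εqζP is differentiated twice. In 𝒬̄ this replaces the term εP″ by ε(ζw)″
plus a term of order ε², so that the order ε part involves only ζ and w. -/
theorem deriv_deriv_profile (hne : ∀ x, 1 - p.q * p.ε * Z x ≠ 0)
    (hZ : Differentiable ℝ Z) (hW : Differentiable ℝ W) (hP : Differentiable ℝ (profile p Z W))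
    (hZ₂ : Differentiable ℝ (deriv Z)) (hW₂ : Differentiable ℝ (deriv W))
    (hP₂ : Differentiable ℝ (deriv (profile p Z W))) (x : ℝ) :
    deriv (deriv (profile p Z W)) x =
      deriv (deriv Z) x * W x + 2 * (deriv Z x * deriv W x) + Z x * deriv (deriv W) x
      + p.ε * p.q * (deriv (deriv Z) x * profile p Z W x
        + 2 * (deriv Z x * deriv (profile p Z W) x) + Z x * deriv (deriv (profile p Z W)) x) := by
  have e1 : deriv (profile p Z W) = fun x => (deriv Z x * W x + Z x * deriv W x)
      + p.ε * p.q * (deriv Z x * profile p Z W x + Z x * deriv (profile p Z W) x) := by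
    ext x
    conv_lhs => rw [show profile p Z W = fun x => Z x * W x + p.ε * p.q * (Z x * profile p Z W x)
      from funext fun x => profile_eq Z W (hne x)]
    exact (((hZ x).hasDerivAt.mul (hW x).hasDerivAt).add
      (((hZ x).hasDerivAt.mul (hP x).hasDerivAt).const_mul _)).deriv
  conv_lhs => rw [e1]
  refine ((((hZ₂ x).hasDerivAt.mul (hW x).hasDerivAt).add
    ((hZ x).hasDerivAt.mul (hW₂ x).hasDerivAt)).add
      ((((hZ₂ x).hasDerivAt.mul (hP x).hasDerivAt).add
        ((hZ x).hasDerivAt.mul (hP₂ x).hasDerivAt)).const_mul _)).deriv.trans ?_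
  ring

theorem opQ_eq (hd : p.δ ≠ 0) (h : p.γ + p.δ ≠ 0) (hne : ∀ x, 1 - p.q * p.ε * Z x ≠ 0)
    (hZ : Differentiable ℝ Z) (hW : Differentiable ℝ W) (hP : Differentiable ℝ (profile p Z W))
    (hZ₂ : Differentiable ℝ (deriv Z)) (hW₂ : Differentiable ℝ (deriv W))
    (hP₂ : Differentiable ℝ (deriv (profile p Z W))) {x : ℝ} (h₁ : depth₁ p Z x ≠ 0)
    (h₂ : depth₂ p Z x ≠ 0) :
    opQ p.γ (depth₁ p Z) (depth₂ p Z) (fun y => (p.γ + p.δ) * W y) x =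
      (p.γ + p.δ) * (-2 * p.ν * deriv (deriv W) x - p.ε * jetBracket p (Z x) (deriv Z x)
        (deriv (deriv Z) x) (W x) (deriv W x) (deriv (deriv W) x))
      + p.ε ^ 2 * jetQ p (Z x) (deriv Z x) (deriv (deriv Z) x) (deriv W x) (deriv (deriv W) x)
        (profile p Z W x) (deriv (profile p Z W) x) (deriv (deriv (profile p Z W)) x) := by
  unfold opQ
  rw [lowerTerm_eq hd h hne hZ hW hP hW₂ hP₂, upperTerm_eq hd h hne hZ hW hP hW₂ hP₂]
  have hP2 := deriv_deriv_profile hne hZ hW hP hZ₂ hW₂ hP₂ x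
  generalize deriv (deriv (profile p Z W)) x = P₂ at *
  generalize deriv (profile p Z W) x = P₁ at *
  generalize profile p Z W x = P at *
  generalize deriv (deriv W) x = w₂ at *
  generalize deriv (deriv Z) x = z₂ at *
  generalize deriv W x = w₁ at *
  generalize deriv Z x = z₁ at *
  -- The powers of h₁ and h₂ in the lower and upper terms cancel the prefactor 1/(h₁h₂).
  have e1 : ∀ A B : ℝ, -1 / (3 * depth₁ p Z x * depth₂ p Z x) *
      (depth₁ p Z x * (3 * depth₂ p Z x ^ 2 * (p.ε * z₁) * A
        + depth₂ p Z x ^ 3 * B) + p.γ * depth₂ p Z x * (3 * depth₁ p Z x ^ 2 * (-(p.ε * z₁)) *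
        (w₁ + p.ε * (p.q + p.δ) * P₁) + depth₁ p Z x ^ 3 * (w₂ + p.ε * (p.q + p.δ) * P₂))) =
      -1 / 3 * (3 * depth₂ p Z x * (p.ε * z₁) * A + depth₂ p Z x ^ 2 * B
        + p.γ * (3 * depth₁ p Z x * (-(p.ε * z₁)) * (w₁ + p.ε * (p.q + p.δ) * P₁)
        + depth₁ p Z x ^ 2 * (w₂ + p.ε * (p.q + p.δ) * P₂))) := by
    intro A B
    field_simp
  rw [e1]
  clear e1
  unfold depth₁ depth₂ jetBracket jetQ
  generalize Z x = z at *
  generalize W x = w at *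
  -- The order ε part is (κ₁ - κ₂)(ζw)″ + κ₂(2ζw″ + 3ζ′w′), up to the factor -(γ + δ); κ₁, κ₂ and ν
  -- are exactly the coefficients that make it agree with 𝒬̄.
  have ek1 : (p.γ + p.δ) * (p.κ₁ - p.κ₂) = 1 / 3 * ((p.q - 1) / p.δ + p.γ * (p.q + p.δ)) := by
    unfold Param.κ₁ Param.κ₂ Param.q
    field_simp
    ring
  have ek2 : (p.γ + p.δ) * p.κ₂ = (1 - p.γ) / 3 := by
    unfold Param.κ₂
    field_simp
  have en : (p.γ + p.δ) * p.ν = (1 / p.δ + p.γ) / 6 := by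
    unfold Param.ν
    rw [add_comm p.δ]
    field_simp
  -- 1/δ becomes an independent unknown d subject to δd = 1, which leaves a polynomial identity.
  have hdd : p.δ * (1 / p.δ) = 1 := mul_one_div_cancel hd
  rw [show (p.q - 1) / p.δ = (p.q - 1) * (1 / p.δ) by ring] at *
  generalize 1 / p.δ = d at *
  linear_combination 2 * w₂ * en + p.ε * (z * w₂ + w * z₂ + 2 * (z₁ * w₁)) * ek1
    + p.ε * (2 * (z * w₂) + 3 * (z₁ * w₁)) * ek2
    - 1 / 3 * (3 * p.ε * z₁ * (w₁ + p.ε * (p.q - 1) * P₁)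
      + (d + 2 * p.ε * z) * (w₂ + p.ε * (p.q - 1) * P₂)) * hdd
    - 1 / 3 * p.ε * ((p.q - 1) * d + p.γ * (p.q + p.δ)) * hP2

/-- ℛ̄ enters with a factor με, so order zero suffices here, whereas 𝒬̄, with a factor μ only, had
to be expanded to order ε. -/
theorem opR_eq (hd : p.δ ≠ 0) (h : p.γ + p.δ ≠ 0) (hne : ∀ x, 1 - p.q * p.ε * Z x ≠ 0)
    (hZ : Differentiable ℝ Z) (hW : Differentiable ℝ W) (hP : Differentiable ℝ (profile p Z W))
    (hW₂ : Differentiable ℝ (deriv W))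
    (hP₂ : Differentiable ℝ (deriv (profile p Z W))) {x : ℝ} (h₁ : depth₁ p Z x ≠ 0)
    (h₂ : depth₂ p Z x ≠ 0) :
    opR p.γ (depth₁ p Z) (depth₂ p Z) (fun y => (p.γ + p.δ) * W y) x =
      (1 - p.γ) * (1 / 3 * (W x * deriv (deriv W) x) + 1 / 2 * (deriv W x * deriv W x))
      + p.ε * jetR p (Z x) (deriv Z x) (W x) (deriv W x) (deriv (deriv W) x)
        (profile p Z W x) (deriv (profile p Z W) x) (deriv (deriv (profile p Z W)) x) := by
  unfold opR
  rw [lowerTerm_eq hd h hne hZ hW hP hW₂ hP₂, upperTerm_eq hd h hne hZ hW hP hW₂ hP₂,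
    (deriv_quotients hd h hne hW hP).1, (deriv_quotients hd h hne hW hP).2,
    quotient_eq hd h Z W (hne x)]
  dsimp only
  generalize deriv (deriv (profile p Z W)) x = P₂ at *
  generalize deriv (profile p Z W) x = P₁ at *
  generalize profile p Z W x = P at *
  generalize deriv (deriv W) x = w₂ at *
  generalize deriv W x = w₁ at *
  generalize deriv Z x = z₁ at *
  have e1 : ∀ A B : ℝ, depth₁ p Z x / depth₂ p Z x *
      (3 * depth₂ p Z x ^ 2 * (p.ε * z₁) * A + depth₂ p Z x ^ 3 * B) =
      depth₁ p Z x * (3 * depth₂ p Z x * (p.ε * z₁) * A + depth₂ p Z x ^ 2 * B) := by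
    intro A B
    field_simp
  have e2 : ∀ A B : ℝ, p.γ * (depth₂ p Z x / depth₁ p Z x) *
      (3 * depth₁ p Z x ^ 2 * (-(p.ε * z₁)) * A + depth₁ p Z x ^ 3 * B) =
      p.γ * depth₂ p Z x * (3 * depth₁ p Z x * (-(p.ε * z₁)) * A + depth₁ p Z x ^ 2 * B) := by
    intro A B
    field_simp
  rw [e1, e2]
  clear e1 e2
  have hE : p.δ * depth₂ p Z x = 1 + p.δ * p.ε * Z x := by
    unfold depth₂
    field_simp
  generalize hh : depth₂ p Z x = h₂' at *
  unfold depth₁ jetR jetProduct jetLower jetUpper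
  generalize Z x = z at *
  generalize W x = w at *
  have hh2 : h₂' = (1 + p.δ * p.ε * z) / p.δ := by
    field_simp
    linarith
  rw [hh2]
  generalize p.q = q at *
  field_simp
  ring

end Operators
end

noncomputable section

open Filter Topology

variable {p : Param}

/-! ### The weakly coupled system in the variables `ζ = u_l + u_r`, `w = u_l - u_r` -/

/-- Taylor polynomial of the mass flux. -/
def massPoly (p : Param) (Z W : ℝ → ℝ) : ℝ → ℝ := fun x =>
  W x + p.ε * (p.c₁ * (Z x * W x)) + p.ε ^ 2 * (p.c₂ * (Z x * (Z x * W x)))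
    + p.ε ^ 3 * (p.q * p.c₂ * (Z x * (Z x * (Z x * W x))))

/-- Taylor polynomial of the velocity flux. -/
def velocityPoly (p : Param) (Z W : ℝ → ℝ) : ℝ → ℝ := fun x =>
  p.ε * (p.c₁ / 2 * (W x * W x)) + p.ε ^ 2 * (p.c₂ * (Z x * (W x * W x)))
    + p.ε ^ 3 * (3 / 2 * (p.q * p.c₂) * (Z x * (Z x * (W x * W x))))

/-- The leading part of `ℛ̄`. -/
def quadraticPoly (W : ℝ → ℝ) : ℝ → ℝ := fun x =>
  1 / 3 * (W x * deriv (deriv W) x) + 1 / 2 * (deriv W x * deriv W x)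

/-- The bracket `2 B(u_l,u_r)` as a function of `ζ` and `w`. -/
def bracketFun (p : Param) (Z W : ℝ → ℝ) : ℝ → ℝ := fun x =>
  jetBracket p (Z x) (deriv Z x) (deriv (deriv Z) x) (W x) (deriv W x) (deriv (deriv W) x)

theorem deriv_add_fun {f g : ℝ → ℝ} (hf : Differentiable ℝ f) (hg : Differentiable ℝ g) :
    deriv (fun x => f x + g x) = fun x => deriv f x + deriv g x :=
  funext fun x => ((hf x).hasDerivAt.add (hg x).hasDerivAt).deriv

theorem deriv_sub_fun {f g : ℝ → ℝ} (hf : Differentiable ℝ f) (hg : Differentiable ℝ g) :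
    deriv (fun x => f x - g x) = fun x => deriv f x - deriv g x :=
  funext fun x => ((hf x).hasDerivAt.sub (hg x).hasDerivAt).deriv

theorem serreBracket_eq {a b : ℝ → ℝ → ℝ} {t : ℝ} (ha : Differentiable ℝ (a t))
    (hb : Differentiable ℝ (b t)) (ha₂ : Differentiable ℝ (deriv (a t)))
    (hb₂ : Differentiable ℝ (deriv (b t))) (x : ℝ) :
    serreBracket p a b t x =
      1 / 2 * bracketFun p (fun y => a t y + b t y) (fun y => a t y - b t y) x := by
  unfold serreBracket bracketFun jetBracket
  rw [deriv_add_fun ha hb, deriv_sub_fun ha hb, deriv_add_fun ha₂ hb₂, deriv_sub_fun ha₂ hb₂]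
  simp only [iteratedDeriv_succ, iteratedDeriv_zero]
  ring

section Equations

variable {T : EReal} {ul ur : ℝ → ℝ → ℝ} {t : ℝ}

/-- B is antisymmetric, hence its contributions cancel in the sum of the two equations and add up in
the difference. -/
theorem dt_serreBracket_swap (x : ℝ) :
    dt T (serreBracket p ur ul) t x = -dt T (serreBracket p ul ur) t x := by
  have : serreBracket p ur ul = fun τ y => -serreBracket p ul ur τ y := by
    ext τ y; unfold serreBracket; ring
  rw [this]
  exact derivWithin.fun_neg

theorem dt_sub_eq (hT : 0 < T) (ht : t ∈ timeInterval T)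
    (hl : ∀ x, DifferentiableWithinAt ℝ (fun τ => ul τ x) (timeInterval T) t)
    (hr : ∀ x, DifferentiableWithinAt ℝ (fun τ => ur τ x) (timeInterval T) t) :
    dt T (fun τ y => ul τ y - ur τ y) t = fun x => dt T ul t x - dt T ur t x :=
  funext fun x => dt_eq hT ht ((hl x).hasDerivWithinAt.sub (hr x).hasDerivWithinAt)

theorem dt_add_eq (hT : 0 < T) (ht : t ∈ timeInterval T)
    (hl : ∀ x, DifferentiableWithinAt ℝ (fun τ => ul τ x) (timeInterval T) t)
    (hr : ∀ x, DifferentiableWithinAt ℝ (fun τ => ur τ x) (timeInterval T) t) :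
    dt T (fun τ y => ul τ y + ur τ y) t = fun x => dt T ul t x + dt T ur t x :=
  funext fun x => dt_eq hT ht ((hl x).hasDerivWithinAt.add (hr x).hasDerivWithinAt)

theorem iteratedDeriv_dt_swap (hT : 0 < T) (ht : t ∈ timeInterval T)
    (hl : ∀ x, DifferentiableWithinAt ℝ (fun τ => ul τ x) (timeInterval T) t)
    (hr : ∀ x, DifferentiableWithinAt ℝ (fun τ => ur τ x) (timeInterval T) t) (x : ℝ) :
    iteratedDeriv 2 (dt T (fun τ y => ur τ y - ul τ y) t) x =
      -iteratedDeriv 2 (dt T (fun τ y => ul τ y - ur τ y) t) x := by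
  have : dt T (fun τ y => ur τ y - ul τ y) t = -dt T (fun τ y => ul τ y - ur τ y) t := by
    rw [dt_sub_eq hT ht hl hr, dt_sub_eq hT ht hr hl]
    ext x
    simp
  rw [this, iteratedDeriv_neg]

theorem deriv_polynomials {f g : ℝ → ℝ} {x a b : ℝ} (hf : HasDerivAt f a x) (hg : HasDerivAt g b x)
    (k : ℝ) :
    deriv (fun y => (f y + 1 / 3 * g y) * (f y - g y)) x
      = (a + 1 / 3 * b) * (f x - g x) + (f x + 1 / 3 * g x) * (a - b) ∧
    deriv (fun y => (f y - g y) * f y * (f y + g y)) x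
      = ((a - b) * f x + (f x - g x) * a) * (f x + g x) + (f x - g x) * f x * (a + b) ∧
    deriv (fun y => (f y - k * g y) * (f y - g y) * (f y + g y) ^ 2) x
      = ((a - k * b) * (f x - g x) + (f x - k * g x) * (a - b)) * (f x + g x) ^ 2
        + (f x - k * g x) * (f x - g x) * (2 * (f x + g x) * (a + b)) := by
  refine ⟨((hf.add (hg.const_mul _)).mul (hf.sub hg)).deriv,
    (((hf.sub hg).mul hf).mul (hf.add hg)).deriv, ?_⟩
  refine ((((hf.sub (hg.const_mul _)).mul (hf.sub hg)).mul ((hf.add hg).pow 2))).deriv.trans ?_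
  simp

theorem deriv_massPoly {Z W : ℝ → ℝ} {x a b : ℝ} (hZ : HasDerivAt Z a x) (hW : HasDerivAt W b x) :
    deriv (massPoly p Z W) x = b + p.ε * (p.c₁ * (a * W x + Z x * b))
      + p.ε ^ 2 * (p.c₂ * (a * (Z x * W x) + Z x * (a * W x + Z x * b)))
      + p.ε ^ 3 * (p.q * p.c₂ * (a * (Z x * (Z x * W x))
        + Z x * (a * (Z x * W x) + Z x * (a * W x + Z x * b)))) :=
  (((hW.add (((hZ.mul hW).const_mul _).const_mul _)).add
    (((hZ.mul (hZ.mul hW)).const_mul _).const_mul _)).add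
    (((hZ.mul (hZ.mul (hZ.mul hW))).const_mul _).const_mul _)).deriv

theorem deriv_velocityPoly {Z W : ℝ → ℝ} {x a b : ℝ} (hZ : HasDerivAt Z a x)
    (hW : HasDerivAt W b x) :
    deriv (velocityPoly p Z W) x = p.ε * (p.c₁ / 2 * (b * W x + W x * b))
      + p.ε ^ 2 * (p.c₂ * (a * (W x * W x) + Z x * (b * W x + W x * b)))
      + p.ε ^ 3 * (3 / 2 * (p.q * p.c₂) * (a * (Z x * (W x * W x))
        + Z x * (a * (W x * W x) + Z x * (b * W x + W x * b)))) :=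
  (((((hW.mul hW).const_mul _).const_mul _).add
    (((hZ.mul (hW.mul hW)).const_mul _).const_mul _)).add
    (((hZ.mul (hZ.mul (hW.mul hW))).const_mul _).const_mul _)).deriv

/-- The sum of the two equations of the weakly coupled system. -/
theorem SolvesSerre.sum (h : SolvesSerre p T ul ur) (hp : p.γ + p.δ ≠ 0) (hT : 0 < T)
    (ht : t ∈ timeInterval T)
    (hl : ∀ x, DifferentiableWithinAt ℝ (fun τ => ul τ x) (timeInterval T) t)
    (hr : ∀ x, DifferentiableWithinAt ℝ (fun τ => ur τ x) (timeInterval T) t)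
    (dl : Differentiable ℝ (ul t)) (dr : Differentiable ℝ (ur t)) (x : ℝ) :
    dt T (fun τ y => ul τ y + ur τ y) t x
      + deriv (massPoly p (fun y => ul t y + ur t y) (fun y => ul t y - ur t y)) x = 0 := by
  obtain ⟨h1, h2⟩ := h t ht x
  have Hl := (dl x).hasDerivAt
  have Hr := (dr x).hasDerivAt
  obtain ⟨l1, l2, l3⟩ := deriv_polynomials Hl Hr (1 / 5)
  obtain ⟨r1, r2, r3⟩ := deriv_polynomials Hr Hl (1 / 5)
  rw [deriv_massPoly (Hl.fun_add Hr) (Hl.fun_sub Hr), dt_add_eq hT ht hl hr]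
  unfold serreL at h1
  unfold serreR at h2
  rw [l1, l2, l3] at h1
  simp only [add_comm (1 / 3 * ul t _) (ur t _), add_comm (ul t _) (ur t _)] at h2
  rw [r1, r2, r3, iteratedDeriv_dt_swap hT ht hl hr, dt_serreBracket_swap] at h2
  -- The expression under ∂ₓ is symmetric in u_l and u_r but has opposite signs in f_l and f_r, so
  -- it drops out of the sum.
  have e : (fun y => 1 / 3 * (ur t y - ul t y) *
      (iteratedDeriv 2 (ur t) y - iteratedDeriv 2 (ul t) y) + 1 / 2 * (deriv (ur t) y - deriv (ul t) y) ^ 2)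
      = fun y => 1 / 3 * (ul t y - ur t y) *
      (iteratedDeriv 2 (ul t) y - iteratedDeriv 2 (ur t) y) + 1 / 2 * (deriv (ul t) y - deriv (ur t) y) ^ 2 := by
    ext y; ring
  rw [e] at h2
  rw [Param.α₁_eq hp, Param.α₂_eq hp, Param.α₃_eq hp] at h1 h2
  linear_combination h1 + h2

/-- The difference of the two equations of the weakly coupled system. -/
theorem SolvesSerre.diff (h : SolvesSerre p T ul ur) (hp : p.γ + p.δ ≠ 0) (hT : 0 < T)
    (ht : t ∈ timeInterval T)
    (hl : ∀ x, DifferentiableWithinAt ℝ (fun τ => ul τ x) (timeInterval T) t)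
    (hr : ∀ x, DifferentiableWithinAt ℝ (fun τ => ur τ x) (timeInterval T) t)
    (dl : ∀ τ ∈ timeInterval T, Differentiable ℝ (ul τ))
    (dr : ∀ τ ∈ timeInterval T, Differentiable ℝ (ur τ))
    (dl₂ : ∀ τ ∈ timeInterval T, Differentiable ℝ (deriv (ul τ)))
    (dr₂ : ∀ τ ∈ timeInterval T, Differentiable ℝ (deriv (ur τ))) (x : ℝ)
    (hB : DifferentiableWithinAt ℝ
      (fun τ => bracketFun p (fun y => ul τ y + ur τ y) (fun y => ul τ y - ur τ y) x)
      (timeInterval T) t) :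
    dt T (fun τ y => ul τ y - ur τ y) t x + deriv (fun y => ul t y + ur t y) x
      + deriv (velocityPoly p (fun y => ul t y + ur t y) (fun y => ul t y - ur t y)) x
      - 2 * p.μ * p.ν * deriv (deriv (dt T (fun τ y => ul τ y - ur τ y) t)) x
      + 2 * (p.μ * p.ε * p.κ₃) * deriv (quadraticPoly (fun y => ul t y - ur t y)) x
      - p.μ * p.ε *
        dt T (fun τ => bracketFun p (fun y => ul τ y + ur τ y) (fun y => ul τ y - ur τ y)) t x
      = 0 := by
  obtain ⟨h1, h2⟩ := h t ht x
  have Hl := (dl t ht x).hasDerivAt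
  have Hr := (dr t ht x).hasDerivAt
  obtain ⟨l1, l2, l3⟩ := deriv_polynomials Hl Hr (1 / 5)
  obtain ⟨r1, r2, r3⟩ := deriv_polynomials Hr Hl (1 / 5)
  -- A time derivative is compared, so the formula for B is needed at all times; this is why space
  -- regularity is required for every τ.
  have hb : dt T (serreBracket p ul ur) t x = 1 / 2 *
      dt T (fun τ => bracketFun p (fun y => ul τ y + ur τ y) (fun y => ul τ y - ur τ y)) t x := by
    refine dt_eq hT ht ?_
    refine (hB.hasDerivWithinAt.const_mul (1 / 2)).congr (fun τ hτ => ?_) ?_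
    · exact serreBracket_eq (dl τ hτ) (dr τ hτ) (dl₂ τ hτ) (dr₂ τ hτ) x
    · exact serreBracket_eq (dl t ht) (dr t ht) (dl₂ t ht) (dr₂ t ht) x
  have hq : quadraticPoly (fun y => ul t y - ur t y) = fun y => 1 / 3 * (ul t y - ur t y) *
      (iteratedDeriv 2 (ul t) y - iteratedDeriv 2 (ur t) y)
        + 1 / 2 * (deriv (ul t) y - deriv (ur t) y) ^ 2 := by
    ext y
    unfold quadraticPoly
    rw [deriv_sub_fun (dl t ht) (dr t ht), deriv_sub_fun (dl₂ t ht) (dr₂ t ht)]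
    simp only [iteratedDeriv_succ, iteratedDeriv_zero]
    ring
  have hi : deriv (deriv (dt T (fun τ y => ul τ y - ur τ y) t)) x
      = iteratedDeriv 2 (dt T (fun τ y => ul τ y - ur τ y) t) x := by
    simp only [iteratedDeriv_succ, iteratedDeriv_zero]
  have hw : dt T (fun τ y => ul τ y - ur τ y) t x = dt T ul t x - dt T ur t x := by
    rw [dt_sub_eq hT ht hl hr]
  rw [deriv_velocityPoly (Hl.fun_add Hr) (Hl.fun_sub Hr), hi, hw, hq, deriv_add_fun (dl t ht) (dr t ht)]
  unfold serreL at h1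
  unfold serreR at h2
  rw [l1, l2, l3, hb] at h1
  simp only [add_comm (1 / 3 * ul t _) (ur t _), add_comm (ul t _) (ur t _)] at h2
  rw [r1, r2, r3, iteratedDeriv_dt_swap hT ht hl hr, dt_serreBracket_swap, hb] at h2
  have e : (fun y => 1 / 3 * (ur t y - ul t y) *
      (iteratedDeriv 2 (ur t) y - iteratedDeriv 2 (ul t) y) + 1 / 2 * (deriv (ur t) y - deriv (ul t) y) ^ 2)
      = fun y => 1 / 3 * (ul t y - ur t y) *
      (iteratedDeriv 2 (ul t) y - iteratedDeriv 2 (ur t) y) + 1 / 2 * (deriv (ul t) y - deriv (ur t) y) ^ 2 := by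
    ext y; ring
  rw [e] at h2
  rw [Param.α₁_eq hp, Param.α₂_eq hp, Param.α₃_eq hp] at h1 h2
  linear_combination h1 - h2

end Equations
end

noncomputable section

open Filter Topology

variable {Ω : Type*}

/-! ### Families of parameters -/

/-- A family of parameters all of whose coefficients are bounded. -/
structure UnifBddParam (p : Ω → Param) : Prop where
  ε : UnifBdd fun ω => (p ω).ε
  δ : UnifBdd fun ω => (p ω).δ
  γ : UnifBdd fun ω => (p ω).γ
  q : UnifBdd fun ω => (p ω).q
  quot : UnifBdd fun ω => ((p ω).q - 1) / (p ω).δ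
  κ₁ : UnifBdd fun ω => (p ω).κ₁
  κ₂ : UnifBdd fun ω => (p ω).κ₂
  κ₃ : UnifBdd fun ω => (p ω).κ₃

namespace UnifBddParam

variable {p : Ω → Param}

theorem c₁ (hp : UnifBddParam p) : UnifBdd fun ω => (p ω).c₁ :=
  (hp.δ.sub (UnifBdd.const 1)).add hp.q

theorem c₂ (hp : UnifBddParam p) : UnifBdd fun ω => (p ω).c₂ :=
  (hp.q.add hp.δ).mul (hp.q.sub (UnifBdd.const 1))

theorem of_mem {μmax εmax δmin δmax : ℝ} (hδ : 0 < δmin)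
    (h : ∀ ω, p ω ∈ paramSet μmax εmax δmin δmax) : UnifBddParam p := by
  have hε : UnifBdd fun ω => (p ω).ε := ⟨εmax, fun ω => by
    rw [abs_of_nonneg (h ω).2.2.1]; exact (h ω).2.2.2.1⟩
  have hle : ∀ ω, δmin ≤ (p ω).δ := fun ω => (h ω).2.2.2.2.1.le
  have hδ' : UnifBdd fun ω => (p ω).δ := ⟨δmax, fun ω => by
    rw [abs_of_pos (hδ.trans_le (hle ω))]; exact (h ω).2.2.2.2.2.1.le⟩
  have hγ : UnifBdd fun ω => (p ω).γ := ⟨1, fun ω => by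
    rw [abs_of_nonneg (h ω).2.2.2.2.2.2.1]; exact (h ω).2.2.2.2.2.2.2.le⟩
  have hle' : ∀ ω, δmin ≤ (p ω).γ + (p ω).δ := fun ω => by
    linarith [hle ω, (h ω).2.2.2.2.2.2.1]
  have h1 := UnifBdd.const (Ω := Ω) 1
  have hq : UnifBdd fun ω => (p ω).q := ((h1.sub hγ).mul hδ').div hδ hle'
  have h1γ := h1.add (hγ.mul hδ')
  refine ⟨hε, hδ', hγ, hq, (hq.sub h1).div hδ hle, ?_, ?_, ?_⟩
  · refine (h1γ.mul ((hδ'.pow 2).sub hγ)).div (a := 3 * δmin * δmin ^ 2) (by positivity) fun ω => ?_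
    have := hle ω
    have := hle' ω
    have := hδ.trans_le (hle ω)
    gcongr
  · refine (h1.sub hγ).div (a := 3 * δmin) (by positivity) fun ω => ?_
    linarith [hle' ω]
  · refine (hγ.sub h1).div (a := 2 * δmin) (by positivity) fun ω => ?_
    linarith [hle' ω]

end UnifBddParam

/-! ### Bounds of polynomials in the jets of ζ, w and P -/

section Jets

variable {T : Ω → EReal} {σ τ : ℝ} {p : Ω → Param} {z z₁ z₂ w w₁ w₂ P P₁ P₂ : Ω → ℝ → ℝ → ℝ}

theorem UnifC1.jetBracket (hp : UnifBddParam p) (hT : ∀ ω, 0 < T ω) (hτ : 1 / 2 < τ) (hτσ : τ ≤ σ)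
    (hz : UnifC1 T σ τ z) (hz₁ : UnifC1 T σ τ z₁) (hz₂ : UnifC1 T σ τ z₂) (hw : UnifC1 T σ τ w)
    (hw₁ : UnifC1 T σ τ w₁) (hw₂ : UnifC1 T σ τ w₂) :
    UnifC1 T σ τ fun ω t x =>
      jetBracket (p ω) (z ω t x) (z₁ ω t x) (z₂ ω t x) (w ω t x) (w₁ ω t x) (w₂ ω t x) := by
  have hσ := hτ.trans_le hτσ
  have h1 := hp.κ₁
  have h2 := hp.κ₂
  unfold _root_.jetBracket
  -- The closure rules follow the polynomial down to its leaves. `const_mul` is tried before `mul`,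
  -- since a scalar coefficient is not a function of H^σ.
  repeat' first
    | assumption
    | exact UnifBdd.const _
    | apply UnifBdd.sub
    | apply UnifBdd.add
    | apply UnifBdd.mul
    | apply UnifC1.sub
    | apply UnifC1.add
    | apply UnifC1.const_mul
    | apply UnifC1.mul

theorem UnifC1.jetQ (hp : UnifBddParam p) (hT : ∀ ω, 0 < T ω) (hτ : 1 / 2 < τ) (hτσ : τ ≤ σ)
    (hz : UnifC1 T σ τ z) (hz₁ : UnifC1 T σ τ z₁) (hz₂ : UnifC1 T σ τ z₂)
    (hw₁ : UnifC1 T σ τ w₁) (hw₂ : UnifC1 T σ τ w₂) (hP : UnifC1 T σ τ P) (hP₁ : UnifC1 T σ τ P₁)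
    (hP₂ : UnifC1 T σ τ P₂) :
    UnifC1 T σ τ fun ω t x => jetQ (p ω) (z ω t x) (z₁ ω t x) (z₂ ω t x) (w₁ ω t x) (w₂ ω t x)
      (P ω t x) (P₁ ω t x) (P₂ ω t x) := by
  have hσ := hτ.trans_le hτσ
  have h1 := hp.ε
  have h2 := hp.δ
  have h3 := hp.γ
  have h4 := hp.q
  have h5 := hp.quot
  unfold _root_.jetQ
  repeat' first
    | assumption
    | exact UnifBdd.const _
    | apply UnifBdd.sub
    | apply UnifBdd.add
    | apply UnifBdd.mul
    | apply UnifC1.sub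
    | apply UnifC1.add
    | apply UnifC1.const_mul
    | apply UnifC1.mul

theorem UnifH.jetR (hp : UnifBddParam p) (hσ : 1 / 2 < σ) (hz : UnifH T σ z) (hz₁ : UnifH T σ z₁)
    (hw : UnifH T σ w) (hw₁ : UnifH T σ w₁) (hw₂ : UnifH T σ w₂) (hP : UnifH T σ P)
    (hP₁ : UnifH T σ P₁) (hP₂ : UnifH T σ P₂) :
    UnifH T σ fun ω t x => jetR (p ω) (z ω t x) (z₁ ω t x) (w ω t x) (w₁ ω t x) (w₂ ω t x)
      (P ω t x) (P₁ ω t x) (P₂ ω t x) := by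
  have h1 := hp.ε
  have h2 := hp.δ
  have h3 := hp.γ
  have h4 := hp.q
  unfold _root_.jetR jetLower jetUpper jetProduct
  repeat' first
    | assumption
    | exact UnifBdd.const _
    | apply UnifBdd.sub
    | apply UnifBdd.add
    | apply UnifBdd.mul
    | apply UnifH.sub
    | apply UnifH.add
    | apply UnifH.const_mul
    | apply UnifH.mul

end Jets
end

noncomputable section

open Filter Topology

/-! ### Solutions of the weakly coupled system as a family -/

/-- A strong solution of the weakly coupled system with admissible parameters, both depths being at
least `h`, and `u_l ± u_r` being bounded by `K` in `W¹([0,T); H^{s+3})`. -/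
structure SerreData (μmax εmax δmin δmax s h K : ℝ) where
  p : Param
  T : EReal
  ul : ℝ → ℝ → ℝ
  ur : ℝ → ℝ → ℝ
  mem : p ∈ paramSet μmax εmax δmin δmax
  pos : 0 < T
  diff_l : ∀ t ∈ timeInterval T, ∀ x, DifferentiableWithinAt ℝ (fun τ => ul τ x) (timeInterval T) t
  diff_r : ∀ t ∈ timeInterval T, ∀ x, DifferentiableWithinAt ℝ (fun τ => ur τ x) (timeInterval T) t
  cont_l : ∀ t ∈ timeInterval T, Continuous (ul t)
  cont_r : ∀ t ∈ timeInterval T, Continuous (ur t)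
  cont_dt_l : ∀ t ∈ timeInterval T, Continuous (dt T ul t)
  cont_dt_r : ∀ t ∈ timeInterval T, Continuous (dt T ur t)
  bound_add : ∀ t ∈ timeInterval T,
    sobolevENorm (s + 3) (fun x => ul t x + ur t x) ≤ ENNReal.ofReal K
  bound_sub : ∀ t ∈ timeInterval T,
    sobolevENorm (s + 3) (fun x => ul t x - ur t x) ≤ ENNReal.ofReal K
  bound_dt_add : ∀ t ∈ timeInterval T,
    sobolevENorm (s + 2) (dt T (fun τ x => ul τ x + ur τ x) t) ≤ ENNReal.ofReal K
  bound_dt_sub : ∀ t ∈ timeInterval T,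
    sobolevENorm (s + 2) (dt T (fun τ x => ul τ x - ur τ x) t) ≤ ENNReal.ofReal K
  solves : SolvesSerre p T ul ur
  depth : ∀ t ∈ timeInterval T, ∀ x, h ≤ depth₁ p (fun y => ul t y + ur t y) x ∧
    h ≤ depth₂ p (fun y => ul t y + ur t y) x

namespace SerreData

variable {μmax εmax δmin δmax s h K : ℝ}

/-- The deformation of the interface. -/
def ζ (D : SerreData μmax εmax δmin δmax s h K) : ℝ → ℝ → ℝ := fun t x => D.ul t x + D.ur t x

/-- The velocity divided by `γ + δ`. -/
def w (D : SerreData μmax εmax δmin δmax s h K) : ℝ → ℝ → ℝ := fun t x => D.ul t x - D.ur t x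

/-- `ζ w / (1 - q ε ζ)`. -/
def P (D : SerreData μmax εmax δmin δmax s h K) : ℝ → ℝ → ℝ := fun t => profile D.p (D.ζ t) (D.w t)

/-- The bracket of the weakly coupled system. -/
def B (D : SerreData μmax εmax δmin δmax s h K) : ℝ → ℝ → ℝ :=
  fun t => bracketFun D.p (D.ζ t) (D.w t)

/-- Second order remainder of `𝒬̄ v`. -/
def remQ (D : SerreData μmax εmax δmin δmax s h K) : ℝ → ℝ → ℝ := fun t x =>
  jetQ D.p (D.ζ t x) (deriv (D.ζ t) x) (deriv (deriv (D.ζ t)) x) (deriv (D.w t) x)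
    (deriv (deriv (D.w t)) x) (D.P t x) (deriv (D.P t) x) (deriv (deriv (D.P t)) x)

/-- First order remainder of `ℛ̄ v`. -/
def remR (D : SerreData μmax εmax δmin δmax s h K) : ℝ → ℝ → ℝ := fun t x =>
  jetR D.p (D.ζ t x) (deriv (D.ζ t) x) (D.w t x) (deriv (D.w t) x)
    (deriv (deriv (D.w t)) x) (D.P t x) (deriv (D.P t) x) (deriv (deriv (D.P t)) x)

/-- Fourth order remainder of the mass flux. -/
def remMass (D : SerreData μmax εmax δmin δmax s h K) : ℝ → ℝ → ℝ := fun t x =>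
  D.p.q ^ 2 * D.p.c₂ * (D.ζ t x * (D.ζ t x * (D.ζ t x * D.P t x)))

/-- Fourth order remainder of the velocity flux. -/
def remVelocity (D : SerreData μmax εmax δmin δmax s h K) : ℝ → ℝ → ℝ := fun t x =>
  D.p.q ^ 2 * D.p.c₂ * (1 / 2) * (4 * (D.ζ t x * (D.ζ t x * (D.P t x * D.w t x)))
    + D.p.q * D.p.ε * (D.ζ t x * (D.ζ t x * (D.P t x * D.P t x))))

section Single

variable (D : SerreData μmax εmax δmin δmax s h K)

theorem δ_pos (hδ : 0 < δmin) : 0 < D.p.δ := hδ.trans D.mem.2.2.2.2.1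

theorem δmin_le : δmin ≤ D.p.γ + D.p.δ := by
  linarith [D.mem.2.2.2.2.1, D.mem.2.2.2.2.2.2.1]

theorem γ_add_δ_le : D.p.γ + D.p.δ ≤ 1 + δmax := by
  linarith [D.mem.2.2.2.2.2.1, D.mem.2.2.2.2.2.2.2]

/-- As γh₂ ≥ 0, the sum h₁ + γh₂ is at least h, and it equals (γ + δ)/δ · (1 - qεζ). The extreme
values of δ/(γ + δ) do the rest. -/
theorem le_one_sub (hδ : 0 < δmin) (hh : 0 < h) {t : ℝ} (ht : t ∈ timeInterval D.T) (x : ℝ) :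
    h * δmin / (1 + δmax) ≤ 1 - D.p.q * D.p.ε * D.ζ t x := by
  have hδp := D.δ_pos hδ
  have hγδ := hδ.trans_le D.δmin_le
  obtain ⟨h1, h2⟩ := D.depth t ht x
  have e := depth_sum_eq hδp.ne' hγδ.ne' (D.ζ t) x
  have hle : h ≤ (D.p.γ + D.p.δ) / D.p.δ * (1 - D.p.q * D.p.ε * D.ζ t x) := by
    rw [← e]
    have : 0 ≤ D.p.γ * depth₂ D.p (D.ζ t) x :=
      mul_nonneg D.mem.2.2.2.2.2.2.1 (hh.le.trans h2)
    have h1' : h ≤ depth₁ D.p (D.ζ t) x := h1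
    linarith
  have hmax := D.γ_add_δ_le
  have h3 : h * D.p.δ / (D.p.γ + D.p.δ) ≤ 1 - D.p.q * D.p.ε * D.ζ t x := by
    rw [div_le_iff₀ hγδ]
    calc h * D.p.δ ≤ (D.p.γ + D.p.δ) / D.p.δ * (1 - D.p.q * D.p.ε * D.ζ t x) * D.p.δ := by gcongr
      _ = _ := by field_simp
  refine le_trans ?_ h3
  have := D.mem.2.2.2.2.1.le
  gcongr

end Single

section Bounds

variable (μmax εmax δmin δmax s h K)

theorem unifBddParam (hδ : 0 < δmin) :
    UnifBddParam fun D : SerreData μmax εmax δmin δmax s h K => D.p :=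
  UnifBddParam.of_mem hδ fun D => D.mem

theorem unifC1_ζ : UnifC1 (fun D : SerreData μmax εmax δmin δmax s h K => D.T) (s + 3) (s + 2) ζ where
  unifH := ⟨_, ENNReal.ofReal_lt_top, fun D t ht =>
    ⟨(D.cont_l t ht).add (D.cont_r t ht), D.bound_add t ht⟩⟩
  unifH_dt := ⟨_, ENNReal.ofReal_lt_top, fun D t ht => ⟨by
    have := dt_add_eq D.pos ht (D.diff_l t ht) (D.diff_r t ht)
    unfold ζ
    beta_reduce
    rw [this]
    exact (D.cont_dt_l t ht).add (D.cont_dt_r t ht), D.bound_dt_add t ht⟩⟩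
  differentiableWithinAt D t ht x := (D.diff_l t ht x).add (D.diff_r t ht x)

theorem unifC1_w : UnifC1 (fun D : SerreData μmax εmax δmin δmax s h K => D.T) (s + 3) (s + 2) w where
  unifH := ⟨_, ENNReal.ofReal_lt_top, fun D t ht =>
    ⟨(D.cont_l t ht).sub (D.cont_r t ht), D.bound_sub t ht⟩⟩
  unifH_dt := ⟨_, ENNReal.ofReal_lt_top, fun D t ht => ⟨by
    have := dt_sub_eq D.pos ht (D.diff_l t ht) (D.diff_r t ht)
    unfold w
    beta_reduce
    rw [this]
    exact (D.cont_dt_l t ht).sub (D.cont_dt_r t ht), D.bound_dt_sub t ht⟩⟩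
  differentiableWithinAt D t ht x := (D.diff_l t ht x).sub (D.diff_r t ht x)

theorem unifC1_P (hδ : 0 < δmin) (hδ' : 0 < δmax) (hs : 1 / 2 < s) (hh : 0 < h) :
    UnifC1 (fun D : SerreData μmax εmax δmin δmax s h K => D.T) (s + 3) (s + 2) P :=
  have hp := unifBddParam μmax εmax δmin δmax s h K hδ
  UnifC1.mul (fun D => D.pos) (by linarith) (by linarith)
    (UnifC1.div_one_sub (a := h * δmin / (1 + δmax)) (by positivity) (fun D => D.pos) (by linarith)
      (by linarith) (by linarith) (hp.q.mul hp.ε) (unifC1_ζ ..)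
      fun D _ ht x => D.le_one_sub hδ hh ht x) (unifC1_w ..)

variable {μmax εmax δmin δmax s h K}

/-- The jet of order two of a family bounded in `W¹([0,T); H^{s+3})`. -/
theorem _root_.UnifC1.jet {Ω : Type*} {T : Ω → EReal} {F : Ω → ℝ → ℝ → ℝ} {s : ℝ} (hs : 1 / 2 < s)
    (hT : ∀ ω, 0 < T ω) (hF : UnifC1 T (s + 3) (s + 2) F) :
    UnifC1 T (s + 1) s F ∧ UnifC1 T (s + 1) s (fun ω t x => deriv (F ω t) x) ∧
      UnifC1 T (s + 1) s (fun ω t x => deriv (deriv (F ω t)) x) := by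
  have h1 : UnifC1 T (s + 1 + 1) (s + 1) (fun ω t x => deriv (F ω t) x) :=
    UnifC1.deriv hT (by linarith) (by linarith) (hF.mono (by linarith) (by linarith))
  exact ⟨hF.mono (by linarith) (by linarith), h1.mono (by linarith) (by linarith),
    UnifC1.deriv hT (by linarith) (by linarith) h1⟩

variable (μmax εmax δmin δmax s h K)

theorem unifC1_B (hδ : 0 < δmin) (hs : 1 / 2 < s) :
    UnifC1 (fun D : SerreData μmax εmax δmin δmax s h K => D.T) (s + 1) s B := by
  obtain ⟨z, z₁, z₂⟩ := (unifC1_ζ μmax εmax δmin δmax s h K).jet hs fun D => D.pos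
  obtain ⟨w, w₁, w₂⟩ := (unifC1_w μmax εmax δmin δmax s h K).jet hs fun D => D.pos
  exact UnifC1.jetBracket (unifBddParam _ _ _ _ _ _ _ hδ) (fun D => D.pos) hs (by linarith)
    z z₁ z₂ w w₁ w₂

/-- This term and B use up the regularity: ∂ₜ is bounded in H^{s+2} and two space derivatives leave
H^s. -/
theorem unifC1_remQ (hδ : 0 < δmin) (hδ' : 0 < δmax) (hs : 1 / 2 < s) (hh : 0 < h) :
    UnifC1 (fun D : SerreData μmax εmax δmin δmax s h K => D.T) (s + 1) s remQ := by
  obtain ⟨z, z₁, z₂⟩ := (unifC1_ζ μmax εmax δmin δmax s h K).jet hs fun D => D.pos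
  obtain ⟨w, w₁, w₂⟩ := (unifC1_w μmax εmax δmin δmax s h K).jet hs fun D => D.pos
  obtain ⟨P, P₁, P₂⟩ := (unifC1_P μmax εmax δmin δmax s h K hδ hδ' hs hh).jet hs fun D => D.pos
  exact UnifC1.jetQ (unifBddParam _ _ _ _ _ _ _ hδ) (fun D => D.pos) hs (by linarith)
    z z₁ z₂ w₁ w₂ P P₁ P₂

theorem unifH_remR (hδ : 0 < δmin) (hδ' : 0 < δmax) (hs : 1 / 2 < s) (hh : 0 < h) :
    UnifH (fun D : SerreData μmax εmax δmin δmax s h K => D.T) (s + 1) remR := by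
  obtain ⟨z, z₁, z₂⟩ := (unifC1_ζ μmax εmax δmin δmax s h K).jet hs fun D => D.pos
  obtain ⟨w, w₁, w₂⟩ := (unifC1_w μmax εmax δmin δmax s h K).jet hs fun D => D.pos
  obtain ⟨P, P₁, P₂⟩ := (unifC1_P μmax εmax δmin δmax s h K hδ hδ' hs hh).jet hs fun D => D.pos
  exact UnifH.jetR (unifBddParam _ _ _ _ _ _ _ hδ) (by linarith) z.1 z₁.1 w.1 w₁.1 w₂.1 P.1 P₁.1
    P₂.1

theorem unifH_remMass (hδ : 0 < δmin) (hδ' : 0 < δmax) (hs : 1 / 2 < s) (hh : 0 < h) :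
    UnifH (fun D : SerreData μmax εmax δmin δmax s h K => D.T) (s + 3) remMass := by
  have hσ : 1 / 2 < s + 3 := by linarith
  have hp := unifBddParam μmax εmax δmin δmax s h K hδ
  have z := (unifC1_ζ μmax εmax δmin δmax s h K).1
  have P := (unifC1_P μmax εmax δmin δmax s h K hδ hδ' hs hh).1
  exact (z.mul hσ (z.mul hσ (z.mul hσ P))).const_mul hσ ((hp.q.pow 2).mul hp.c₂)

theorem unifH_remVelocity (hδ : 0 < δmin) (hδ' : 0 < δmax) (hs : 1 / 2 < s) (hh : 0 < h) :
    UnifH (fun D : SerreData μmax εmax δmin δmax s h K => D.T) (s + 3) remVelocity := by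
  have hσ : 1 / 2 < s + 3 := by linarith
  have hp := unifBddParam μmax εmax δmin δmax s h K hδ
  have z := (unifC1_ζ μmax εmax δmin δmax s h K).1
  have w := (unifC1_w μmax εmax δmin δmax s h K).1
  have P := (unifC1_P μmax εmax δmin δmax s h K hδ hδ' hs hh).1
  exact (((z.mul hσ (z.mul hσ (P.mul hσ w))).const_mul hσ (UnifBdd.const 4)).add hσ
    ((z.mul hσ (z.mul hσ (P.mul hσ P))).const_mul hσ (hp.q.mul hp.ε))).const_mul hσ
      (((hp.q.pow 2).mul hp.c₂).mul (UnifBdd.const (1 / 2)))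

theorem unifH_quadraticPoly (hs : 1 / 2 < s) :
    UnifH (fun D : SerreData μmax εmax δmin δmax s h K => D.T) (s + 1)
      fun D t => quadraticPoly (D.w t) := by
  have hσ : 1 / 2 < s + 1 := by linarith
  obtain ⟨w, w₁, w₂⟩ := (unifC1_w μmax εmax δmin δmax s h K).jet hs fun D => D.pos
  exact ((w.1.mul hσ w₂.1).const_mul hσ (UnifBdd.const _)).add hσ
    ((w₁.1.mul hσ w₁.1).const_mul hσ (UnifBdd.const _))

end Bounds

end SerreData
end

noncomputable section

open Filter Topology

namespace SerreData

variable {μmax εmax δmin δmax s h K : ℝ} (D : SerreData μmax εmax δmin δmax s h K) {t : ℝ}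

/-! ### Regularity of a single solution -/

theorem differentiable_ζ (hs : 1 / 2 < s) (ht : t ∈ timeInterval D.T) : Differentiable ℝ (D.ζ t) :=
  ((unifC1_ζ μmax εmax δmin δmax s h K).1.mono (by linarith)).differentiable hs ht

theorem differentiable_w (hs : 1 / 2 < s) (ht : t ∈ timeInterval D.T) : Differentiable ℝ (D.w t) :=
  ((unifC1_w μmax εmax δmin δmax s h K).1.mono (by linarith)).differentiable hs ht

theorem differentiable_P (hδ : 0 < δmin) (hδ' : 0 < δmax) (hs : 1 / 2 < s) (hh : 0 < h)
    (ht : t ∈ timeInterval D.T) : Differentiable ℝ (D.P t) :=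
  ((unifC1_P μmax εmax δmin δmax s h K hδ hδ' hs hh).1.mono (by linarith)).differentiable hs ht

theorem differentiable_deriv_ζ (hs : 1 / 2 < s) (ht : t ∈ timeInterval D.T) :
    Differentiable ℝ (deriv (D.ζ t)) :=
  ((unifC1_ζ μmax εmax δmin δmax s h K).jet hs fun D => D.pos).2.1.1.differentiable hs ht

theorem differentiable_deriv_w (hs : 1 / 2 < s) (ht : t ∈ timeInterval D.T) :
    Differentiable ℝ (deriv (D.w t)) :=
  ((unifC1_w μmax εmax δmin δmax s h K).jet hs fun D => D.pos).2.1.1.differentiable hs ht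

theorem differentiable_deriv_P (hδ : 0 < δmin) (hδ' : 0 < δmax) (hs : 1 / 2 < s) (hh : 0 < h)
    (ht : t ∈ timeInterval D.T) : Differentiable ℝ (deriv (D.P t)) :=
  ((unifC1_P μmax εmax δmin δmax s h K hδ hδ' hs hh).jet hs
    fun D => D.pos).2.1.1.differentiable hs ht

theorem ul_eq : D.ul t = fun x => 1 / 2 * (D.ζ t x + D.w t x) := by
  ext x; unfold ζ w; ring

theorem ur_eq : D.ur t = fun x => 1 / 2 * (D.ζ t x - D.w t x) := by
  ext x; unfold ζ w; ring

theorem differentiable_ul (hs : 1 / 2 < s) (ht : t ∈ timeInterval D.T) :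
    Differentiable ℝ (D.ul t) := by
  rw [ul_eq]
  exact ((D.differentiable_ζ hs ht).add (D.differentiable_w hs ht)).const_mul _

theorem differentiable_ur (hs : 1 / 2 < s) (ht : t ∈ timeInterval D.T) :
    Differentiable ℝ (D.ur t) := by
  rw [ur_eq]
  exact ((D.differentiable_ζ hs ht).sub (D.differentiable_w hs ht)).const_mul _

theorem differentiable_deriv_ul (hs : 1 / 2 < s) (ht : t ∈ timeInterval D.T) :
    Differentiable ℝ (deriv (D.ul t)) := by
  have : deriv (D.ul t) = fun x => 1 / 2 * (deriv (D.ζ t) x + deriv (D.w t) x) := by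
    rw [ul_eq]
    exact funext fun x => (((D.differentiable_ζ hs ht x).hasDerivAt.add
      (D.differentiable_w hs ht x).hasDerivAt).const_mul _).deriv
  rw [this]
  exact ((D.differentiable_deriv_ζ hs ht).add (D.differentiable_deriv_w hs ht)).const_mul _

theorem differentiable_deriv_ur (hs : 1 / 2 < s) (ht : t ∈ timeInterval D.T) :
    Differentiable ℝ (deriv (D.ur t)) := by
  have : deriv (D.ur t) = fun x => 1 / 2 * (deriv (D.ζ t) x - deriv (D.w t) x) := by
    rw [ur_eq]
    exact funext fun x => (((D.differentiable_ζ hs ht x).hasDerivAt.sub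
      (D.differentiable_w hs ht x).hasDerivAt).const_mul _).deriv
  rw [this]
  exact ((D.differentiable_deriv_ζ hs ht).sub (D.differentiable_deriv_w hs ht)).const_mul _

/-! ### The equations -/

theorem mass_eq (hδ : 0 < δmin) (hs : 1 / 2 < s) (ht : t ∈ timeInterval D.T) (x : ℝ) :
    dt D.T D.ζ t x + deriv (massPoly D.p (D.ζ t) (D.w t)) x = 0 :=
  D.solves.sum (hδ.trans_le D.δmin_le).ne' D.pos ht (D.diff_l t ht) (D.diff_r t ht)
    (D.differentiable_ul hs ht) (D.differentiable_ur hs ht) x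

theorem velocity_eq (hδ : 0 < δmin) (hs : 1 / 2 < s) (ht : t ∈ timeInterval D.T) (x : ℝ) :
    dt D.T D.w t x + deriv (D.ζ t) x + deriv (velocityPoly D.p (D.ζ t) (D.w t)) x
      - 2 * D.p.μ * D.p.ν * deriv (deriv (dt D.T D.w t)) x
      + 2 * (D.p.μ * D.p.ε * D.p.κ₃) * deriv (quadraticPoly (D.w t)) x
      - D.p.μ * D.p.ε * dt D.T D.B t x = 0 :=
  D.solves.diff (hδ.trans_le D.δmin_le).ne' D.pos ht (D.diff_l t ht) (D.diff_r t ht)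
    (fun _ hτ => D.differentiable_ul hs hτ) (fun _ hτ => D.differentiable_ur hs hτ)
    (fun _ hτ => D.differentiable_deriv_ul hs hτ) (fun _ hτ => D.differentiable_deriv_ur hs hτ) x
    ((unifC1_B μmax εmax δmin δmax s h K hδ hs).3 D t ht x)

theorem differentiable_massPoly (hs : 1 / 2 < s) (ht : t ∈ timeInterval D.T) :
    Differentiable ℝ (massPoly D.p (D.ζ t) (D.w t)) := by
  have hZ := D.differentiable_ζ hs ht
  have hW := D.differentiable_w hs ht
  unfold massPoly
  fun_prop

theorem differentiable_velocityPoly (hs : 1 / 2 < s) (ht : t ∈ timeInterval D.T) :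
    Differentiable ℝ (velocityPoly D.p (D.ζ t) (D.w t)) := by
  have hZ := D.differentiable_ζ hs ht
  have hW := D.differentiable_w hs ht
  unfold velocityPoly
  fun_prop

end SerreData
end

noncomputable section

open Filter Topology

namespace SerreData

variable {μmax εmax δmin δmax s h K : ℝ} (D : SerreData μmax εmax δmin δmax s h K) {t : ℝ}

/-! ### The Green–Naghdi operators along a solution -/

theorem one_sub_ne_zero (hδ : 0 < δmin) (hδ' : 0 < δmax) (hh : 0 < h) (ht : t ∈ timeInterval D.T)
    (x : ℝ) : 1 - D.p.q * D.p.ε * D.ζ t x ≠ 0 :=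
  ((by positivity : 0 < h * δmin / (1 + δmax)).trans_le (D.le_one_sub hδ hh ht x)).ne'

theorem hasDerivAt_massFlux (hδ : 0 < δmin) (hδ' : 0 < δmax) (hs : 1 / 2 < s) (hh : 0 < h)
    (ht : t ∈ timeInterval D.T) (x : ℝ) :
    HasDerivAt (massFlux D.p (D.ζ t) fun y => (D.p.γ + D.p.δ) * D.w t y)
      (deriv (massPoly D.p (D.ζ t) (D.w t)) x + D.p.ε ^ 4 * deriv (D.remMass t) x) x := by
  have e : massFlux D.p (D.ζ t) (fun y => (D.p.γ + D.p.δ) * D.w t y)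
      = fun y => massPoly D.p (D.ζ t) (D.w t) y + D.p.ε ^ 4 * D.remMass t y :=
    funext fun y => massFlux_eq (D.δ_pos hδ).ne' (hδ.trans_le D.δmin_le).ne' (D.ζ t) (D.w t)
      (D.one_sub_ne_zero hδ hδ' hh ht y)
  have hX : Differentiable ℝ (D.remMass t) :=
    ((unifH_remMass μmax εmax δmin δmax s h K hδ hδ' hs hh).mono
      (by linarith)).differentiable hs ht
  rw [e]
  exact (D.differentiable_massPoly hs ht x).hasDerivAt.add ((hX x).hasDerivAt.const_mul _)

/-- Proved from the quotient itself: the Taylor formula carries a factor ε/2 and says nothing about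
the flux when ε = 0. -/
theorem differentiable_velocityFlux (hδ : 0 < δmin) (hδ' : 0 < δmax) (hs : 1 / 2 < s) (hh : 0 < h)
    (ht : t ∈ timeInterval D.T) :
    Differentiable ℝ (velocityFlux D.p (D.ζ t) fun y => (D.p.γ + D.p.δ) * D.w t y) := by
  have hZ := D.differentiable_ζ hs ht
  have hW := D.differentiable_w hs ht
  have hne : ∀ x, depth₁ D.p (D.ζ t) x + D.p.γ * depth₂ D.p (D.ζ t) x ≠ 0 := fun x => by
    rw [depth_sum_eq (D.δ_pos hδ).ne' (hδ.trans_le D.δmin_le).ne']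
    exact mul_ne_zero (div_ne_zero (hδ.trans_le D.δmin_le).ne' (D.δ_pos hδ).ne')
      (D.one_sub_ne_zero hδ hδ' hh ht x)
  have h1 : Differentiable ℝ (depth₁ D.p (D.ζ t)) := by unfold depth₁; fun_prop
  have h2 : Differentiable ℝ (depth₂ D.p (D.ζ t)) := by unfold depth₂; fun_prop
  unfold velocityFlux
  refine Differentiable.mul (Differentiable.div (by fun_prop) (by fun_prop)
    fun x => pow_ne_zero 2 (hne x)) (by fun_prop)

theorem deriv_velocityFlux (hδ : 0 < δmin) (hδ' : 0 < δmax) (hs : 1 / 2 < s) (hh : 0 < h)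
    (ht : t ∈ timeInterval D.T) (x : ℝ) :
    D.p.ε / 2 * deriv (velocityFlux D.p (D.ζ t) fun y => (D.p.γ + D.p.δ) * D.w t y) x
      = (D.p.γ + D.p.δ) * (deriv (velocityPoly D.p (D.ζ t) (D.w t)) x
        + D.p.ε ^ 4 * deriv (D.remVelocity t) x) := by
  have e : (fun y => D.p.ε / 2 * velocityFlux D.p (D.ζ t) (fun y => (D.p.γ + D.p.δ) * D.w t y) y)
      = fun y => (D.p.γ + D.p.δ) * (velocityPoly D.p (D.ζ t) (D.w t) y
        + D.p.ε ^ 4 * D.remVelocity t y) := by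
    ext y
    rw [velocityFlux_eq (D.δ_pos hδ).ne' (hδ.trans_le D.δmin_le).ne' (D.ζ t) (D.w t)
      (D.one_sub_ne_zero hδ hδ' hh ht y)]
    unfold velocityPoly remVelocity P
    ring
  have hX : Differentiable ℝ (D.remVelocity t) :=
    ((unifH_remVelocity μmax εmax δmin δmax s h K hδ hδ' hs hh).mono
      (by linarith)).differentiable hs ht
  have hV := D.differentiable_velocityFlux hδ hδ' hs hh ht x
  refine ((hV.hasDerivAt.const_mul (D.p.ε / 2)).unique ?_)
  rw [e]
  exact ((D.differentiable_velocityPoly hs ht x).hasDerivAt.add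
    ((hX x).hasDerivAt.const_mul _)).const_mul _

theorem hasDerivAt_quadraticTerm (hδ : 0 < δmin) (hδ' : 0 < δmax) (hs : 1 / 2 < s) (hh : 0 < h)
    (ht : t ∈ timeInterval D.T) (x : ℝ) :
    HasDerivAt (quadraticTerm D.p (D.ζ t) fun y => (D.p.γ + D.p.δ) * D.w t y)
      ((1 - D.p.γ) * deriv (quadraticPoly (D.w t)) x + D.p.ε * deriv (D.remR t) x) x := by
  have e : quadraticTerm D.p (D.ζ t) (fun y => (D.p.γ + D.p.δ) * D.w t y)
      = fun y => (1 - D.p.γ) * quadraticPoly (D.w t) y + D.p.ε * D.remR t y :=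
    funext fun y => opR_eq (D.δ_pos hδ).ne' (hδ.trans_le D.δmin_le).ne'
      (D.one_sub_ne_zero hδ hδ' hh ht) (D.differentiable_ζ hs ht) (D.differentiable_w hs ht)
      (D.differentiable_P hδ hδ' hs hh ht) (D.differentiable_deriv_w hs ht)
      (D.differentiable_deriv_P hδ hδ' hs hh ht) (hh.trans_le (D.depth t ht y).1).ne'
      (hh.trans_le (D.depth t ht y).2).ne'
  have hX : Differentiable ℝ (D.remR t) :=
    (unifH_remR μmax εmax δmin δmax s h K hδ hδ' hs hh).differentiable hs ht
  have hQ : Differentiable ℝ (quadraticPoly (D.w t)) :=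
    (unifH_quadraticPoly μmax εmax δmin δmax s h K hs).differentiable hs ht
  rw [e]
  exact ((hQ x).hasDerivAt.const_mul _).add ((hX x).hasDerivAt.const_mul _)

theorem hasDerivWithinAt_deriv_deriv_w (hs : 1 / 2 < s) (ht : t ∈ timeInterval D.T) (x : ℝ) :
    HasDerivWithinAt (fun τ => deriv (deriv (D.w τ)) x) (deriv (deriv (dt D.T D.w t)) x)
      (timeInterval D.T) t := by
  have hw : UnifC1 (fun D : SerreData μmax εmax δmin δmax s h K => D.T) (s + 1 + 1 + 1) (s + 1 + 1)
      w := (unifC1_w μmax εmax δmin δmax s h K).mono (by linarith) (by linarith)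
  have h1 := UnifC1.deriv (fun D => D.pos) (by linarith) (by linarith) hw
  have h2 := h1.hasDerivWithinAt_deriv (by linarith) hs ht x
  have e : dt D.T (fun τ y => deriv (D.w τ) y) t = deriv (dt D.T D.w t) :=
    funext fun y => dt_eq D.pos ht (hw.hasDerivWithinAt_deriv (by linarith) (by linarith) ht y)
  rwa [e] at h2

theorem hasDerivWithinAt_momentum (hδ : 0 < δmin) (hδ' : 0 < δmax) (hs : 1 / 2 < s) (hh : 0 < h)
    (ht : t ∈ timeInterval D.T) (x : ℝ) :
    HasDerivWithinAt (fun τ => momentum D.p D.ζ (fun τ y => (D.p.γ + D.p.δ) * D.w τ y) τ x)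
      ((D.p.γ + D.p.δ) * (dt D.T D.w t x - 2 * D.p.μ * D.p.ν * deriv (deriv (dt D.T D.w t)) x
        - D.p.μ * D.p.ε * dt D.T D.B t x) + D.p.μ * D.p.ε ^ 2 * dt D.T D.remQ t x)
      (timeInterval D.T) t := by
  have e : ∀ τ ∈ timeInterval D.T, momentum D.p D.ζ (fun τ y => (D.p.γ + D.p.δ) * D.w τ y) τ x
      = (D.p.γ + D.p.δ) * (D.w τ x - 2 * D.p.μ * D.p.ν * deriv (deriv (D.w τ)) x
        - D.p.μ * D.p.ε * D.B τ x) + D.p.μ * D.p.ε ^ 2 * D.remQ τ x := by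
    intro τ hτ
    unfold momentum
    rw [opQ_eq (D.δ_pos hδ).ne' (hδ.trans_le D.δmin_le).ne'
      (D.one_sub_ne_zero hδ hδ' hh hτ) (D.differentiable_ζ hs hτ) (D.differentiable_w hs hτ)
      (D.differentiable_P hδ hδ' hs hh hτ) (D.differentiable_deriv_ζ hs hτ)
      (D.differentiable_deriv_w hs hτ)
      (D.differentiable_deriv_P hδ hδ' hs hh hτ) (hh.trans_le (D.depth τ hτ x).1).ne'
      (hh.trans_le (D.depth τ hτ x).2).ne']
    unfold B remQ bracketFun P
    ring
  refine HasDerivWithinAt.congr ?_ e (e t ht)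
  exact ((((unifC1_w μmax εmax δmin δmax s h K).hasDerivWithinAt ht x).sub
    ((D.hasDerivWithinAt_deriv_deriv_w hs ht x).const_mul _)).sub
    (((unifC1_B μmax εmax δmin δmax s h K hδ hs).hasDerivWithinAt ht x).const_mul _)).const_mul
      (D.p.γ + D.p.δ) |>.add
    (((unifC1_remQ μmax εmax δmin δmax s h K hδ hδ' hs hh).hasDerivWithinAt ht x).const_mul _)

/-- The residual of the mass equation. -/
def res₁ : ℝ → ℝ → ℝ := fun t x => D.p.ε ^ 4 / serrePrecision D.p * deriv (D.remMass t) x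

/-- The residual of the velocity equation. -/
def res₂ : ℝ → ℝ → ℝ := fun t x =>
  D.p.ε ^ 4 / serrePrecision D.p * ((D.p.γ + D.p.δ) * deriv (D.remVelocity t) x)
    + D.p.μ * D.p.ε ^ 2 / serrePrecision D.p * (dt D.T D.remQ t x - deriv (D.remR t) x)

/-- If the precision vanishes, so do both of its nonnegative summands; the division by zero in the
residuals is then harmless. -/
theorem serrePrecision_mul_div :
    serrePrecision D.p * (D.p.ε ^ 4 / serrePrecision D.p) = D.p.ε ^ 4 ∧
    serrePrecision D.p * (D.p.μ * D.p.ε ^ 2 / serrePrecision D.p) = D.p.μ * D.p.ε ^ 2 := by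
  have hμ := D.mem.1
  have hε := D.mem.2.2.1
  constructor <;>
  · refine mul_div_cancel_of_imp' fun h0 => ?_
    unfold serrePrecision at h0
    have h1 : 0 ≤ D.p.μ * D.p.ε ^ 2 := by positivity
    have h2 : 0 ≤ D.p.ε ^ 4 := by positivity
    linarith

theorem solvesGN (hδ : 0 < δmin) (hδ' : 0 < δmax) (hs : 1 / 2 < s) (hh : 0 < h) :
    SolvesGN D.p D.T D.ζ (fun t x => (D.p.γ + D.p.δ) * D.w t x)
      (fun t x => serrePrecision D.p * D.res₁ t x) (fun t x => serrePrecision D.p * D.res₂ t x) := by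
  intro t ht x
  obtain ⟨e1, e2⟩ := D.serrePrecision_mul_div
  have hm := D.hasDerivAt_massFlux hδ hδ' hs hh ht x
  have hq := D.hasDerivAt_quadraticTerm hδ hδ' hs hh ht x
  have hd := D.hasDerivWithinAt_momentum hδ hδ' hs hh ht x
  refine ⟨(unifC1_ζ μmax εmax δmin δmax s h K).3 D t ht x, hd.differentiableWithinAt,
    D.differentiable_ζ hs ht x, hm.differentiableAt,
    D.differentiable_velocityFlux hδ hδ' hs hh ht x, hq.differentiableAt, ?_, ?_⟩
  · rw [hm.deriv]
    unfold res₁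
    linear_combination D.mass_eq hδ hs ht x - deriv (D.remMass t) x * e1
  · rw [hq.deriv, dt_eq D.pos ht hd, D.deriv_velocityFlux hδ hδ' hs hh ht x]
    -- κ₃ is normalised so that the order zero part (1 - γ)(ww″/3 + w′²/2) of ℛ̄ is matched.
    have hκ : 2 * D.p.κ₃ * (D.p.γ + D.p.δ) = D.p.γ - 1 := by
      have := (hδ.trans_le D.δmin_le).ne'
      unfold Param.κ₃
      field_simp
    unfold res₂
    linear_combination (D.p.γ + D.p.δ) * D.velocity_eq hδ hs ht x
      - (D.p.γ + D.p.δ) * deriv (D.remVelocity t) x * e1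
      - (dt D.T D.remQ t x - deriv (D.remR t) x) * e2
      - D.p.μ * D.p.ε * deriv (quadraticPoly (D.w t)) x * hκ

theorem unifBdd_quotients :
    UnifBdd (fun D : SerreData μmax εmax δmin δmax s h K => D.p.ε ^ 4 / serrePrecision D.p) ∧
    UnifBdd (fun D : SerreData μmax εmax δmin δmax s h K =>
      D.p.μ * D.p.ε ^ 2 / serrePrecision D.p) := by
  constructor <;>
  · refine ⟨1, fun D => ?_⟩
    have hμ := D.mem.1
    have hε := D.mem.2.2.1
    have h1 : 0 ≤ D.p.μ * D.p.ε ^ 2 := by positivity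
    have h2 : 0 ≤ D.p.ε ^ 4 := by positivity
    have h3 : 0 ≤ serrePrecision D.p := add_nonneg h1 h2
    rw [abs_of_nonneg (by positivity)]
    exact div_le_one_of_le₀ (by unfold serrePrecision; linarith) h3

variable (μmax εmax δmin δmax s h K)

theorem unifH_res₁ (hδ : 0 < δmin) (hδ' : 0 < δmax) (hs : 1 / 2 < s) (hh : 0 < h) :
    UnifH (fun D : SerreData μmax εmax δmin δmax s h K => D.T) s res₁ :=
  (UnifH.deriv hs ((unifH_remMass μmax εmax δmin δmax s h K hδ hδ' hs hh).mono
    (by linarith))).const_mul hs unifBdd_quotients.1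

theorem unifH_res₂ (hδ : 0 < δmin) (hδ' : 0 < δmax) (hs : 1 / 2 < s) (hh : 0 < h) :
    UnifH (fun D : SerreData μmax εmax δmin δmax s h K => D.T) s res₂ :=
  have hp := unifBddParam μmax εmax δmin δmax s h K hδ
  (((UnifH.deriv hs ((unifH_remVelocity μmax εmax δmin δmax s h K hδ hδ' hs hh).mono
    (by linarith))).const_mul hs (hp.γ.add hp.δ)).const_mul hs unifBdd_quotients.1).add hs
  (((unifC1_remQ μmax εmax δmin δmax s h K hδ hδ' hs hh).2.sub hs
    (UnifH.deriv hs (unifH_remR μmax εmax δmin δmax s h K hδ hδ' hs hh))).const_mul hs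
    unifBdd_quotients.2)

end SerreData

/-! ### From uniform families to constants -/

theorem UnifH.memLinfty {Ω : Type*} {T : Ω → EReal} {σ : ℝ} {F : Ω → ℝ → ℝ → ℝ} (hF : UnifH T σ F)
    (ω : Ω) : MemLinfty (T ω) σ (F ω) := by
  refine ⟨fun t ht => hF.continuous ht, ?_⟩
  obtain ⟨K, hK, h⟩ := hF
  exact (iSup₂_le fun t ht => (h ω t ht).2).trans_lt hK

theorem UnifH.exists_linftyENorm_le {Ω : Type*} {T : Ω → EReal} {σ : ℝ} {F : Ω → ℝ → ℝ → ℝ}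
    (hF : UnifH T σ F) : ∃ C : ℝ, 0 ≤ C ∧ ∀ ω, linftyENorm (T ω) σ (F ω) ≤ ENNReal.ofReal C := by
  obtain ⟨K, hK, h⟩ := hF
  refine ⟨K.toReal, ENNReal.toReal_nonneg, fun ω => ?_⟩
  rw [ENNReal.ofReal_toReal hK.ne]
  exact iSup₂_le fun t ht => (h ω t ht).2

/-- The constant bounds a family indexed by all of `SerreData`, hence depends only on the parameters
of that type; T belongs to the data and does not enter. -/
theorem exists_consistent {μmax εmax δmin δmax s h : ℝ} (hδ : 0 < δmin) (hδ' : 0 < δmax)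
    (hs : 1 / 2 < s) (hh : 0 < h) (K : ℝ) :
    ∃ C : ℝ, 0 < C ∧ ∀ D : SerreData μmax εmax δmin δmax s h K, ∃ r₁ r₂ : ℝ → ℝ → ℝ,
      SolvesGN D.p D.T D.ζ (fun t x => (D.p.γ + D.p.δ) * D.w t x)
        (fun t x => serrePrecision D.p * r₁ t x) (fun t x => serrePrecision D.p * r₂ t x) ∧
      MemLinfty D.T s r₁ ∧ MemLinfty D.T s r₂ ∧
      linftyENorm D.T s r₁ + linftyENorm D.T s r₂ ≤ ENNReal.ofReal C := by
  have h1 := SerreData.unifH_res₁ μmax εmax δmin δmax s h K hδ hδ' hs hh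
  have h2 := SerreData.unifH_res₂ μmax εmax δmin δmax s h K hδ hδ' hs hh
  obtain ⟨C₁, hC₁, hb₁⟩ := h1.exists_linftyENorm_le
  obtain ⟨C₂, hC₂, hb₂⟩ := h2.exists_linftyENorm_le
  -- The summand 1 makes the constant positive.
  refine ⟨C₁ + C₂ + 1, by positivity, fun D => ⟨D.res₁, D.res₂, D.solvesGN hδ hδ' hs hh,
    h1.memLinfty D, h2.memLinfty D, ?_⟩⟩
  refine (add_le_add (hb₁ D) (hb₂ D)).trans ?_
  rw [← ENNReal.ofReal_add hC₁ hC₂]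
  exact ENNReal.ofReal_le_ofReal (by linarith)

end

noncomputable section

open Filter Topology

/-! ### Control of the time derivatives -/

theorem sobolevENorm_neg_deriv_le {σ : ℝ} (hσ : 1 / 2 < σ) {f g : ℝ → ℝ} (c : ℝ)
    (hf : Continuous f) (hf' : sobolevENorm (σ + 1) f < ⊤) (hg : Continuous g)
    (hg' : sobolevENorm (σ + 1) g < ⊤) :
    sobolevENorm σ (fun x => -1 * deriv f x + -c * deriv g x)
      ≤ sobolevENorm (σ + 1) f + ENNReal.ofReal |c| * sobolevENorm (σ + 1) g := by
  have cf := continuous_deriv_of_sobolevENorm hσ hf hf'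
  have cg := continuous_deriv_of_sobolevENorm hσ hg hg'
  have bf := sobolevENorm_deriv_le hσ hf
  have bg := sobolevENorm_deriv_le hσ hg
  refine (sobolevENorm_add_le hσ (cf.const_mul _) (cg.const_mul _)).trans ?_
  rw [sobolevENorm_const_mul hσ _ cf (bf.trans_lt hf'),
    sobolevENorm_const_mul hσ _ cg (bg.trans_lt hg'), abs_neg, abs_neg, abs_one,
    ENNReal.ofReal_one, one_mul]
  gcongr

theorem UnifH.exists_sobolevENorm_le {Ω : Type*} {T : Ω → EReal} {σ : ℝ} {F : Ω → ℝ → ℝ → ℝ}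
    (hF : UnifH T σ F) : ∃ C : ℝ, 0 ≤ C ∧
      ∀ ω, ∀ t ∈ timeInterval (T ω), sobolevENorm σ (F ω t) ≤ ENNReal.ofReal C := by
  obtain ⟨K, hK, h⟩ := hF
  refine ⟨K.toReal, ENNReal.toReal_nonneg, fun ω t ht => ?_⟩
  rw [ENNReal.ofReal_toReal hK.ne]
  exact (h ω t ht).2

namespace SerreData

variable {μmax εmax δmin δmax s h K : ℝ} (D : SerreData μmax εmax δmin δmax s h K) {t : ℝ}

/-- The nonlinear part of the mass flux, divided by `ε`. -/
def fluxMass : ℝ → ℝ → ℝ := fun t x =>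
  D.p.c₁ * (D.ζ t x * D.w t x) + D.p.ε * D.p.c₂ * (D.ζ t x * (D.ζ t x * D.w t x))
    + D.p.ε ^ 2 * (D.p.q * D.p.c₂) * (D.ζ t x * (D.ζ t x * (D.ζ t x * D.w t x)))

/-- The velocity flux divided by `ε`. -/
def fluxVelocity : ℝ → ℝ → ℝ := fun t x =>
  D.p.c₁ * (1 / 2) * (D.w t x * D.w t x) + D.p.ε * D.p.c₂ * (D.ζ t x * (D.w t x * D.w t x))
    + D.p.ε ^ 2 * (3 / 2) * (D.p.q * D.p.c₂) * (D.ζ t x * (D.ζ t x * (D.w t x * D.w t x)))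

/-- The dispersive terms of the velocity equation, divided by `μ ε`. -/
def dispersion : ℝ → ℝ → ℝ := fun t x =>
  -2 * D.p.κ₃ * deriv (quadraticPoly (D.w t)) x + dt D.T D.B t x

variable (μmax εmax δmin δmax s h K)

theorem unifH_fluxMass (hδ : 0 < δmin) (hs : 1 / 2 < s) :
    UnifH (fun D : SerreData μmax εmax δmin δmax s h K => D.T) (s + 3) fluxMass := by
  have hσ : 1 / 2 < s + 3 := by linarith
  have hp := unifBddParam μmax εmax δmin δmax s h K hδ
  have z := (unifC1_ζ μmax εmax δmin δmax s h K).1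
  have w := (unifC1_w μmax εmax δmin δmax s h K).1
  exact (((z.mul hσ w).const_mul hσ hp.c₁).add hσ
    ((z.mul hσ (z.mul hσ w)).const_mul hσ (hp.ε.mul hp.c₂))).add hσ
    ((z.mul hσ (z.mul hσ (z.mul hσ w))).const_mul hσ ((hp.ε.pow 2).mul (hp.q.mul hp.c₂)))

theorem unifH_fluxVelocity (hδ : 0 < δmin) (hs : 1 / 2 < s) :
    UnifH (fun D : SerreData μmax εmax δmin δmax s h K => D.T) (s + 3) fluxVelocity := by
  have hσ : 1 / 2 < s + 3 := by linarith
  have hp := unifBddParam μmax εmax δmin δmax s h K hδ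
  have z := (unifC1_ζ μmax εmax δmin δmax s h K).1
  have w := (unifC1_w μmax εmax δmin δmax s h K).1
  exact (((w.mul hσ w).const_mul hσ (hp.c₁.mul (UnifBdd.const _))).add hσ
    ((z.mul hσ (w.mul hσ w)).const_mul hσ (hp.ε.mul hp.c₂))).add hσ
    ((z.mul hσ (z.mul hσ (w.mul hσ w))).const_mul hσ
      (((hp.ε.pow 2).mul (UnifBdd.const _)).mul (hp.q.mul hp.c₂)))

theorem unifH_dispersion (hδ : 0 < δmin) (hs : 1 / 2 < s) :
    UnifH (fun D : SerreData μmax εmax δmin δmax s h K => D.T) s dispersion :=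
  have hp := unifBddParam μmax εmax δmin δmax s h K hδ
  ((UnifH.deriv hs (unifH_quadraticPoly μmax εmax δmin δmax s h K hs)).const_mul hs
    ((UnifBdd.const (-2)).mul hp.κ₃)).add hs (unifC1_B μmax εmax δmin δmax s h K hδ hs).2

variable {μmax εmax δmin δmax s h K}

theorem dt_ζ_eq (hδ : 0 < δmin) (hs : 1 / 2 < s) (ht : t ∈ timeInterval D.T) :
    dt D.T D.ζ t = fun x => -1 * deriv (D.w t) x + -D.p.ε * deriv (D.fluxMass t) x := by
  ext x
  have hX : Differentiable ℝ (D.fluxMass t) :=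
    ((unifH_fluxMass μmax εmax δmin δmax s h K hδ hs).mono (by linarith)).differentiable hs ht
  have e : massPoly D.p (D.ζ t) (D.w t) = fun y => D.w t y + D.p.ε * D.fluxMass t y := by
    ext y; unfold massPoly fluxMass; ring
  have := D.mass_eq hδ hs ht x
  rw [e, ((D.differentiable_w hs ht x).hasDerivAt.fun_add
    ((hX x).hasDerivAt.const_mul D.p.ε)).deriv] at this
  linarith

/-- `dispersion` contains ∂ₜB, hence two space derivatives of ∂ₜζ and ∂ₜw, and is bounded in H^s
only. The factor μ is kept in front of it, to be absorbed by 1 - 2μν∂ₓ². -/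
theorem dt_w_eq (hδ : 0 < δmin) (hs : 1 / 2 < s) (ht : t ∈ timeInterval D.T) (x : ℝ) :
    dt D.T D.w t x - 2 * D.p.μ * D.p.ν * deriv (deriv (dt D.T D.w t)) x
      = (-1 * deriv (D.ζ t) x + -D.p.ε * deriv (D.fluxVelocity t) x)
        + D.p.μ * (D.p.ε * D.dispersion t x) := by
  have hX : Differentiable ℝ (D.fluxVelocity t) :=
    ((unifH_fluxVelocity μmax εmax δmin δmax s h K hδ hs).mono (by linarith)).differentiable hs ht
  have e : velocityPoly D.p (D.ζ t) (D.w t) = fun y => D.p.ε * D.fluxVelocity t y := by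
    ext y; unfold velocityPoly fluxVelocity; ring
  have := D.velocity_eq hδ hs ht x
  rw [e, ((hX x).hasDerivAt.const_mul D.p.ε).deriv] at this
  unfold dispersion
  linear_combination this

/-- A lower bound of ν makes 1 - 2μν∂ₓ² control μ∂ₓ² uniformly in the parameters. -/
theorem le_ν (hδ : 0 < δmin) : 1 / (6 * (δmax * (δmax + 1))) ≤ D.p.ν := by
  have h0 := D.δ_pos hδ
  have h1 := D.mem.2.2.2.2.2.1
  have h2 := D.mem.2.2.2.2.2.2.1
  have h3 := D.mem.2.2.2.2.2.2.2
  unfold Param.ν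
  rw [div_mul_div_comm, one_mul]
  have h4 : 0 ≤ D.p.γ * D.p.δ := by positivity
  have h5 := h0.trans h1
  exact div_le_div₀ (by positivity) (by linarith) (by positivity) (by gcongr)

/-- The time derivatives are controlled by the `H^{s+3}` norms up to a term of size `ε`. -/
theorem exists_dt_bounds (hμ : 0 < μmax) (hδ : 0 < δmin) (hδ' : 0 < δmax) (hs : 1 / 2 < s) (h K : ℝ) :
    ∃ L : ℝ, 0 ≤ L ∧ ∀ D : SerreData μmax εmax δmin δmax s h K, ∀ t ∈ timeInterval D.T,
      sobolevENorm (s + 2) (dt D.T D.ζ t) ≤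
        sobolevENorm (s + 3) (D.w t) + ENNReal.ofReal (D.p.ε * L) ∧
      sobolevENorm (s + 2) (dt D.T D.w t) ≤
        sobolevENorm (s + 3) (D.ζ t) + ENNReal.ofReal (D.p.ε * L) := by
  have hM := unifH_fluxMass μmax εmax δmin δmax s h K hδ hs
  have hV := unifH_fluxVelocity μmax εmax δmin δmax s h K hδ hs
  have hX := unifH_dispersion μmax εmax δmin δmax s h K hδ hs
  obtain ⟨L₁, hL₁, b₁⟩ := hM.exists_sobolevENorm_le
  obtain ⟨L₂, hL₂, b₂⟩ := hV.exists_sobolevENorm_le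
  obtain ⟨L₃, hL₃, b₃⟩ := hX.exists_sobolevENorm_le
  have e3 : s + 3 = s + 2 + 1 := by ring
  -- k serves μ(1 + y) ≤ k(1 + 2μνy): μmax bounds μ, and 6δmax(δmax + 1)ν ≥ 1 turns μy into at most
  -- 3δmax(δmax + 1) · 2μνy.
  set k : ℝ := μmax + 3 * (δmax * (δmax + 1)) with hk
  have hk0 : 0 ≤ k := by positivity
  refine ⟨L₁ + (L₂ + k * L₃), by positivity, fun D t ht => ?_⟩
  have hε := D.mem.2.2.1
  have hz := (unifC1_ζ μmax εmax δmin δmax s h K)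
  have hw := (unifC1_w μmax εmax δmin δmax s h K)
  have cz := hz.1.continuous ht
  have cw := hw.1.continuous ht
  have cM := hM.continuous ht
  have cV := hV.continuous ht
  have lz := hz.1.lt_top ht
  have lw := hw.1.lt_top ht
  have lM := hM.lt_top ht
  have lV := hV.lt_top ht
  have b₁' := b₁ D t ht
  have b₂' := b₂ D t ht
  rw [e3] at lz lw lM lV b₁' b₂' ⊢
  constructor
  · rw [D.dt_ζ_eq hδ hs ht]
    refine (sobolevENorm_neg_deriv_le (by linarith) D.p.ε cw lw cM lM).trans ?_
    gcongr
    rw [abs_of_nonneg hε, ENNReal.ofReal_mul hε]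
    gcongr
    exact b₁'.trans (ENNReal.ofReal_le_ofReal (le_add_of_nonneg_right (by positivity)))
  · have cX := hX.continuous ht
    have hd : sobolevENorm s (fun x => D.p.ε * D.dispersion t x)
        = ENNReal.ofReal |D.p.ε| * sobolevENorm s (D.dispersion t) :=
      sobolevENorm_const_mul hs _ cX (hX.lt_top ht)
    have hν := D.le_ν hδ
    have hν0 : 0 ≤ D.p.ν := le_trans (by positivity) hν
    have hμ0 := D.mem.1
    have hmk : ∀ y : ℝ, 0 ≤ y → D.p.μ * (1 + y) ≤ k * (1 + 2 * D.p.μ * D.p.ν * y) := by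
      intro y hy
      have h1 : 1 ≤ 6 * (δmax * (δmax + 1)) * D.p.ν := by
        rw [div_le_iff₀ (by positivity)] at hν
        linarith
      have h2 : D.p.μ * y * 1 ≤ D.p.μ * y * (6 * (δmax * (δmax + 1)) * D.p.ν) := by gcongr
      have h3 : 0 ≤ μmax * (2 * D.p.μ * D.p.ν * y) := by positivity
      have h4 : 0 ≤ 3 * (δmax * (δmax + 1)) := by positivity
      rw [hk]
      linarith [D.mem.2.1]
    refine (sobolevENorm_le_of_elliptic hs (by positivity) hμ0 hk0 hmk (hw.2.continuous ht)
      (hw.2.lt_top ht) (cX.const_mul _) ?_ (D.dt_w_eq hδ hs ht)).trans ?_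
    · rw [hd]
      exact ENNReal.mul_lt_top ENNReal.ofReal_lt_top (hX.lt_top ht)
    refine (add_le_add_left
      (sobolevENorm_neg_deriv_le (by linarith) D.p.ε cz lz cV lV) _).trans ?_
    rw [hd, add_assoc, abs_of_nonneg hε]
    gcongr
    calc ENNReal.ofReal D.p.ε * sobolevENorm (s + 2 + 1) (D.fluxVelocity t)
          + ENNReal.ofReal k * (ENNReal.ofReal D.p.ε * sobolevENorm s (D.dispersion t))
        ≤ ENNReal.ofReal D.p.ε * ENNReal.ofReal L₂
          + ENNReal.ofReal k * (ENNReal.ofReal D.p.ε * ENNReal.ofReal L₃) := by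
          gcongr
          exact b₃ D t ht
      _ = ENNReal.ofReal (D.p.ε * (L₂ + k * L₃)) := by
          rw [← ENNReal.ofReal_mul hε, ← ENNReal.ofReal_mul hε, ← ENNReal.ofReal_mul hk0,
            ← ENNReal.ofReal_add (by positivity) (by positivity)]
          congr 1
          ring
      _ ≤ _ := ENNReal.ofReal_le_ofReal (mul_le_mul_of_nonneg_left (by linarith) hε)

end SerreData
end

noncomputable section

open Filter Topology

/-! ### Consistency -/

theorem sobolevENorm_sub_le {σ : ℝ} (hσ : 1 / 2 < σ) {f g : ℝ → ℝ} (hf : Continuous f)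
    (hg : Continuous g) (hg' : sobolevENorm σ g < ⊤) :
    sobolevENorm σ (fun x => f x - g x) ≤ sobolevENorm σ f + sobolevENorm σ g := by
  have e : (fun x => f x - g x) = fun x => f x + -1 * g x := by ext x; ring
  rw [e]
  refine (sobolevENorm_add_le hσ hf (hg.const_mul _)).trans ?_
  rw [sobolevENorm_const_mul hσ _ hg hg', abs_neg, abs_one, ENNReal.ofReal_one, one_mul]

theorem sobolevENorm_le_linftyENorm {T : EReal} {σ : ℝ} {u : ℝ → ℝ → ℝ} {t : ℝ}
    (ht : t ∈ timeInterval T) : sobolevENorm σ (u t) ≤ linftyENorm T σ u :=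
  le_iSup₂_of_le t ht le_rfl

/-- A member of a family of solutions of the weakly coupled system. -/
def SerreFamily.data {μmax εmax δmin δmax s h M : ℝ} {S : Set Param} {T : EReal}
    {ul ur : Param → ℝ → ℝ → ℝ} (hF : SerreFamily S T s h M ul ur) (hs : 1 / 2 < s)
    (hS : S ⊆ paramSet μmax εmax δmin δmax) (hT : 0 < T) {p : Param} (hp : p ∈ S) :
    SerreData μmax εmax δmin δmax s h M :=
  have hl := (hF p hp).1
  have hr := (hF p hp).2.1
  have hb : ∀ t ∈ timeInterval T,
      sobolevENorm (s + 3) (ul p t) + sobolevENorm (s + 3) (ur p t) ≤ ENNReal.ofReal M :=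
    fun t ht => le_trans (add_le_add
      ((sobolevENorm_le_linftyENorm ht).trans le_self_add)
      ((sobolevENorm_le_linftyENorm ht).trans le_self_add)) (hF p hp).2.2.1
  have e : s + 3 - 1 = s + 2 := by ring
  have hb' : ∀ t ∈ timeInterval T, sobolevENorm (s + 2) (dt T (ul p) t)
      + sobolevENorm (s + 2) (dt T (ur p) t) ≤ ENNReal.ofReal M := by
    intro t ht
    rw [← e]
    exact le_trans (add_le_add
      ((sobolevENorm_le_linftyENorm ht).trans le_add_self)
      ((sobolevENorm_le_linftyENorm ht).trans le_add_self)) (hF p hp).2.2.1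
  { p := p
    T := T
    ul := ul p
    ur := ur p
    mem := hS hp
    pos := hT
    diff_l := hl.2.1
    diff_r := hr.2.1
    cont_l := hl.1.1
    cont_r := hr.1.1
    cont_dt_l := hl.2.2.1
    cont_dt_r := hr.2.2.1
    bound_add := fun t ht =>
      (sobolevENorm_add_le (by linarith) (hl.1.1 t ht) (hr.1.1 t ht)).trans (hb t ht)
    bound_sub := fun t ht =>
      (sobolevENorm_sub_le (by linarith) (hl.1.1 t ht) (hr.1.1 t ht)
        ((le_add_self.trans (hb t ht)).trans_lt ENNReal.ofReal_lt_top)).trans (hb t ht)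
    bound_dt_add := fun t ht => by
      rw [dt_add_eq hT ht (hl.2.1 t ht) (hr.2.1 t ht)]
      exact (sobolevENorm_add_le (by linarith) (hl.2.2.1 t ht) (hr.2.2.1 t ht)).trans (hb' t ht)
    bound_dt_sub := fun t ht => by
      rw [dt_sub_eq hT ht (hl.2.1 t ht) (hr.2.1 t ht)]
      exact (sobolevENorm_sub_le (by linarith) (hl.2.2.1 t ht) (hr.2.2.1 t ht)
        ((le_add_self.trans (hb' t ht)).trans_lt ENNReal.ofReal_lt_top)).trans (hb' t ht)
    solves := (hF p hp).2.2.2.1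
    depth := (hF p hp).2.2.2.2 }

namespace SerreData

variable {μmax εmax δmin δmax s h K : ℝ} (D : SerreData μmax εmax δmin δmax s h K) {t : ℝ}

/-- The velocity. -/
def v : ℝ → ℝ → ℝ := fun t x => (D.p.γ + D.p.δ) * D.w t x

theorem memLinfty_ζ : MemLinfty D.T (s + 3) D.ζ :=
  (unifC1_ζ μmax εmax δmin δmax s h K).1.memLinfty D

theorem unifH_v (μmax εmax δmin δmax s h K : ℝ) (hδ : 0 < δmin) (hs : 1 / 2 < s) :
    UnifH (fun D : SerreData μmax εmax δmin δmax s h K => D.T) (s + 3) v :=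
  have hp := unifBddParam μmax εmax δmin δmax s h K hδ
  (unifC1_w μmax εmax δmin δmax s h K).1.const_mul (by linarith) (hp.γ.add hp.δ)

theorem exists_uniform_bound (hδ : 0 < δmin) (hs : 1 / 2 < s) (h K : ℝ) :
    ∃ C : ℝ, ∀ D : SerreData μmax εmax δmin δmax s h K,
      MemLinfty D.T (s + 3) D.ζ ∧ MemLinfty D.T (s + 3) D.v ∧
      linftyENorm D.T (s + 3) D.ζ + linftyENorm D.T (s + 3) D.v ≤ ENNReal.ofReal C := by
  have h1 := (unifC1_ζ μmax εmax δmin δmax s h K).1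
  have h2 := unifH_v μmax εmax δmin δmax s h K hδ hs
  obtain ⟨C₁, hC₁, hb₁⟩ := h1.exists_linftyENorm_le
  obtain ⟨C₂, hC₂, hb₂⟩ := h2.exists_linftyENorm_le
  refine ⟨C₁ + C₂, fun D => ⟨h1.memLinfty D, h2.memLinfty D, ?_⟩⟩
  rw [ENNReal.ofReal_add hC₁ hC₂]
  exact add_le_add (hb₁ D) (hb₂ D)

theorem sobolevENorm_w_le (hδ : 0 < δmin) (hs : 1 / 2 < s) (ht : t ∈ timeInterval D.T) :
    sobolevENorm (s + 3) (D.w t)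
      ≤ ENNReal.ofReal ((linftyENorm D.T (s + 3) D.v).toReal / δmin) := by
  have hv := unifH_v μmax εmax δmin δmax s h K hδ hs
  have hpos := hδ.trans_le D.δmin_le
  have e : D.w t = fun x => (D.p.γ + D.p.δ)⁻¹ * D.v t x := by
    ext x
    unfold v
    field_simp
  rw [e, sobolevENorm_const_mul (by linarith) _ (hv.continuous ht) (hv.lt_top ht),
    abs_of_pos (by positivity), div_eq_inv_mul, ENNReal.ofReal_mul (by positivity),
    ENNReal.ofReal_toReal (hv.memLinfty D).2.ne]
  have := D.δmin_le
  gcongr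
  exact sobolevENorm_le_linftyENorm ht

/-- Makes εζ uniformly small for small ε, which keeps the depths close to their rest values 1 and
1/δ. -/
theorem abs_ζ_le (hs : 1 / 2 < s) (ht : t ∈ timeInterval D.T) (x : ℝ) :
    |D.ζ t x| ≤ (embeddingConst (s + 3) * ENNReal.ofReal K).toReal := by
  have hz := (unifC1_ζ μmax εmax δmin δmax s h K).1
  have h1 := (enorm_le_sobolevENorm (by linarith) (hz.continuous ht) (hz.lt_top ht) x).trans
    (mul_le_mul_right (D.bound_add t ht) (embeddingConst (s + 3)))
  have h2 := ENNReal.toReal_mono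
    (ENNReal.mul_lt_top (embeddingConst_lt_top (by linarith)) ENNReal.ofReal_lt_top).ne h1
  rwa [toReal_enorm, Real.norm_eq_abs] at h2

/-- A solution with small `ε`, seen as a solution whose bounds only involve the norms of `ζ`
and `v`. -/
def restrict {h' K' L : ℝ} (hδ : 0 < δmin) (hs : 1 / 2 < s)
    (hL : ∀ t ∈ timeInterval D.T,
      sobolevENorm (s + 2) (dt D.T D.ζ t) ≤
        sobolevENorm (s + 3) (D.w t) + ENNReal.ofReal (D.p.ε * L) ∧
      sobolevENorm (s + 2) (dt D.T D.w t) ≤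
        sobolevENorm (s + 3) (D.ζ t) + ENNReal.ofReal (D.p.ε * L))
    (hεL : D.p.ε * L ≤ 1)
    (hεζ : D.p.ε * (embeddingConst (s + 3) * ENNReal.ofReal K).toReal ≤ h')
    (h1 : 2 * h' ≤ 1) (h2 : 2 * h' ≤ 1 / δmax)
    (hK' : (linftyENorm D.T (s + 3) D.ζ).toReal
      + (linftyENorm D.T (s + 3) D.v).toReal / δmin + 1 ≤ K') :
    SerreData μmax εmax δmin δmax s h' K' :=
  have ha : ∀ t ∈ timeInterval D.T, sobolevENorm (s + 3) (D.ζ t)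
      ≤ ENNReal.ofReal (linftyENorm D.T (s + 3) D.ζ).toReal := fun t ht => by
    rw [ENNReal.ofReal_toReal D.memLinfty_ζ.2.ne]
    exact sobolevENorm_le_linftyENorm ht
  have hb : ∀ t ∈ timeInterval D.T, sobolevENorm (s + 3) (D.w t)
      ≤ ENNReal.ofReal ((linftyENorm D.T (s + 3) D.v).toReal / δmin) :=
    fun t ht => D.sobolevENorm_w_le hδ hs ht
  have ha0 : 0 ≤ (linftyENorm D.T (s + 3) D.ζ).toReal := ENNReal.toReal_nonneg
  have hb0 : 0 ≤ (linftyENorm D.T (s + 3) D.v).toReal / δmin :=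
    div_nonneg ENNReal.toReal_nonneg hδ.le
  have habs : ∀ t ∈ timeInterval D.T, ∀ x, |D.p.ε * D.ζ t x| ≤ h' := fun t ht x => by
    rw [abs_mul, abs_of_nonneg D.mem.2.2.1]
    exact (mul_le_mul_of_nonneg_left (D.abs_ζ_le hs ht x) D.mem.2.2.1).trans hεζ
  -- The solution and its parameters are unchanged, so a residual found for the new data is one for
  -- the old; only the bounds are replaced.
  { D with
    bound_add := fun t ht => (ha t ht).trans (ENNReal.ofReal_le_ofReal (by linarith))
    bound_sub := fun t ht => (hb t ht).trans (ENNReal.ofReal_le_ofReal (by linarith))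
    bound_dt_add := fun t ht => by
      refine (hL t ht).1.trans ((add_le_add (hb t ht) (ENNReal.ofReal_le_ofReal hεL)).trans ?_)
      rw [← ENNReal.ofReal_add hb0 zero_le_one]
      exact ENNReal.ofReal_le_ofReal (by linarith)
    bound_dt_sub := fun t ht => by
      refine (hL t ht).2.trans ((add_le_add (ha t ht) (ENNReal.ofReal_le_ofReal hεL)).trans ?_)
      rw [← ENNReal.ofReal_add ha0 zero_le_one]
      exact ENNReal.ofReal_le_ofReal (by linarith)
    depth := fun t ht x => by
      obtain ⟨h3, h4⟩ := abs_le.1 (habs t ht x)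
      have h5 : 1 / δmax ≤ 1 / D.p.δ :=
        one_div_le_one_div_of_le (D.δ_pos hδ) D.mem.2.2.2.2.2.1.le
      constructor
      · change h' ≤ 1 - D.p.ε * D.ζ t x
        linarith
      · change h' ≤ 1 / D.p.δ + D.p.ε * D.ζ t x
        linarith }

end SerreData

end

/-! ### The consistency theorem -/

theorem mainTheorem7 (μmax εmax δmin δmax s : ℝ)
    (hμ : 0 < μmax) (hε : 0 < εmax) (hδ : 0 < δmin) (hδ' : 0 < δmax) (hs : 1 / 2 < s) :
    -- for all admissible parameters, with a constant depending on `h` and the `W¹` bound `M`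
    (∀ h M : ℝ, 0 < h → 0 < M → ∃ C : ℝ, 0 < C ∧
      ∀ (S : Set Param) (T : EReal) (ul ur : Param → ℝ → ℝ → ℝ),
        S ⊆ paramSet μmax εmax δmin δmax → 0 < T → SerreFamily S T s h M ul ur →
        ConsistentGN S T s 3 serrePrecision (serreZeta ul ur) (serreVelocity ul ur)
          (fun _ _ => C)) ∧
    -- for small precision, with a constant depending only on the `L^∞([0,T); H^{s+3})` norms
    (∃ C : ℝ → ℝ → ℝ, (∀ a b a' b' : ℝ, a ≤ a' → b ≤ b' → C a b ≤ C a' b') ∧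
      ∀ h M : ℝ, 0 < h → 0 < M → ∃ ρ : ℝ, 0 < ρ ∧
      ∀ (S : Set Param) (T : EReal) (ul ur : Param → ℝ → ℝ → ℝ),
        S ⊆ paramSet μmax εmax δmin δmax → 0 < T → SerreFamily S T s h M ul ur →
        ConsistentGN {p ∈ S | serrePrecision p ≤ ρ} T s 3 serrePrecision
          (serreZeta ul ur) (serreVelocity ul ur) C) := by
  constructor
  · intro h M hh hM
    obtain ⟨C, hC, hcons⟩ := exists_consistent (μmax := μmax) (εmax := εmax) hδ hδ' hs hh M
    obtain ⟨K, hK⟩ := SerreData.exists_uniform_bound (μmax := μmax) (εmax := εmax) (δmax := δmax)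
      hδ hs h M
    exact ⟨C, hC, fun S T ul ur hS hT hF => ⟨⟨K, fun p hp => hK (hF.data hs hS hT hp)⟩,
      fun p hp => hcons (hF.data hs hS hT hp)⟩⟩
  · set h' : ℝ := min (1 / 2) (1 / (2 * δmax)) with hh'
    have hpos : 0 < h' := by positivity
    have h1 : 2 * h' ≤ 1 := by linarith [min_le_left (1 / 2) (1 / (2 * δmax))]
    have h2 : 2 * h' ≤ 1 / δmax := by
      have : 1 / δmax = 2 * (1 / (2 * δmax)) := by field_simp
      linarith [min_le_right (1 / 2) (1 / (2 * δmax))]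
    -- Integer bounds K = n suffice, and a sum of the positive constants over n is automatically
    -- monotone.
    choose Cst hCst hcons using fun n : ℕ =>
      exists_consistent (μmax := μmax) (εmax := εmax) hδ hδ' hs hpos (n : ℝ)
    -- a + b/δmin + 1 is the bound required by `restrict`. The range extends to the ceiling of it
    -- plus one, so that the term at the ceiling itself is included.
    refine ⟨fun a b => ∑ n ∈ Finset.range (⌈a + b / δmin + 1⌉₊ + 1), Cst n,
      fun a b a' b' haa hbb => ?_, fun h M hh hM => ?_⟩
    · refine Finset.sum_le_sum_of_subset_of_nonneg (Finset.range_mono ?_) fun n _ _ => (hCst n).le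
      gcongr
    · obtain ⟨K, hK⟩ := SerreData.exists_uniform_bound (μmax := μmax) (εmax := εmax) (δmax := δmax)
        hδ hs h M
      obtain ⟨L, hL0, hL⟩ := SerreData.exists_dt_bounds (εmax := εmax) hμ hδ hδ' hs h M
      set E : ℝ := (embeddingConst (s + 3) * ENNReal.ofReal M).toReal with hE
      have hE0 : 0 ≤ E := ENNReal.toReal_nonneg
      -- For ε ≤ ε₁ both εL and εE are at most h' ≤ 1/2: the O(ε) terms in the time derivatives and
      -- the size of εζ are controlled at once.
      set ε₁ : ℝ := h' / (L + E + 1) with hε₁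
      have hε₁0 : 0 < ε₁ := by positivity
      have hε₁L : ε₁ * (L + E + 1) = h' := by rw [hε₁]; field_simp
      -- Since ε⁴ is at most the precision, this threshold forces ε ≤ ε₁.
      refine ⟨ε₁ ^ 4, by positivity, fun S T ul ur hS hT hF =>
        ⟨⟨K, fun p hp => hK (hF.data hs hS hT hp.1)⟩, fun p hp => ?_⟩⟩
      set D := hF.data hs hS hT hp.1 with hD
      have hε0 : 0 ≤ D.p.ε := D.mem.2.2.1
      have hμ0 : 0 ≤ D.p.μ := D.mem.1
      have hle : D.p.ε ≤ ε₁ := by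
        have h3 : D.p.μ * D.p.ε ^ 2 + D.p.ε ^ 4 ≤ ε₁ ^ 4 := hp.2
        have h4 : 0 ≤ D.p.μ * D.p.ε ^ 2 := by positivity
        exact le_of_pow_le_pow_left₀ (n := 4) (by norm_num) hε₁0.le (by linarith)
      have hεL : D.p.ε * L ≤ 1 := by
        have := mul_le_mul_of_nonneg_right hle hL0
        linarith [mul_nonneg hε₁0.le hE0]
      have hεE : D.p.ε * E ≤ h' := by
        have := mul_le_mul_of_nonneg_right hle hE0
        linarith [mul_nonneg hε₁0.le hL0]
      obtain ⟨r₁, r₂, hsol, hr₁, hr₂, hb⟩ := hcons _ (D.restrict hδ hs (hL D) hεL hεE h1 h2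
        (Nat.le_ceil _))
      refine ⟨r₁, r₂, hsol, hr₁, hr₂, hb.trans (ENNReal.ofReal_le_ofReal ?_)⟩
      exact Finset.single_le_sum (f := Cst) (fun n _ => (hCst n).le) (Finset.self_mem_range_succ _)
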